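/- Let $\mathbf{SU}(2)$ be the group of $2\times 2$ complex unitary matrices of determinant $1$, with normalized Haar measure $\mu$. Let $X$, $Y$ be the left-invariant vector fields $Xf(g)=\frac{d}{ds}\big|_{s=0}f(g\,e^{sX})$, $Yf(g)=\frac{d}{ds}\big|_{s=0}f(g\,e^{sY})$ given by the matrices $$X=\begin{pmatrix}0&1\\-1&0\end{pmatrix},\qquad Y=\begin{pmatrix}0&i\\ i&0\end{pmatrix},$$ and let $\mathcal L=X^2+Y^2$ and $\Gamma(f,h)=\frac12\big(\mathcal L(fh)-f\mathcal Lh-h\mathcal Lf\big)$, so that $\Gamma(f,f)=(Xf)^2+(Yf)^2$ for smooth $f$. For every smooth $f:\mathbf{SU}(2)\to\mathbb R$ the Cauchy problem $\partial_t u=\mathcal L u$ ($t>0$), $u(0,\cdot)=f$, has exactly one solution that is continuous on $[0,\infty)\times \mathbf{SU}(2)$ and smooth on $\mathbf{SU}(2)$ for each $t>0$; write $P_tf=e^{t\mathcal L}f=u(t,\cdot)$. For every $t>0$ there is exactly one smooth function $p_t:\mathbf{SU}(2)\to\mathbb R$, the heat kernel issued from the identity element $e$, with $P_tf(e)=\int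 p_t f\,d\mu$ for all smooth $f$. The function $t\mapsto\int_{\mathbf{SU}(2)}p_t^2\,d\mu$ is differentiable on $(0,\infty)$; put $$A(t)=-\frac14\,\frac{\partial}{\partial t}\int_{\mathbf{SU}(2)}p_t^2\,d\mu ,\qquad t>0 .$$ Then, for every smooth $f:\mathbf{SU}(2)\to\mathbb R$, every $t>0$ and every $g\in\mathbf{SU}(2)$, $$\Gamma(P_tf,P_tf)(g)\le A(t)\left(\int_{\mathbf{SU}(2)}f^2\,d\mu-\Big(\int_{\mathbf{SU}(2)}f\,d\mu\Big)^2\right).$$ Moreover, $A$ is (strictly) decreasing on $(0,\infty)$, and $$A(t)\sim\frac{\pi^2}{128\,t^3}\quad(t\to0^+),\qquad A(t)\sim 4e^{-4t}\quad(t\to+\infty).$$ -/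

import Mathlib

open MeasureTheory Filter Topology Asymptotics

namespace SubellipticSU2

/-- The compact Lie group `SU(2)` of unitary `2 × 2` complex matrices of determinant `1`. -/
abbrev SU2 : Type := Matrix.specialUnitaryGroup (Fin 2) ℂ

/-- The Pauli matrix `X`. -/
def pauliX : Matrix (Fin 2) (Fin 2) ℂ := !![0, 1; -1, 0]

/-- The Pauli matrix `Y`. -/
def pauliY : Matrix (Fin 2) (Fin 2) ℂ := !![0, Complex.I; Complex.I, 0]

theorem pauliX_sq : pauliX * pauliX = -1 := by
  ext i j; fin_cases i <;> fin_cases j <;> simp [pauliX]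

theorem pauliY_sq : pauliY * pauliY = -1 := by
  ext i j; fin_cases i <;> fin_cases j <;> simp [pauliY]

theorem exp_smul_of_sq (J : Matrix (Fin 2) (Fin 2) ℂ) (hJ : J * J = -1) (s : ℝ) :
    NormedSpace.exp (s • J) = Real.cos s • (1 : Matrix (Fin 2) (Fin 2) ℂ) + Real.sin s • J := by
  let _ : NormedRing (Matrix (Fin 2) (Fin 2) ℂ) := Matrix.linftyOpNormedRing
  let _ : NormedAlgebra ℝ (Matrix (Fin 2) (Fin 2) ℂ) := Matrix.linftyOpNormedAlgebra
  have hc : Continuous (Complex.lift ⟨J, hJ⟩) :=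
    (Complex.lift ⟨J, hJ⟩).toLinearMap.continuous_of_finiteDimensional
  have h := NormedSpace.map_exp (Complex.lift ⟨J, hJ⟩) hc (s * Complex.I)
  have h1 : Complex.lift ⟨J, hJ⟩ (s * Complex.I) = s • J := by
    simp [Complex.liftAux_apply]
  have h2 : NormedSpace.exp ((s : ℂ) * Complex.I) = Complex.exp (s * Complex.I) := by
    rw [Complex.exp_eq_exp_ℂ]
  rw [h1, h2] at h
  refine Eq.trans h.symm ?_
  simp [Complex.liftAux_apply, Complex.exp_ofReal_mul_I_re, Complex.exp_ofReal_mul_I_im,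
    Algebra.algebraMap_eq_smul_one]

theorem exp_smul_pauliX (s : ℝ) : NormedSpace.exp (s • pauliX) =
    !![(Real.cos s : ℂ), (Real.sin s : ℂ); -(Real.sin s : ℂ), (Real.cos s : ℂ)] := by
  rw [exp_smul_of_sq _ pauliX_sq]
  ext i j; fin_cases i <;> fin_cases j <;> simp [pauliX]

theorem exp_smul_pauliY (s : ℝ) : NormedSpace.exp (s • pauliY) =
    !![(Real.cos s : ℂ), (Real.sin s : ℂ) * Complex.I;
      (Real.sin s : ℂ) * Complex.I, (Real.cos s : ℂ)] := by
  rw [exp_smul_of_sq _ pauliY_sq]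
  ext i j; fin_cases i <;> fin_cases j <;> simp [pauliY]

theorem exp_smul_pauliX_mem (s : ℝ) :
    NormedSpace.exp (s • pauliX) ∈ Matrix.specialUnitaryGroup (Fin 2) ℂ := by
  have h := Complex.sin_sq_add_cos_sq (s : ℂ)
  rw [exp_smul_pauliX, Matrix.mem_specialUnitaryGroup_iff, Matrix.mem_unitaryGroup_iff]
  constructor
  · ext i j; fin_cases i <;> fin_cases j <;>
      simp [Matrix.mul_apply, Matrix.star_apply, ← Complex.cos_conj, ← Complex.sin_conj] <;>
      first | ring1 | linear_combination h
  · simp [Matrix.det_fin_two]; linear_combination h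

theorem exp_smul_pauliY_mem (s : ℝ) :
    NormedSpace.exp (s • pauliY) ∈ Matrix.specialUnitaryGroup (Fin 2) ℂ := by
  have h := Complex.sin_sq_add_cos_sq (s : ℂ)
  have hI := Complex.I_sq
  rw [exp_smul_pauliY, Matrix.mem_specialUnitaryGroup_iff, Matrix.mem_unitaryGroup_iff]
  constructor
  · ext i j; fin_cases i <;> fin_cases j <;>
      simp [Matrix.mul_apply, Matrix.star_apply, ← Complex.cos_conj, ← Complex.sin_conj] <;>
      first | ring1 | linear_combination h - Complex.sin s ^ 2 * hI
  · simp [Matrix.det_fin_two]; linear_combination h - Complex.sin s ^ 2 * hI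

/-- The one-parameter subgroup `s ↦ exp (s X)` of `SU(2)`. -/
noncomputable def expX (s : ℝ) : SU2 := ⟨NormedSpace.exp (s • pauliX), exp_smul_pauliX_mem s⟩

/-- The one-parameter subgroup `s ↦ exp (s Y)` of `SU(2)`. -/
noncomputable def expY (s : ℝ) : SU2 := ⟨NormedSpace.exp (s • pauliY), exp_smul_pauliY_mem s⟩

/-- Smooth functions on `SU(2)`, a closed embedded submanifold of the space of `2 × 2` complex
matrices: the restrictions of smooth functions on that space. -/
def IsSmooth (f : SU2 → ℝ) : Prop :=
  ∃ F : (Fin 2 → Fin 2 → ℂ) → ℝ, ContDiff ℝ (⊤ : ℕ∞) F ∧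
    ∀ g : SU2, f g = F (fun i j => (g : Matrix (Fin 2) (Fin 2) ℂ) i j)

/-- The left-invariant vector field `X`. -/
noncomputable def fieldX (f : SU2 → ℝ) (g : SU2) : ℝ := deriv (fun s : ℝ => f (g * expX s)) 0

/-- The left-invariant vector field `Y`. -/
noncomputable def fieldY (f : SU2 → ℝ) (g : SU2) : ℝ := deriv (fun s : ℝ => f (g * expY s)) 0

/-- The sublaplacian `ℒ = X² + Y²`. -/
noncomputable def sublaplacian (f : SU2 → ℝ) (g : SU2) : ℝ :=
  fieldX (fieldX f) g + fieldY (fieldY f) g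

/-- The carré du champ `Γ(f, h) = (ℒ(f h) - f ℒ h - h ℒ f) / 2`. -/
noncomputable def carreDuChamp (f h : SU2 → ℝ) (g : SU2) : ℝ :=
  (sublaplacian (fun x => f x * h x) g - f g * sublaplacian h g - h g * sublaplacian f g) / 2

instance instContinuousInvSU2 : ContinuousInv SU2 where
  continuous_inv := by
    have h : Continuous fun g : SU2 => star (g : Matrix (Fin 2) (Fin 2) ℂ) :=
      continuous_star.comp continuous_subtype_val
    exact h.subtype_mk _

instance instIsTopologicalGroupSU2 : IsTopologicalGroup SU2 where

theorem norm_coe_apply_le_one (g : SU2) (i j : Fin 2) :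
    ‖(g : Matrix (Fin 2) (Fin 2) ℂ) i j‖ ≤ 1 :=
  entry_norm_bound_of_unitary (Matrix.specialUnitaryGroup_le_unitaryGroup g.2) i j

theorem isClosed_SU2 :
    IsClosed (Matrix.specialUnitaryGroup (Fin 2) ℂ : Set (Matrix (Fin 2) (Fin 2) ℂ)) := by
  have h : (Matrix.specialUnitaryGroup (Fin 2) ℂ : Set (Matrix (Fin 2) (Fin 2) ℂ)) =
      {A | A * star A = 1} ∩ {A | A.det = 1} := by
    ext A
    simp [Matrix.mem_specialUnitaryGroup_iff, Matrix.mem_unitaryGroup_iff]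
  rw [h]
  exact (isClosed_eq (continuous_id.mul continuous_star) continuous_const).inter
    (isClosed_eq (Continuous.matrix_det continuous_id) continuous_const)

instance instCompactSpaceSU2 : CompactSpace SU2 := by
  have hK : IsCompact (Set.univ.pi fun _ : Fin 2 => Set.univ.pi fun _ : Fin 2 =>
      Metric.closedBall (0 : ℂ) 1) :=
    isCompact_univ_pi fun _ => isCompact_univ_pi fun _ => isCompact_closedBall 0 1
  refine isCompact_iff_compactSpace.mp (IsCompact.of_isClosed_subset hK isClosed_SU2 ?_)
  intro A hA i _ j _
  simpa using norm_coe_apply_le_one ⟨A, hA⟩ i j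

noncomputable instance instMeasurableSpaceSU2 : MeasurableSpace SU2 := borel SU2

instance instBorelSpaceSU2 : BorelSpace SU2 := ⟨rfl⟩

/-- The normalized Haar measure `μ` of the compact group `SU(2)`, with `μ (SU(2)) = 1`. -/
noncomputable def haar : Measure SU2 := Measure.haarMeasure ⊤

/-- `u` is the solution of the Cauchy problem `∂ₜ u = ℒ u`, `u(0, ·) = f`: it is continuous on
`[0, ∞) × SU(2)`, smooth in space for each `t > 0`, and satisfies the equation for `t > 0`. -/
def IsHeatSolution (f : SU2 → ℝ) (u : ℝ → SU2 → ℝ) : Prop :=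
  u 0 = f ∧
  ContinuousOn (fun q : ℝ × SU2 => u q.1 q.2) (Set.Ici 0 ×ˢ Set.univ) ∧
  (∀ t : ℝ, 0 < t → IsSmooth (u t)) ∧
  ∀ t : ℝ, 0 < t → ∀ g : SU2, HasDerivAt (fun s : ℝ => u s g) (sublaplacian (u t) g) t

/-- The heat semigroup `Pₜ f = exp (t ℒ) f` on smooth functions `f`: the value at time `t` of the
solution of the Cauchy problem with initial datum `f` (it exists and is unique for `t ≥ 0`). -/
noncomputable def heatSemigroup (t : ℝ) (f : SU2 → ℝ) : SU2 → ℝ :=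
  Classical.epsilon (IsHeatSolution f) t

/-- `p` is the smooth density, with respect to Haar measure, of the heat kernel measure at time `t`
issued from the identity. -/
def IsHeatKernel (t : ℝ) (p : SU2 → ℝ) : Prop :=
  IsSmooth p ∧ ∀ f : SU2 → ℝ, IsSmooth f → heatSemigroup t f 1 = ∫ h, p h * f h ∂haar

/-- The heat kernel `pₜ` issued from the identity (it exists and is unique for `t > 0`). -/
noncomputable def heatKernel (t : ℝ) : SU2 → ℝ := Classical.epsilon (IsHeatKernel t)

/-- `A(t) = -(1/4) ∂ₜ ∫ pₜ² dμ`. -/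
noncomputable def gradConst (t : ℝ) : ℝ :=
  -(1 / 4) * deriv (fun s : ℝ => ∫ g, heatKernel s g ^ 2 ∂haar) t

end SubellipticSU2

/-!
The waves `(x a + y c) ^ p (x b + y d) ^ s`, functions of the matrix with rows `(a, b)`, `(c, d)`,
are eigenfunctions of `ℒ` for the eigenvalue `-λ`, where `λ = (2 p + 1) (2 s + 1) - 1`, and their
span is dense. Convolution with the diagonal coefficient `D_{p, s}`, the coefficient of `z ^ p` in
`(a z + c) ^ p (b z + d) ^ s`, divides waves of type `(p, s)` by `p + s + 1` and kills the others,
so the heat kernel is `p_t = ∑ (p + s + 1) exp (-λ t) D_{p, s}`. Solutions of the Cauchy problem are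
unique by the maximum principle.

By left invariance `X P_t f (g)` and `Y P_t f (g)` are the inner products of `f - ∫ f` with
`h ↦ X p_t (h⁻¹ g)` and `h ↦ Y p_t (h⁻¹ g)`, which have mean zero. Conjugation by a diagonal
element of `SU(2)` fixes `p_t` and rotates `X` to `Y`, so `X p_t` and `Y p_t` are orthogonal of
equal norm, and integration by parts identifies the square of this norm with `A(t)`. Bessel's
inequality is then the gradient bound.

Finally `2 A(t) = ∑ λ (p + s + 1) exp (-2 t λ)`. Every term with `λ ≠ 0` decreases, and the two
terms with `λ = 2` dominate as `t → ∞`. By symmetry `p + s + 1` may be replaced by `2 p + 1`, which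
makes the sum over `p` elementary; its leading terms as `t → 0` are summed over `s` by
`∑ 1 / (2 s + 1) ^ 2 = π ^ 2 / 8`.
-/

namespace SubellipticSU2

/-! ### Haar measure on a compact group -/

section CompactGroup

variable {G : Type*} [Group G] [TopologicalSpace G] [IsTopologicalGroup G]
  [MeasurableSpace G] [BorelSpace G] (μ : Measure G) [IsProbabilityMeasure μ] [μ.IsHaarMeasure]

theorem isMulRightInvariant_of_isHaarMeasure [LocallyCompactSpace G] : μ.IsMulRightInvariant where
  map_mul_right_eq_self g := by
    have : IsProbabilityMeasure (μ.map (· * g)) :=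
      Measure.isProbabilityMeasure_map (continuous_mul_const g).aemeasurable
    exact Measure.isHaarMeasure_eq_of_isProbabilityMeasure _ _

theorem isInvInvariant_of_isHaarMeasure [LocallyCompactSpace G] : μ.IsInvInvariant where
  inv_eq_self := by
    have : μ.IsMulRightInvariant := isMulRightInvariant_of_isHaarMeasure μ
    have : IsProbabilityMeasure μ.inv :=
      Measure.isProbabilityMeasure_map continuous_inv.aemeasurable
    have : μ.inv.IsHaarMeasure :=
      { (inferInstance : μ.inv.IsMulLeftInvariant) with
        lt_top_of_isCompact := fun _ _ => measure_lt_top _ _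
        open_pos := (inferInstance : μ.inv.IsOpenPosMeasure).open_pos }
    exact Measure.isHaarMeasure_eq_of_isProbabilityMeasure _ _

end CompactGroup

theorem integral_comp_inv_mul {G E : Type*} [Group G] [MeasurableSpace G] [MeasurableMul G]
    [MeasurableInv G] [NormedAddCommGroup E] [NormedSpace ℝ E] (μ : Measure G)
    [μ.IsMulRightInvariant] [μ.IsInvInvariant] (f : G → E) (g : G) :
    ∫ h, f (h⁻¹ * g) ∂μ = ∫ h, f h ∂μ := by
  rw [integral_inv_eq_self (fun h => f (h * g)) μ, integral_mul_right_eq_self]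

/-! ### Derivatives at maxima -/

theorem deriv_deriv_nonpos_of_isLocalMax {φ : ℝ → ℝ} {x : ℝ} (hφ : ContinuousAt φ x)
    (hmax : IsLocalMax φ x) : deriv (deriv φ) x ≤ 0 := by
  by_contra! hpos
  have hmin := isLocalMin_of_deriv_deriv_pos hpos hmax.deriv_eq_zero hφ
  have hconst : φ =ᶠ[𝓝 x] fun _ => φ x := by
    filter_upwards [hmax, hmin] with s h h' using le_antisymm h h'
  have hzero : deriv (deriv φ) x = 0 := by simpa using hconst.deriv.deriv_eq
  exact hpos.ne' hzero

theorem nonneg_of_hasDerivAt_of_eventually_le {w : ℝ → ℝ} {w' t : ℝ} (hw : HasDerivAt w w' t)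
    (hmax : ∀ᶠ s in 𝓝[<] t, w s ≤ w t) : 0 ≤ w' := by
  have h := (hasDerivWithinAt_iff_tendsto_slope' (s := Set.Iio t) (by simp)).1
    hw.hasDerivWithinAt
  refine ge_of_tendsto h ?_
  filter_upwards [hmax, self_mem_nhdsWithin] with s hs (hst : s < t)
  rw [slope_def_field]
  exact div_nonneg_of_nonpos (sub_nonpos.2 hs) (sub_nonpos.2 hst.le)

/-! ### Integrals over a compact space depending on a parameter -/

section ParametricIntegral

variable {K : Type*} [TopologicalSpace K] [CompactSpace K]
  {E : Type*} [NormedAddCommGroup E] {F : Type*} [NormedAddCommGroup F]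

theorem exists_eventually_forall_norm_le {X : Type*} [TopologicalSpace X] {f : X → K → F} {x : X}
    (hf : ∀ k, ContinuousAt ↿f (x, k)) : ∃ C, ∀ᶠ y in 𝓝 x, ∀ k, ‖f y k‖ ≤ C := by
  have hfx : Continuous fun k => ‖f x k‖ :=
    continuous_iff_continuousAt.2 fun k =>
      ((hf k).comp (f := fun k => (x, k)) (Continuous.prodMk_right x).continuousAt).norm
  obtain ⟨C, hC⟩ := (isCompact_range hfx).bddAbove
  refine ⟨C + 1, ?_⟩
  have h := isCompact_univ.eventually_forall_of_forall_eventually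
    (P := fun y k => ‖f y k‖ ≤ C + 1) (x₀ := x) fun k _ =>
      ((hf k).norm.eventually_lt_const
        ((hC ⟨k, rfl⟩).trans_lt (lt_add_one C))).mono fun _ h => h.le
  exact h.mono fun y hy k => hy k trivial

variable [MeasurableSpace K] [BorelSpace K] (μ : Measure K) [IsFiniteMeasure μ]

variable {μ} in
theorem integrable_of_continuous {f : K → F} (hf : Continuous f) : Integrable f μ :=
  hf.integrable_of_hasCompactSupport (HasCompactSupport.of_compactSpace f)

variable [NormedSpace ℝ F]

theorem continuousAt_integral {X : Type*} [TopologicalSpace X] [FirstCountableTopology X]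
    {f : X → K → F} {x : X} (hf : ∀ᶠ y in 𝓝 x, Continuous (f y))
    (hfx : ∀ k, ContinuousAt ↿f (x, k)) : ContinuousAt (fun y => ∫ k, f y k ∂μ) x := by
  obtain ⟨C, hC⟩ := exists_eventually_forall_norm_le hfx
  refine continuousAt_of_dominated (bound := fun _ => C)
    (hf.mono fun y hy => (integrable_of_continuous hy).aestronglyMeasurable)
    (hC.mono fun y hy => .of_forall hy) (integrable_const C) (.of_forall fun k => ?_)
  exact (hfx k).comp (f := fun y => (y, k)) (Continuous.prodMk_left k).continuousAt

theorem continuous_integral {X : Type*} [TopologicalSpace X] [FirstCountableTopology X]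
    {f : X → K → F} (hf : Continuous ↿f) : Continuous fun y => ∫ k, f y k ∂μ :=
  continuous_iff_continuousAt.2 fun _ => continuousAt_integral μ
    (.of_forall fun y => hf.comp (.prodMk_right y)) fun _ => hf.continuousAt

section HasFDerivAt

variable {𝕜 : Type*} [RCLike 𝕜] [NormedSpace 𝕜 F]

theorem hasFDerivAt_integral [NormedSpace 𝕜 E] {f : E → K → F} {f' : E → K → E →L[𝕜] F} {x : E}
    (hf : ∀ᶠ y in 𝓝 x, Continuous (f y)) (hf' : ∀ k, ContinuousAt ↿f' (x, k))
    (hd : ∀ᶠ y in 𝓝 x, ∀ k, HasFDerivAt (f · k) (f' y k) y) :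
    HasFDerivAt (fun y => ∫ k, f y k ∂μ) (∫ k, f' x k ∂μ) x := by
  obtain ⟨C, hC⟩ := exists_eventually_forall_norm_le hf'
  have hf'x : Continuous (f' x) := continuous_iff_continuousAt.2 fun k =>
    (hf' k).comp (f := fun k => (x, k)) (Continuous.prodMk_right x).continuousAt
  exact hasFDerivAt_integral_of_dominated_of_fderiv_le (hC.and hd)
    (hf.mono fun y hy => (integrable_of_continuous hy).aestronglyMeasurable)
    (integrable_of_continuous hf.self_of_nhds)
    (integrable_of_continuous hf'x).aestronglyMeasurable
    (.of_forall fun k y hy => hy.1 k) (integrable_const C) (.of_forall fun k y hy => hy.2 k)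

theorem hasDerivAt_integral {f f' : 𝕜 → K → F} {x : 𝕜}
    (hf : ∀ᶠ y in 𝓝 x, Continuous (f y)) (hf' : ∀ k, ContinuousAt ↿f' (x, k))
    (hd : ∀ᶠ y in 𝓝 x, ∀ k, HasDerivAt (f · k) (f' y k) y) :
    HasDerivAt (fun y => ∫ k, f y k ∂μ) (∫ k, f' x k ∂μ) x := by
  obtain ⟨C, hC⟩ := exists_eventually_forall_norm_le hf'
  have hf'x : Continuous (f' x) := continuous_iff_continuousAt.2 fun k =>
    (hf' k).comp (f := fun k => (x, k)) (Continuous.prodMk_right x).continuousAt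
  exact (hasDerivAt_integral_of_dominated_loc_of_deriv_le (hC.and hd)
    (hf.mono fun y hy => (integrable_of_continuous hy).aestronglyMeasurable)
    (integrable_of_continuous hf.self_of_nhds)
    (integrable_of_continuous hf'x).aestronglyMeasurable
    (.of_forall fun k y hy => hy.1 k) (integrable_const C) (.of_forall fun k y hy => hy.2 k)).2

theorem contDiff_integral [NormedSpace 𝕜 E] {f : E → K → F} {n : ℕ∞}
    (hf : ∀ k, ContDiff 𝕜 n (f · k))
    (hc : ∀ m : ℕ, m ≤ n → Continuous fun q : E × K => iteratedFDeriv 𝕜 m (f · q.2) q.1) :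
    ContDiff 𝕜 n fun x => ∫ k, f x k ∂μ := by
  refine HasFTaylorSeriesUpTo.contDiff
    (f' := fun x m => ∫ k, iteratedFDeriv 𝕜 m (f · k) x ∂μ) ⟨fun x => ?_, fun m hm x => ?_,
      fun m hm => continuous_integral μ (hc m (by exact_mod_cast hm))⟩
  · have h := (continuousMultilinearCurryFin0 𝕜 E F).toContinuousLinearEquiv.integral_comp_comm
      (μ := μ) fun k => iteratedFDeriv 𝕜 0 (f · k) x
    exact h.symm.trans (by simp)
  · have hm : (m : ℕ∞) < n := by exact_mod_cast hm
    have h := ContinuousLinearEquiv.integral_comp_comm (𝕜 := 𝕜) (μ := μ)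
      (E := E [×(m + 1)]→L[𝕜] F) (F := E →L[𝕜] E [×m]→L[𝕜] F)
      (continuousMultilinearCurryLeftEquiv 𝕜 (fun _ : Fin (m + 1) => E) F).toContinuousLinearEquiv
      fun k => iteratedFDeriv 𝕜 (m + 1) (f · k) x
    have hcm := hc m hm.le
    have hcs := hc (m + 1) (by exact_mod_cast Order.add_one_le_of_lt hm)
    refine (hasFDerivAt_integral μ (f' := fun y k => fderiv 𝕜 (iteratedFDeriv 𝕜 m (f · k)) y)
      (.of_forall fun y => hcm.comp (Continuous.prodMk_right y)) (fun k => ?_)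
      (.of_forall fun y k => ?_)).congr_fderiv h
    · exact ((continuousMultilinearCurryLeftEquiv 𝕜
        (fun _ : Fin (m + 1) => E) F).continuous.comp hcs).continuousAt
    · exact ((hf k).differentiable_iteratedFDeriv (by exact_mod_cast hm) y).hasFDerivAt

theorem contDiff_integral_smul_comp_clm {E' : Type*} [NormedAddCommGroup E'] [NormedSpace 𝕜 E]
    [NormedSpace 𝕜 E'] {n : ℕ∞} {P : E' → F} (hP : ContDiff 𝕜 n P) {T : K → E →L[𝕜] E'}
    (hT : Continuous T) {w : K → 𝕜} (hw : Continuous w) :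
    ContDiff 𝕜 n fun x => ∫ k, w k • P (T k x) ∂μ := by
  have hPT : ∀ k, ContDiff 𝕜 n (P ∘ T k) := fun k => hP.comp (T k).contDiff
  refine contDiff_integral μ (fun k => (hPT k).const_smul (w k)) fun m hm => ?_
  have hm' : (m : WithTop ℕ∞) ≤ n := by exact_mod_cast hm
  have hiter : ∀ q : E × K, iteratedFDeriv 𝕜 m (fun x => w q.2 • P (T q.2 x)) q.1 =
      w q.2 • ContinuousMultilinearMap.compContinuousLinearMapContinuousMultilinear 𝕜
        (fun _ : Fin m => E) (fun _ => E') F (fun _ => T q.2)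
        (iteratedFDeriv 𝕜 m P (T q.2 q.1)) := fun q => by
    refine (iteratedFDeriv_const_smul_apply' ((hPT q.2).of_le hm').contDiffAt).trans ?_
    rw [(T q.2).iteratedFDeriv_comp_right hP q.1 hm']
    rfl
  have hPm := hP.continuous_iteratedFDeriv hm'
  have hcomp := (ContinuousMultilinearMap.compContinuousLinearMapContinuousMultilinear 𝕜
    (fun _ : Fin m => E) (fun _ => E') F).cont
  have hTq : Continuous fun q : E × K => fun _ : Fin m => T q.2 := by fun_prop
  simp only [hiter]
  exact (hw.comp continuous_snd).smul ((hcomp.comp hTq).clm_apply (hPm.comp (by fun_prop)))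

end HasFDerivAt

end ParametricIntegral

/-! ### Normally convergent series of holomorphic functions -/

/-- A family of functions on a normed space is locally normally summable on `U` if near every point
of `U` it is dominated in norm by a summable family of constants. -/
def LocallyNormallySummable {I E F : Type*} [NormedAddCommGroup E] [NormedAddCommGroup F]
    (f : I → E → F) (U : Set E) : Prop :=
  ∀ x ∈ U, ∃ r > 0, ∃ B : I → ℝ, Summable B ∧ ∀ i, ∀ y ∈ Metric.ball x r, ‖f i y‖ ≤ B i

section Holomorphic

variable {I E F : Type*} [NormedAddCommGroup E] [NormedAddCommGroup F] {f : I → E → F} {U : Set E}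

theorem LocallyNormallySummable.summable [CompleteSpace F] (h : LocallyNormallySummable f U)
    {x : E} (hx : x ∈ U) : Summable fun i => f i x := by
  obtain ⟨r, hr, B, hB, hfB⟩ := h x hx
  exact .of_norm_bounded hB fun i => hfB i x (Metric.mem_ball_self hr)

variable [NormedSpace ℂ E] [NormedSpace ℂ F]

theorem norm_fderiv_le_of_forall_mem_ball {φ : E → F} (hφ : Differentiable ℂ φ) {x : E} {r C : ℝ}
    (hr : 0 < r) (hC : ∀ y ∈ Metric.ball x r, ‖φ y‖ ≤ C) : ‖fderiv ℂ φ x‖ ≤ 2 * C / r := by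
  refine Complex.norm_fderiv_le_div_of_mapsTo_ball hφ.differentiableOn (fun y hy => ?_) hr
  rw [Metric.mem_closedBall, dist_eq_norm]
  linarith [norm_sub_le (φ y) (φ x), hC y hy, hC x (Metric.mem_ball_self hr)]

namespace LocallyNormallySummable

protected theorem fderiv (h : LocallyNormallySummable f U) (hf : ∀ i, Differentiable ℂ (f i)) :
    LocallyNormallySummable (fun i => fderiv ℂ (f i)) U := by
  intro x hx
  obtain ⟨r, hr, B, hB, hfB⟩ := h x hx
  refine ⟨r / 2, by positivity, fun i => 2 * B i / (r / 2), (hB.mul_left 2).div_const _,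
    fun i y hy => norm_fderiv_le_of_forall_mem_ball (hf i) (by positivity) fun z hz =>
      hfB i z ?_⟩
  rw [Metric.mem_ball] at *
  linarith [dist_triangle z y x]

theorem hasFDerivAt_tsum [CompleteSpace F] (h : LocallyNormallySummable f U)
    (hf : ∀ i, Differentiable ℂ (f i)) {x : E} (hx : x ∈ U) :
    HasFDerivAt (fun y => ∑' i, f i y) (∑' i, fderiv ℂ (f i) x) x := by
  obtain ⟨r, hr, B, hB, hfB⟩ := h.fderiv hf x hx
  let _ : NormedSpace ℝ E := NormedSpace.restrictScalars ℝ ℂ E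
  exact hasFDerivAt_tsum_of_isPreconnected hB Metric.isOpen_ball
    (convex_ball x r).isPreconnected (fun i y _ => (hf i y).hasFDerivAt) hfB
    (Metric.mem_ball_self hr) (h.summable hx) (Metric.mem_ball_self hr)

theorem iteratedFDeriv (h : LocallyNormallySummable f U) (hf : ∀ i, ContDiff ℂ (⊤ : ℕ∞) (f i))
    (n : ℕ) : LocallyNormallySummable (fun i => iteratedFDeriv ℂ n (f i)) U := by
  induction n with
  | zero => simpa [LocallyNormallySummable] using h
  | succ n ih =>
    simpa [LocallyNormallySummable, norm_fderiv_iteratedFDeriv] using ih.fderiv fun i =>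
      (hf i).differentiable_iteratedFDeriv (by exact_mod_cast WithTop.coe_lt_top n)

theorem contDiffOn_tsum [CompleteSpace F] (h : LocallyNormallySummable f U)
    (hf : ∀ i, ContDiff ℂ (⊤ : ℕ∞) (f i)) :
    ContDiffOn ℂ (⊤ : ℕ∞) (fun y => ∑' i, f i y) U := by
  have hfd : ∀ n i, Differentiable ℂ (_root_.iteratedFDeriv ℂ n (f i)) := fun n i =>
    (hf i).differentiable_iteratedFDeriv (by exact_mod_cast WithTop.coe_lt_top n)
  have hder : ∀ n x, x ∈ U → HasFDerivAt (fun y => ∑' i, _root_.iteratedFDeriv ℂ n (f i) y)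
      (∑' i, _root_.iteratedFDeriv ℂ (n + 1) (f i) x).curryLeft x := fun n x hx => by
    refine ((h.iteratedFDeriv hf n).hasFDerivAt_tsum (hfd n) hx).congr_fderiv ?_
    exact (ContinuousLinearEquiv.map_tsum (f := fun i => _root_.iteratedFDeriv ℂ (n + 1) (f i) x)
      (continuousMultilinearCurryLeftEquiv ℂ
        (fun _ : Fin (n + 1) => E) F).toContinuousLinearEquiv).symm
  refine HasFTaylorSeriesUpToOn.contDiffOn
    (f' := fun x n => ∑' i, _root_.iteratedFDeriv ℂ n (f i) x)
    ⟨fun x _ => ?_, fun n _ x hx => (hder n x hx).hasFDerivWithinAt,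
      fun n _ x hx => (hder n x hx).continuousAt.continuousWithinAt⟩
  exact (continuousMultilinearCurryFin0 ℂ E F).toContinuousLinearEquiv.map_tsum.trans
    (tsum_congr fun i => by simp)

end LocallyNormallySummable

end Holomorphic

/-! ### The group `SU(2)` in its ambient space -/

instance instIsHaarMeasureHaar : haar.IsHaarMeasure := by
  unfold haar; infer_instance

instance instIsProbabilityMeasureHaar : IsProbabilityMeasure haar where
  measure_univ := by
    have h := Measure.haarMeasure_self (G := SU2) (K₀ := ⊤)
    simpa [haar] using h

instance instIsMulRightInvariantHaar : haar.IsMulRightInvariant :=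
  isMulRightInvariant_of_isHaarMeasure haar

instance instIsInvInvariantHaar : haar.IsInvInvariant := isInvInvariant_of_isHaarMeasure haar

/-- The ambient normed space of `2 × 2` complex matrices; unlike `Matrix`, the iterated function
type carries a norm, and it is the type used in `IsSmooth`. -/
abbrev Mat : Type := Fin 2 → Fin 2 → ℂ

/-- The inclusion of `SU(2)` in the ambient space. -/
def emb (g : SU2) : Mat := fun i j => (g : Matrix (Fin 2) (Fin 2) ℂ) i j

theorem continuous_emb : Continuous emb := continuous_subtype_val

instance instFirstCountableTopologySU2 : FirstCountableTopology SU2 :=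
  (Topology.IsInducing.subtypeVal : Topology.IsInducing emb).firstCountableTopology

theorem emb_injective : Function.Injective emb := Subtype.val_injective

theorem continuous_emb_apply (i j : Fin 2) : Continuous fun g => emb g i j :=
  (continuous_apply_apply i j).comp continuous_emb

theorem emb_one (i j : Fin 2) : emb 1 i j = if i = j then 1 else 0 :=
  Matrix.one_apply (i := i) (j := j)

theorem emb_mul (g h : SU2) (i j : Fin 2) :
    emb (g * h) i j = emb g i 0 * emb h 0 j + emb g i 1 * emb h 1 j := by
  simp [emb, Matrix.mul_apply]

theorem emb_inv (g : SU2) (i j : Fin 2) : emb g⁻¹ i j = star (emb g j i) := rfl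

theorem emb_det (g : SU2) : emb g 0 0 * emb g 1 1 - emb g 0 1 * emb g 1 0 = 1 := by
  have h := (Matrix.mem_specialUnitaryGroup_iff.1 g.2).2
  rwa [Matrix.det_fin_two] at h

theorem emb_row_mul_star (g : SU2) (i j : Fin 2) :
    emb g i 0 * star (emb g j 0) + emb g i 1 * star (emb g j 1) = if i = j then 1 else 0 := by
  rw [← emb_one, ← mul_inv_cancel g, emb_mul, emb_inv, emb_inv]

theorem emb_one_one (g : SU2) : emb g 1 1 = star (emb g 0 0) := by
  have hdet := emb_det g
  have hrow := emb_row_mul_star g 0 0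
  have horth := emb_row_mul_star g 1 0
  simp only [if_true, one_ne_zero, if_false] at hrow horth
  linear_combination (-emb g 1 1) * hrow + star (emb g 0 0) * hdet + emb g 0 1 * horth

theorem emb_one_zero (g : SU2) : emb g 1 0 = -star (emb g 0 1) := by
  have hdet := emb_det g
  have hrow := emb_row_mul_star g 0 0
  have horth := emb_row_mul_star g 1 0
  simp only [if_true, one_ne_zero, if_false] at hrow horth
  linear_combination (-emb g 1 0) * hrow - star (emb g 0 1) * hdet + emb g 0 0 * horth

/-- The element of `SU(2)` with first row `(a, b)`. -/
def mk (a b : ℂ) (h : Complex.normSq a + Complex.normSq b = 1) : SU2 :=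
  ⟨!![a, b; -star b, star a], by
    have h' : a * (starRingEnd ℂ) a + b * (starRingEnd ℂ) b = 1 := by
      rw [Complex.mul_conj, Complex.mul_conj]
      exact_mod_cast h
    have h'' : b * (starRingEnd ℂ) b + a * (starRingEnd ℂ) a = 1 := by rw [add_comm, h']
    rw [Matrix.mem_specialUnitaryGroup_iff, Matrix.mem_unitaryGroup_iff]
    constructor
    · ext i j; fin_cases i <;> fin_cases j <;>
        simp [Matrix.mul_apply, Matrix.star_apply, mul_comm, h', h'']
    · simpa [Matrix.det_fin_two] using h'⟩

theorem emb_mk (a b : ℂ) (h) : emb (mk a b h) = ![![a, b], ![-star b, star a]] := rfl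

/-- Left multiplication by a group element, on the ambient space. -/
noncomputable def leftMul (g : SU2) : Mat →L[ℂ] Mat :=
  LinearMap.toContinuousLinearMap
    { toFun := fun A i j => emb g i 0 * A 0 j + emb g i 1 * A 1 j
      map_add' := fun A B => by ext i j; simp only [Pi.add_apply]; ring
      map_smul' := fun c A => by
        ext i j; simp only [Pi.smul_apply, smul_eq_mul, RingHom.id_apply]; ring }

theorem leftMul_apply (g : SU2) (A : Mat) (i j : Fin 2) :
    leftMul g A i j = emb g i 0 * A 0 j + emb g i 1 * A 1 j := rfl

theorem leftMul_emb (g h : SU2) : leftMul g (emb h) = emb (g * h) := by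
  ext i j; rw [leftMul_apply, emb_mul]

theorem continuous_leftMul : Continuous leftMul := by
  rw [continuous_clm_apply]
  intro A
  refine continuous_pi fun i => continuous_pi fun j => ?_
  simp only [leftMul_apply]
  have := continuous_emb_apply
  fun_prop

/-- Right multiplication by a matrix, on the ambient space. -/
noncomputable def rightMul (J : Matrix (Fin 2) (Fin 2) ℂ) : Mat →L[ℂ] Mat :=
  LinearMap.toContinuousLinearMap
    { toFun := fun A i j => A i 0 * J 0 j + A i 1 * J 1 j
      map_add' := fun A B => by ext i j; simp only [Pi.add_apply]; ring
      map_smul' := fun c A => by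
        ext i j; simp only [Pi.smul_apply, smul_eq_mul, RingHom.id_apply]; ring }

theorem rightMul_apply (J : Matrix (Fin 2) (Fin 2) ℂ) (A : Mat) (i j : Fin 2) :
    rightMul J A i j = A i 0 * J 0 j + A i 1 * J 1 j := rfl

theorem rightMul_rightMul (J J' : Matrix (Fin 2) (Fin 2) ℂ) (A : Mat) :
    rightMul J' (rightMul J A) = rightMul (J * J') A := by
  ext i j
  simp only [rightMul_apply, Matrix.mul_apply, Fin.sum_univ_two]
  ring

@[simp] theorem rightMul_pauliX_zero (A : Mat) (i : Fin 2) : rightMul pauliX A i 0 = -A i 1 := by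
  simp [rightMul_apply, pauliX]

@[simp] theorem rightMul_pauliX_one (A : Mat) (i : Fin 2) : rightMul pauliX A i 1 = A i 0 := by
  simp [rightMul_apply, pauliX]

@[simp] theorem rightMul_pauliY_zero (A : Mat) (i : Fin 2) :
    rightMul pauliY A i 0 = Complex.I * A i 1 := by
  simp [rightMul_apply, pauliY, mul_comm]

@[simp] theorem rightMul_pauliY_one (A : Mat) (i : Fin 2) :
    rightMul pauliY A i 1 = Complex.I * A i 0 := by
  simp [rightMul_apply, pauliY, mul_comm]

/-- `γ` is the one-parameter subgroup `s ↦ exp (s J)`, generated by a matrix `J` of square `-1`.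
It lets the fields `X` and `Y` be treated at once. -/
structure IsDirection (γ : ℝ → SU2) (J : Matrix (Fin 2) (Fin 2) ℂ) : Prop where
  coe_apply : ∀ s, (γ s : Matrix (Fin 2) (Fin 2) ℂ) = NormedSpace.exp (s • J)
  mul_self : J * J = -1

theorem isDirection_expX : IsDirection expX pauliX := ⟨fun _ => rfl, pauliX_sq⟩

theorem isDirection_expY : IsDirection expY pauliY := ⟨fun _ => rfl, pauliY_sq⟩

section Direction

variable {γ : ℝ → SU2} {J : Matrix (Fin 2) (Fin 2) ℂ}

namespace IsDirection

theorem rightMul_rightMul_self (hd : IsDirection γ J) (A : Mat) :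
    rightMul J (rightMul J A) = -A := by
  ext i j
  rw [rightMul_rightMul, hd.mul_self, rightMul_apply]
  fin_cases j <;> simp

theorem emb_mul_eq (hd : IsDirection γ J) (g : SU2) (s : ℝ) :
    emb (g * γ s) = (Real.cos s : ℂ) • emb g + (Real.sin s : ℂ) • rightMul J (emb g) := by
  have hγ : ∀ i j, emb (γ s) i j = _ := fun i j =>
    congrFun (congrFun ((hd.coe_apply s).trans (exp_smul_of_sq J hd.mul_self s)) i) j
  ext i j
  rw [emb_mul, hγ, hγ]
  fin_cases j <;> simp [rightMul_apply] <;> ring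

theorem apply_zero (hd : IsDirection γ J) : γ 0 = 1 := by
  apply Subtype.val_injective
  simp [hd.coe_apply]

theorem hasDerivAt (hd : IsDirection γ J) (g : SU2) (s : ℝ) :
    HasDerivAt (fun s => emb (g * γ s)) (rightMul J (emb (g * γ s))) s := by
  rw [funext fun s => hd.emb_mul_eq g s, hd.emb_mul_eq]
  have hcos := ((Real.hasDerivAt_cos s).ofReal_comp).smul_const (emb g)
  have hsin := ((Real.hasDerivAt_sin s).ofReal_comp).smul_const (rightMul J (emb g))
  refine (hcos.add hsin).congr_deriv ?_
  simp only [map_add, map_smul, hd.rightMul_rightMul_self]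
  push_cast
  module

theorem continuous (hd : IsDirection γ J) : Continuous γ := by
  have h : Continuous fun s => emb (1 * γ s) :=
    continuous_iff_continuousAt.2 fun s => (hd.hasDerivAt 1 s).continuousAt
  simp only [one_mul] at h
  exact continuous_induced_rng.2 h

end IsDirection

/-! ### Smooth functions and left-invariant fields -/

theorem isSmooth_const (c : ℝ) : IsSmooth fun _ => c := ⟨fun _ => c, contDiff_const, fun _ => rfl⟩

namespace IsSmooth

variable {f h : SU2 → ℝ}

theorem continuous (hf : IsSmooth f) : Continuous f := by
  obtain ⟨F, hF, hfF⟩ := hf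
  rw [funext hfF]
  exact hF.continuous.comp continuous_emb

theorem add (hf : IsSmooth f) (hh : IsSmooth h) : IsSmooth fun g => f g + h g := by
  obtain ⟨F, hF, hfF⟩ := hf
  obtain ⟨H, hH, hhH⟩ := hh
  exact ⟨fun A => F A + H A, hF.add hH, fun g => congrArg₂ _ (hfF g) (hhH g)⟩

theorem mul (hf : IsSmooth f) (hh : IsSmooth h) : IsSmooth fun g => f g * h g := by
  obtain ⟨F, hF, hfF⟩ := hf
  obtain ⟨H, hH, hhH⟩ := hh
  exact ⟨fun A => F A * H A, hF.mul hH, fun g => congrArg₂ _ (hfF g) (hhH g)⟩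

theorem const_mul (hf : IsSmooth f) (c : ℝ) : IsSmooth fun g => c * f g :=
  (isSmooth_const c).mul hf

theorem neg (hf : IsSmooth f) : IsSmooth fun g => -f g := by
  simpa using hf.const_mul (-1)

theorem sub (hf : IsSmooth f) (hh : IsSmooth h) : IsSmooth fun g => f g - h g := by
  simpa [sub_eq_add_neg] using hf.add hh.neg

end IsSmooth

/-- The derivative along a one-parameter subgroup acting on the right. -/
noncomputable def fieldAlong (γ : ℝ → SU2) (f : SU2 → ℝ) (g : SU2) : ℝ :=
  deriv (fun s : ℝ => f (g * γ s)) 0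

theorem fieldX_eq_fieldAlong : fieldX = fieldAlong expX := rfl

theorem fieldY_eq_fieldAlong : fieldY = fieldAlong expY := rfl

theorem sublaplacian_eq_fieldAlong (f : SU2 → ℝ) (g : SU2) : sublaplacian f g =
    fieldAlong expX (fieldAlong expX f) g + fieldAlong expY (fieldAlong expY f) g := rfl

theorem IsDirection.hasDerivAt_comp_emb (hd : IsDirection γ J) {F : Mat → ℝ}
    (hF : Differentiable ℝ F) (g : SU2) (s : ℝ) :
    HasDerivAt (fun s => F (emb (g * γ s)))
      (fderiv ℝ F (emb (g * γ s)) (rightMul J (emb (g * γ s)))) s :=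
  (hF _).hasFDerivAt.comp_hasDerivAt s (hd.hasDerivAt g s)

theorem IsDirection.fieldAlong_comp_emb (hd : IsDirection γ J) {F : Mat → ℝ}
    (hF : Differentiable ℝ F) (g : SU2) :
    fieldAlong γ (fun g => F (emb g)) g = fderiv ℝ F (emb g) (rightMul J (emb g)) := by
  simpa only [fieldAlong, hd.apply_zero, mul_one] using (hd.hasDerivAt_comp_emb hF g 0).deriv

namespace IsSmooth

variable {f h : SU2 → ℝ}

protected theorem fieldAlong (hd : IsDirection γ J) (hf : IsSmooth f) :
    IsSmooth (fieldAlong γ f) := by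
  obtain ⟨F, hF, hfF⟩ := hf
  refine ⟨fun A => fderiv ℝ F A (rightMul J A), ?_, fun g => ?_⟩
  · have hF' : ContDiff ℝ (⊤ : ℕ∞) (fderiv ℝ F) := hF.fderiv_right (by simp)
    exact hF'.clm_apply ((rightMul J).restrictScalars ℝ).contDiff
  · rw [funext hfF]
    exact hd.fieldAlong_comp_emb (hF.differentiable (by simp)) g

theorem hasDerivAt (hd : IsDirection γ J) (hf : IsSmooth f) (g : SU2) (s : ℝ) :
    HasDerivAt (fun s => f (g * γ s)) (SubellipticSU2.fieldAlong γ f (g * γ s)) s := by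
  obtain ⟨F, hF, hfF⟩ := hf
  have hF' : Differentiable ℝ F := hF.differentiable (by simp)
  rw [funext hfF]
  exact (hd.hasDerivAt_comp_emb hF' g s).congr_deriv (hd.fieldAlong_comp_emb hF' _).symm

theorem hasDerivAt_zero (hd : IsDirection γ J) (hf : IsSmooth f) (g : SU2) :
    HasDerivAt (fun s => f (g * γ s)) (SubellipticSU2.fieldAlong γ f g) 0 := by
  simpa only [hd.apply_zero, mul_one] using hf.hasDerivAt hd g 0

protected theorem fieldX (hf : IsSmooth f) : IsSmooth (fieldX f) := hf.fieldAlong isDirection_expX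

protected theorem fieldY (hf : IsSmooth f) : IsSmooth (fieldY f) := hf.fieldAlong isDirection_expY

end IsSmooth

section FieldAlgebra

variable {f h : SU2 → ℝ}

theorem fieldAlong_add (hd : IsDirection γ J) (hf : IsSmooth f) (hh : IsSmooth h) :
    fieldAlong γ (fun g => f g + h g) = fun g => fieldAlong γ f g + fieldAlong γ h g :=
  funext fun g => ((hf.hasDerivAt_zero hd g).add (hh.hasDerivAt_zero hd g)).deriv

theorem fieldAlong_const_mul (hd : IsDirection γ J) (hf : IsSmooth f) (c : ℝ) :
    fieldAlong γ (fun g => c * f g) = fun g => c * fieldAlong γ f g :=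
  funext fun g => ((hf.hasDerivAt_zero hd g).const_mul c).deriv

theorem fieldAlong_mul (hd : IsDirection γ J) (hf : IsSmooth f) (hh : IsSmooth h) :
    fieldAlong γ (fun g => f g * h g) =
      fun g => fieldAlong γ f g * h g + f g * fieldAlong γ h g := by
  funext g
  have hfh := ((hf.hasDerivAt_zero hd g).fun_mul (hh.hasDerivAt_zero hd g)).deriv
  simpa [fieldAlong, hd.apply_zero] using hfh

theorem fieldAlong_fieldAlong_add (hd : IsDirection γ J) (hf : IsSmooth f) (hh : IsSmooth h)
    (g : SU2) : fieldAlong γ (fieldAlong γ fun g => f g + h g) g =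
      fieldAlong γ (fieldAlong γ f) g + fieldAlong γ (fieldAlong γ h) g := by
  rw [fieldAlong_add hd hf hh, fieldAlong_add hd (hf.fieldAlong hd) (hh.fieldAlong hd)]

theorem fieldAlong_fieldAlong_const_mul (hd : IsDirection γ J) (hf : IsSmooth f) (c : ℝ)
    (g : SU2) : fieldAlong γ (fieldAlong γ fun g => c * f g) g =
      c * fieldAlong γ (fieldAlong γ f) g := by
  rw [fieldAlong_const_mul hd hf, fieldAlong_const_mul hd (hf.fieldAlong hd)]

theorem fieldAlong_fieldAlong_mul (hd : IsDirection γ J) (hf : IsSmooth f) (hh : IsSmooth h)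
    (g : SU2) : fieldAlong γ (fieldAlong γ fun g => f g * h g) g =
      f g * fieldAlong γ (fieldAlong γ h) g + h g * fieldAlong γ (fieldAlong γ f) g
        + 2 * (fieldAlong γ f g * fieldAlong γ h g) := by
  have hf' := hf.fieldAlong hd
  have hh' := hh.fieldAlong hd
  rw [fieldAlong_mul hd hf hh, fieldAlong_add hd (hf'.mul hh) (hf.mul hh'),
    fieldAlong_mul hd hf' hh, fieldAlong_mul hd hf hh']
  ring

theorem sublaplacian_add (hf : IsSmooth f) (hh : IsSmooth h) (g : SU2) :
    sublaplacian (fun g => f g + h g) g = sublaplacian f g + sublaplacian h g := by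
  simp only [sublaplacian_eq_fieldAlong, fieldAlong_fieldAlong_add isDirection_expX hf hh,
    fieldAlong_fieldAlong_add isDirection_expY hf hh]
  ring

theorem sublaplacian_const_mul (hf : IsSmooth f) (c : ℝ) (g : SU2) :
    sublaplacian (fun g => c * f g) g = c * sublaplacian f g := by
  simp only [sublaplacian_eq_fieldAlong, fieldAlong_fieldAlong_const_mul isDirection_expX hf,
    fieldAlong_fieldAlong_const_mul isDirection_expY hf]
  ring

theorem sublaplacian_neg (hf : IsSmooth f) (g : SU2) :
    sublaplacian (fun g => -f g) g = -sublaplacian f g := by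
  simpa using sublaplacian_const_mul hf (-1) g

theorem sublaplacian_sub (hf : IsSmooth f) (hh : IsSmooth h) (g : SU2) :
    sublaplacian (fun g => f g - h g) g = sublaplacian f g - sublaplacian h g := by
  simpa only [sub_eq_add_neg, sublaplacian_neg hh] using sublaplacian_add hf hh.neg g

theorem sublaplacian_mul (hf : IsSmooth f) (hh : IsSmooth h) (g : SU2) :
    sublaplacian (fun g => f g * h g) g = f g * sublaplacian h g + h g * sublaplacian f g
      + 2 * (fieldX f g * fieldX h g + fieldY f g * fieldY h g) := by
  simp only [sublaplacian_eq_fieldAlong, fieldX_eq_fieldAlong, fieldY_eq_fieldAlong,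
    fieldAlong_fieldAlong_mul isDirection_expX hf hh,
    fieldAlong_fieldAlong_mul isDirection_expY hf hh]
  ring

theorem carreDuChamp_self (hf : IsSmooth f) (g : SU2) :
    carreDuChamp f f g = fieldX f g ^ 2 + fieldY f g ^ 2 := by
  rw [carreDuChamp, sublaplacian_mul hf hf]; ring

end FieldAlgebra

/-! ### Convolution with a continuous function -/

section Convolution

variable {p f : SU2 → ℝ}

theorem IsSmooth.convolution (hp : IsSmooth p) (hf : Continuous f) :
    IsSmooth fun g => ∫ h, p (h⁻¹ * g) * f h ∂haar := by
  obtain ⟨P, hP, hpP⟩ := hp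
  have hT : Continuous fun h : SU2 => (leftMul h⁻¹).restrictScalars ℝ :=
    (ContinuousLinearMap.continuous_restrictScalars ℝ).comp (continuous_leftMul.comp continuous_inv)
  refine ⟨_, contDiff_integral_smul_comp_clm haar hP hT hf, fun g => ?_⟩
  refine integral_congr_ae (.of_forall fun h => ?_)
  change _ = f h * P (leftMul h⁻¹ (emb g))
  rw [leftMul_emb]
  refine (mul_comm _ _).trans ?_
  exact congrArg (f h * ·) (hpP (h⁻¹ * g))

theorem fieldAlong_convolution (hd : IsDirection γ J) (hp : IsSmooth p) (hf : Continuous f)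
    (g : SU2) : fieldAlong γ (fun g => ∫ h, p (h⁻¹ * g) * f h ∂haar) g =
      ∫ h, fieldAlong γ p (h⁻¹ * g) * f h ∂haar := by
  have hpc := hp.continuous
  have hpc' := (hp.fieldAlong hd).continuous
  have hγ := hd.continuous
  have hder := hasDerivAt_integral haar (x := 0)
    (f := fun s h => p (h⁻¹ * (g * γ s)) * f h)
    (f' := fun s h => fieldAlong γ p (h⁻¹ * (g * γ s)) * f h)
    (.of_forall fun s => by fun_prop)
    (fun h => by simp only [Function.HasUncurry.uncurry, id]; fun_prop)
    (.of_forall fun s h => by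
      simpa only [mul_assoc] using (hp.hasDerivAt hd (h⁻¹ * g) s).mul_const (f h))
  simp only [hd.apply_zero, mul_one] at hder
  exact hder.deriv

theorem sublaplacian_convolution (hp : IsSmooth p) (hf : Continuous f) (g : SU2) :
    sublaplacian (fun g => ∫ h, p (h⁻¹ * g) * f h ∂haar) g =
      ∫ h, sublaplacian p (h⁻¹ * g) * f h ∂haar := by
  have hpX := hp.fieldAlong isDirection_expX
  have hpY := hp.fieldAlong isDirection_expY
  have hpXX := (hpX.fieldAlong isDirection_expX).continuous
  have hpYY := (hpY.fieldAlong isDirection_expY).continuous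
  simp only [sublaplacian_eq_fieldAlong]
  rw [funext (fieldAlong_convolution isDirection_expX hp hf),
    funext (fieldAlong_convolution isDirection_expY hp hf),
    fieldAlong_convolution isDirection_expX hpX hf,
    fieldAlong_convolution isDirection_expY hpY hf,
    ← integral_add (integrable_of_continuous (by fun_prop))
      (integrable_of_continuous (by fun_prop))]
  simp only [add_mul]

theorem integral_fieldAlong (hd : IsDirection γ J) (hf : IsSmooth f) :
    ∫ g, fieldAlong γ f g ∂haar = 0 := by
  have hconv := fieldAlong_convolution hd hf (continuous_const (y := (1 : ℝ))) 1
  simp only [mul_one] at hconv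
  rw [funext fun g => integral_comp_inv_mul haar f g,
    integral_inv_eq_self (fieldAlong γ f) haar] at hconv
  rw [← hconv]
  exact deriv_const _ _

theorem integral_fieldAlong_sq (hd : IsDirection γ J) (hf : IsSmooth f) :
    ∫ g, fieldAlong γ f g ^ 2 ∂haar = -∫ g, f g * fieldAlong γ (fieldAlong γ f) g ∂haar := by
  have hf' := hf.fieldAlong hd
  have h := integral_fieldAlong hd (hf.mul hf')
  rw [fieldAlong_mul hd hf hf', integral_add
    (integrable_of_continuous (hf'.mul hf').continuous)
    (integrable_of_continuous (hf.mul (hf'.fieldAlong hd)).continuous)] at h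
  simpa only [sq] using eq_neg_of_add_eq_zero_left h

theorem integral_fieldX_sq_add_fieldY_sq (hf : IsSmooth f) :
    ∫ g, (fieldX f g ^ 2 + fieldY f g ^ 2) ∂haar = -∫ g, f g * sublaplacian f g ∂haar := by
  have hX := integral_fieldAlong_sq isDirection_expX hf
  have hY := integral_fieldAlong_sq isDirection_expY hf
  have c := hf.continuous
  have cX := hf.fieldX.continuous
  have cY := hf.fieldY.continuous
  have cXX := hf.fieldX.fieldX.continuous
  have cYY := hf.fieldY.fieldY.continuous
  simp only [← fieldX_eq_fieldAlong, ← fieldY_eq_fieldAlong] at hX hY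
  rw [integral_add (integrable_of_continuous (by fun_prop)) (integrable_of_continuous
    (by fun_prop)), hX, hY]
  simp only [sublaplacian, mul_add]
  rw [integral_add (integrable_of_continuous (by fun_prop)) (integrable_of_continuous
    (by fun_prop)), neg_add]

end Convolution

/-! ### The maximum principle -/

theorem fieldAlong_fieldAlong_nonpos (hd : IsDirection γ J) {f : SU2 → ℝ} (hf : IsSmooth f)
    {g : SU2} (hg : ∀ h, f h ≤ f g) : fieldAlong γ (fieldAlong γ f) g ≤ 0 := by
  have hderiv : deriv (fun s => f (g * γ s)) = fun s => fieldAlong γ f (g * γ s) :=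
    funext fun s => (hf.hasDerivAt hd g s).deriv
  have hmax : IsLocalMax (fun s => f (g * γ s)) 0 :=
    .of_forall fun s => by simpa [hd.apply_zero] using hg (g * γ s)
  have h := deriv_deriv_nonpos_of_isLocalMax (hf.hasDerivAt hd g 0).continuousAt hmax
  rwa [hderiv] at h

end Direction

theorem sublaplacian_nonpos {f : SU2 → ℝ} (hf : IsSmooth f) {g : SU2} (hg : ∀ h, f h ≤ f g) :
    sublaplacian f g ≤ 0 :=
  add_nonpos (fieldAlong_fieldAlong_nonpos isDirection_expX hf hg)
    (fieldAlong_fieldAlong_nonpos isDirection_expY hf hg)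

namespace IsHeatSolution

variable {f h : SU2 → ℝ} {u v : ℝ → SU2 → ℝ} {M t : ℝ}

-- Subtracting `ε t` makes the time derivative at an interior maximum strictly too small.
theorem sub_mul_le (hu : IsHeatSolution f u) (h0 : ∀ g, f g ≤ M) (ht : 0 ≤ t) (g : SU2) {ε : ℝ}
    (hε : 0 < ε) : u t g - ε * t ≤ M := by
  obtain ⟨hu0, hc, hs, hder⟩ := hu
  have hcw : ContinuousOn (fun q : ℝ × SU2 => u q.1 q.2 - ε * q.1) (Set.Icc 0 t ×ˢ Set.univ) :=
    (hc.mono (Set.prod_mono Set.Icc_subset_Ici_self subset_rfl)).sub (by fun_prop)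
  obtain ⟨⟨t₀, g₀⟩, ⟨ht₀, -⟩, hmax⟩ := (isCompact_Icc.prod isCompact_univ).exists_isMaxOn
    ⟨(0, g), ⟨le_rfl, ht⟩, trivial⟩ hcw
  replace hmax : ∀ s ∈ Set.Icc 0 t, ∀ h, u s h - ε * s ≤ u t₀ g₀ - ε * t₀ :=
    fun s hs h => hmax (show (s, h) ∈ Set.Icc 0 t ×ˢ (Set.univ : Set SU2) from ⟨hs, trivial⟩)
  refine (hmax t ⟨ht, le_rfl⟩ g).trans ?_
  rcases ht₀.1.eq_or_lt with rfl | hpos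
  · simpa [hu0] using h0 g₀
  exfalso
  have hspace : sublaplacian (u t₀) g₀ ≤ 0 := sublaplacian_nonpos (hs t₀ hpos) fun h => by
    linarith [hmax t₀ ht₀ h]
  have htime : 0 ≤ sublaplacian (u t₀) g₀ - ε * 1 :=
    nonneg_of_hasDerivAt_of_eventually_le
      ((hder t₀ hpos g₀).sub ((hasDerivAt_id t₀).const_mul ε))
      (mem_of_superset (Ioo_mem_nhdsLT hpos) fun s hs => hmax s ⟨hs.1.le, hs.2.le.trans ht₀.2⟩ g₀)
  linarith

theorem le_of_forall_le (hu : IsHeatSolution f u) (h0 : ∀ g, f g ≤ M) (ht : 0 ≤ t) (g : SU2) :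
    u t g ≤ M := by
  have hlim : Tendsto (fun ε => u t g - ε * t) (𝓝[>] 0) (𝓝 (u t g - 0 * t)) :=
    (by fun_prop : Continuous fun ε => u t g - ε * t).continuousWithinAt
  rw [zero_mul, sub_zero] at hlim
  exact le_of_tendsto hlim (eventually_mem_nhdsWithin.mono fun ε hε => hu.sub_mul_le h0 ht g hε)

theorem neg (hu : IsHeatSolution f u) : IsHeatSolution (fun g => -f g) (fun t g => -u t g) := by
  obtain ⟨hu0, hc, hs, hder⟩ := hu
  refine ⟨by simp only [hu0], hc.neg, fun t ht => (hs t ht).neg, fun t ht g => ?_⟩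
  rw [sublaplacian_neg (hs t ht)]
  exact (hder t ht g).neg

theorem sub (hu : IsHeatSolution f u) (hv : IsHeatSolution h v) :
    IsHeatSolution (fun g => f g - h g) (fun t g => u t g - v t g) := by
  obtain ⟨hu0, huc, hus, huder⟩ := hu
  obtain ⟨hv0, hvc, hvs, hvder⟩ := hv
  refine ⟨by simp only [hu0, hv0], huc.sub hvc, fun t ht => (hus t ht).sub (hvs t ht),
    fun t ht g => ?_⟩
  rw [sublaplacian_sub (hus t ht) (hvs t ht)]
  exact (huder t ht g).sub (hvder t ht g)

theorem abs_le (hu : IsHeatSolution f u) (h0 : ∀ g, |f g| ≤ M) (ht : 0 ≤ t) (g : SU2) :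
    |u t g| ≤ M :=
  abs_le'.2 ⟨hu.le_of_forall_le (fun g => (abs_le'.1 (h0 g)).1) ht g,
    hu.neg.le_of_forall_le (fun g => (abs_le'.1 (h0 g)).2) ht g⟩

theorem unique (hu : IsHeatSolution f u) (hv : IsHeatSolution f v) (ht : 0 ≤ t) : u t = v t :=
  funext fun g => sub_eq_zero.1 <| abs_nonpos_iff.1 <|
    (hu.sub hv).abs_le (M := 0) (fun g => by simp) ht g

end IsHeatSolution

/-! ### Coefficients of polynomials as averages over roots of unity -/

section Polynomial

open Polynomial

theorem sum_primitiveRoot_pow_mul_pow {R : Type*} [CommRing R] [IsDomain R] {N : ℕ} {ζ : R}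
    (hζ : IsPrimitiveRoot ζ N) {k e : ℕ} (hk : k < N) (he : e < N) :
    ∑ l ∈ Finset.range N, (ζ ^ l) ^ (N - k) * (ζ ^ l) ^ e = if e = k then (N : R) else 0 := by
  have hgeom : ∀ l, (ζ ^ l) ^ (N - k) * (ζ ^ l) ^ e = (ζ ^ (N - k + e)) ^ l := fun l => by ring
  simp only [hgeom]
  split_ifs with hek
  · rw [hek, Nat.sub_add_cancel hk.le, hζ.pow_eq_one]
    simp
  · have hne : ζ ^ (N - k + e) ≠ 1 := fun h => by
      obtain ⟨c, hc⟩ := (hζ.pow_eq_one_iff_dvd _).1 h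
      have hc2 : c < 2 := by
        by_contra! h2
        have : N * 2 ≤ N * c := Nat.mul_le_mul_left _ h2
        omega
      interval_cases c <;> omega
    refine eq_zero_of_ne_zero_of_mul_left_eq_zero (sub_ne_zero.2 hne) ?_
    rw [mul_geom_sum, ← pow_mul, mul_comm, pow_mul, hζ.pow_eq_one, one_pow, sub_self]

theorem sum_primitiveRoot_pow_mul_eval {R : Type*} [CommRing R] [IsDomain R] {N : ℕ} {ζ : R}
    (hζ : IsPrimitiveRoot ζ N) {P : R[X]} (hP : P.natDegree < N) {k : ℕ} (hk : k < N) :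
    ∑ l ∈ Finset.range N, (ζ ^ l) ^ (N - k) * P.eval (ζ ^ l) = N * P.coeff k := by
  simp only [eval_eq_sum_range' hP, Finset.mul_sum, mul_left_comm _ (P.coeff _)]
  rw [Finset.sum_comm]
  have hinner : ∀ e ∈ Finset.range N, ∑ l ∈ Finset.range N,
      P.coeff e * ((ζ ^ l) ^ (N - k) * (ζ ^ l) ^ e) = if e = k then N * P.coeff k else 0 := by
    intro e he
    rw [← Finset.mul_sum, sum_primitiveRoot_pow_mul_pow hζ hk (Finset.mem_range.1 he)]
    split_ifs with hek
    · rw [hek, mul_comm]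
    · rw [mul_zero]
  rw [Finset.sum_congr rfl hinner, Finset.sum_ite_eq', if_pos (Finset.mem_range.2 hk)]

/-- The primitive `N`-th root of unity `exp (2πi / N)`; it is `1` for `N = 0`. -/
noncomputable def rootOfUnity (N : ℕ) : ℂ := Complex.exp (2 * Real.pi * Complex.I / N)

theorem isPrimitiveRoot_rootOfUnity {N : ℕ} (hN : N ≠ 0) : IsPrimitiveRoot (rootOfUnity N) N :=
  Complex.isPrimitiveRoot_exp N hN

theorem norm_rootOfUnity {N : ℕ} (hN : N ≠ 0) : ‖rootOfUnity N‖ = 1 :=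
  (isPrimitiveRoot_rootOfUnity hN).norm'_eq_one hN

/-- The discrete Fourier coefficients expressing the `k`-th coefficient of a polynomial of degree
less than `N` through its values at the `N`-th roots of unity. -/
noncomputable def fourierWeight (N k l : ℕ) : ℂ := (N : ℂ)⁻¹ * (rootOfUnity N ^ l) ^ (N - k)

theorem norm_fourierWeight {N : ℕ} (hN : N ≠ 0) (k l : ℕ) : ‖fourierWeight N k l‖ = (N : ℝ)⁻¹ := by
  simp [fourierWeight, norm_rootOfUnity hN]

theorem sum_fourierWeight_mul_eval {P : ℂ[X]} {N k : ℕ} (hP : P.natDegree < N) (hk : k < N) :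
    ∑ l ∈ Finset.range N, fourierWeight N k l * P.eval (rootOfUnity N ^ l) = P.coeff k := by
  have hN : N ≠ 0 := by omega
  simp only [fourierWeight, mul_assoc]
  rw [← Finset.mul_sum, sum_primitiveRoot_pow_mul_eval (isPrimitiveRoot_rootOfUnity hN) hP hk,
    inv_mul_cancel_left₀ (Nat.cast_ne_zero.2 hN)]

theorem norm_coeff_mul_pow_le {P : ℂ[X]} {ρ C : ℝ} (hρ : 0 ≤ ρ)
    (h : ∀ z : ℂ, ‖z‖ = ρ → ‖P.eval z‖ ≤ C) (k : ℕ) : ‖P.coeff k‖ * ρ ^ k ≤ C := by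
  set N := max P.natDegree k + 1
  have hN : N ≠ 0 := by omega
  have hQ : (P.comp (Polynomial.C (ρ : ℂ) * X)).natDegree < N :=
    natDegree_comp_le.trans_lt (by
      have := Nat.mul_le_mul_left P.natDegree
        ((natDegree_C_mul_le (ρ : ℂ) X).trans natDegree_X_le)
      omega)
  have hcoeff := sum_fourierWeight_mul_eval hQ (k := k) (by omega)
  rw [comp_C_mul_X_coeff] at hcoeff
  have hterm : ∀ l ∈ Finset.range N, ‖fourierWeight N k l *
      (P.comp (Polynomial.C (ρ : ℂ) * X)).eval (rootOfUnity N ^ l)‖ ≤ (N : ℝ)⁻¹ * C := by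
    intro l _
    rw [norm_mul, norm_fourierWeight hN, eval_comp]
    refine mul_le_mul_of_nonneg_left (h _ ?_) (by positivity)
    simp [norm_rootOfUnity hN, abs_of_nonneg hρ]
  calc ‖P.coeff k‖ * ρ ^ k = ‖P.coeff k * (ρ : ℂ) ^ k‖ := by simp [abs_of_nonneg hρ]
    _ ≤ ∑ _l ∈ Finset.range N, (N : ℝ)⁻¹ * C := hcoeff ▸ norm_sum_le_of_le _ hterm
    _ = C := by
      rw [Finset.sum_const, Finset.card_range, nsmul_eq_mul,
        mul_inv_cancel_left₀ (Nat.cast_ne_zero.2 hN)]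

theorem coeff_C_mul_X_add_C_pow {R : Type*} [CommSemiring R] (a c : R) (n k : ℕ) :
    ((C a * X + C c) ^ n).coeff k = n.choose k * (a ^ k * c ^ (n - k)) := by
  have hterm : ∀ m, (C a * X) ^ m * C c ^ (n - m) * ((n.choose m : ℕ) : R[X]) =
      C (a ^ m * c ^ (n - m) * n.choose m) * X ^ m := fun m => by
    simp only [map_mul, map_pow, map_natCast]; ring
  simp only [add_pow, hterm, finsetSum_coeff, coeff_C_mul_X_pow, Finset.sum_ite_eq,
    Finset.mem_range]
  split_ifs with hk
  · ring
  · rw [Nat.choose_eq_zero_of_lt (by omega)]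
    simp

/-- The polynomial `(a z + c) ^ p (b z + d) ^ s` in `z`. -/
noncomputable def linearPowMul (a b c d : ℂ) (p s : ℕ) : ℂ[X] :=
  (C a * X + C c) ^ p * (C b * X + C d) ^ s

theorem eval_linearPowMul (a b c d : ℂ) (p s : ℕ) (z : ℂ) :
    (linearPowMul a b c d p s).eval z = (z * a + c) ^ p * (z * b + d) ^ s := by
  simp only [linearPowMul, eval_mul, eval_pow, eval_add, eval_C, eval_X, mul_comm]

theorem natDegree_linearPowMul_le (a b c d : ℂ) (p s : ℕ) :
    (linearPowMul a b c d p s).natDegree ≤ p + s := by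
  refine natDegree_mul_le_of_le ?_ ?_
  · simpa using natDegree_pow_le_of_le p (natDegree_linear_le (a := a) (b := c))
  · simpa using natDegree_pow_le_of_le s (natDegree_linear_le (a := b) (b := d))

theorem coeff_one_linearPowMul (a b c d : ℂ) (p s : ℕ) : (linearPowMul a b c d p s).coeff 1 =
    p * a * (c ^ (p - 1) * d ^ s) + s * b * (c ^ p * d ^ (s - 1)) := by
  have hcoeff := coeff_derivative (linearPowMul a b c d p s) 0
  rw [coeff_zero_eq_eval_zero, Nat.cast_zero, zero_add, zero_add, mul_one] at hcoeff
  rw [← hcoeff]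
  simp only [linearPowMul, derivative_mul, derivative_pow, derivative_add,
    derivative_X, derivative_C, eval_add, eval_mul, eval_pow, eval_C, eval_X, eval_zero, eval_one]
  ring

theorem coeff_linearPowMul_left (a b c d : ℂ) (p s : ℕ) : (linearPowMul a b c d p s).coeff p =
    ∑ j ∈ Finset.range (p + s + 1), (p.choose j * s.choose j : ℂ) *
      (a ^ (p - j) * d ^ (s - j) * (b * c) ^ j) := by
  rw [linearPowMul, coeff_mul, ← Finset.Nat.sum_antidiagonal_swap,
    Finset.Nat.sum_antidiagonal_eq_sum_range_succ_mk]
  simp only [Prod.swap, coeff_C_mul_X_add_C_pow]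
  have hsub : Finset.range p.succ ⊆ Finset.range (p + s + 1) :=
    Finset.range_subset_range.2 (by omega)
  rw [← Finset.sum_subset hsub fun j _ hj => by
    rw [Nat.choose_eq_zero_of_lt (not_lt.1 (mt Finset.mem_range.2 hj)), Nat.cast_zero, zero_mul,
      zero_mul]]
  refine Finset.sum_congr rfl fun j hj => ?_
  have hjp : j ≤ p := Nat.lt_succ_iff.1 (Finset.mem_range.1 hj)
  rw [Nat.choose_symm hjp, Nat.sub_sub_self hjp]
  ring

end Polynomial

/-! ### Holomorphic functions on the ambient space -/

theorem exists_contDiff_eqOn_of_contDiffOn {E F : Type*} [NormedAddCommGroup E] [NormedSpace ℝ E]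
    [FiniteDimensional ℝ E] [NormedAddCommGroup F] [NormedSpace ℝ F] {n : ℕ∞} {f : E → F}
    {K U : Set E} (hK : IsClosed K) (hU : IsOpen U) (hKU : K ⊆ U) (hf : ContDiffOn ℝ n f U) :
    ∃ f' : E → F, ContDiff ℝ n f' ∧ Set.EqOn f' f K := by
  obtain ⟨χ, hχ0, hχ1, -⟩ := exists_contMDiffMap_zero_one_nhds_of_isClosed (n := n)
    (modelWithCornersSelf ℝ E) hU.isClosed_compl hK (Set.disjoint_left.2 fun x hx hxK =>
      hx (hKU hxK))
  refine ⟨fun x => χ x • f x, contDiff_iff_contDiffAt.2 fun x => ?_, fun x hx => ?_⟩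
  · by_cases hxU : x ∈ U
    · exact χ.contMDiff.contDiff.contDiffAt.smul (hf.contDiffAt (hU.mem_nhds hxU))
    · refine contDiffAt_const (c := (0 : F)) |>.congr_of_eventuallyEq ?_
      filter_upwards [eventually_nhdsSet_iff_forall.1 hχ0 x hxU] with y hy
      rw [hy, zero_smul]
  · simp only [hχ1.self_of_nhdsSet x hx, one_smul]

section LieDeriv

variable {𝕜 E : Type*} [NontriviallyNormedField 𝕜] [NormedAddCommGroup E] [NormedSpace 𝕜 E]

/-- The derivative of a function along the linear vector field `R`. -/
noncomputable def lieDeriv (R : E →L[𝕜] E) (F : E → 𝕜) (x : E) : 𝕜 := fderiv 𝕜 F x (R x)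

theorem lieDeriv_add {F G : E → 𝕜} (hF : Differentiable 𝕜 F) (hG : Differentiable 𝕜 G)
    (R : E →L[𝕜] E) : lieDeriv R (F + G) = lieDeriv R F + lieDeriv R G := by
  funext x
  simp [lieDeriv, fderiv_add (hF x) (hG x)]

theorem lieDeriv_const_smul {F : E → 𝕜} (hF : Differentiable 𝕜 F) (c : 𝕜)
    (R : E →L[𝕜] E) : lieDeriv R (c • F) = c • lieDeriv R F := by
  funext x
  simp [lieDeriv, fderiv_const_smul (hF x)]

theorem contDiffOn_lieDeriv {F : E → 𝕜} {U : Set E} (hU : IsOpen U)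
    (hF : ContDiffOn 𝕜 (⊤ : ℕ∞) F U) (R : E →L[𝕜] E) :
    ContDiffOn 𝕜 (⊤ : ℕ∞) (lieDeriv R F) U :=
  (hF.fderiv_of_isOpen hU (by simp)).clm_apply R.contDiff.contDiffOn

theorem contDiff_lieDeriv {F : E → 𝕜} (hF : ContDiff 𝕜 (⊤ : ℕ∞) F) (R : E →L[𝕜] E) :
    ContDiff 𝕜 (⊤ : ℕ∞) (lieDeriv R F) :=
  contDiffOn_univ.1 (contDiffOn_lieDeriv isOpen_univ hF.contDiffOn R)

end LieDeriv

/-- The holomorphic extension of the sublaplacian. -/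
noncomputable def complexLaplacian (F : Mat → ℂ) : Mat → ℂ :=
  lieDeriv (rightMul pauliX) (lieDeriv (rightMul pauliX) F) +
    lieDeriv (rightMul pauliY) (lieDeriv (rightMul pauliY) F)

theorem complexLaplacian_add {F G : Mat → ℂ} (hF : ContDiff ℂ (⊤ : ℕ∞) F)
    (hG : ContDiff ℂ (⊤ : ℕ∞) G) :
    complexLaplacian (F + G) = complexLaplacian F + complexLaplacian G := by
  have hd : ∀ {F : Mat → ℂ}, ContDiff ℂ (⊤ : ℕ∞) F → Differentiable ℂ F := fun h =>
    h.differentiable (by simp)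
  simp only [complexLaplacian, lieDeriv_add (hd hF) (hd hG),
    lieDeriv_add (hd (contDiff_lieDeriv hF _)) (hd (contDiff_lieDeriv hG _))]
  abel

theorem complexLaplacian_const_smul {F : Mat → ℂ} (hF : ContDiff ℂ (⊤ : ℕ∞) F) (c : ℂ) :
    complexLaplacian (c • F) = c • complexLaplacian F := by
  have hd : ∀ {F : Mat → ℂ}, ContDiff ℂ (⊤ : ℕ∞) F → Differentiable ℂ F := fun h =>
    h.differentiable (by simp)
  simp only [complexLaplacian, lieDeriv_const_smul (hd hF),
    lieDeriv_const_smul (hd (contDiff_lieDeriv hF _)), smul_add]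

theorem fieldAlong_re {γ : ℝ → SU2} {J : Matrix (Fin 2) (Fin 2) ℂ} (hd : IsDirection γ J)
    {G : Mat → ℂ} {g : SU2} (hG : DifferentiableAt ℂ G (emb g)) :
    fieldAlong γ (fun g => (G (emb g)).re) g = (lieDeriv (rightMul J) G (emb g)).re := by
  have hre : HasFDerivAt (fun A => (G A).re) _ (emb g) :=
    Complex.reCLM.hasFDerivAt.comp _ (hG.hasFDerivAt.restrictScalars ℝ)
  have h := hre.comp_hasDerivAt_of_eq 0 (hd.hasDerivAt g 0) (by simp [hd.apply_zero])
  rw [hd.apply_zero, mul_one] at h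
  exact h.deriv

section Restriction

variable {U : Set Mat} {G : Mat → ℂ}

theorem isSmooth_re (hU : IsOpen U) (hemb : ∀ g, emb g ∈ U) (hG : ContDiffOn ℂ (⊤ : ℕ∞) G U) :
    IsSmooth fun g => (G (emb g)).re := by
  have hre : ContDiffOn ℝ (⊤ : ℕ∞) (fun A => (G A).re) U :=
    Complex.reCLM.contDiff.comp_contDiffOn (hG.restrict_scalars ℝ)
  obtain ⟨F, hF, hFG⟩ := exists_contDiff_eqOn_of_contDiffOn
    (isCompact_range continuous_emb).isClosed hU (Set.range_subset_iff.2 hemb) hre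
  exact ⟨F, hF, fun g => (hFG ⟨g, rfl⟩).symm⟩

theorem sublaplacian_re (hU : IsOpen U) (hemb : ∀ g, emb g ∈ U)
    (hG : ContDiffOn ℂ (⊤ : ℕ∞) G U) (g : SU2) :
    sublaplacian (fun g => (G (emb g)).re) g = (complexLaplacian G (emb g)).re := by
  have hdiff : ∀ {F : Mat → ℂ}, ContDiffOn ℂ (⊤ : ℕ∞) F U → ∀ g, DifferentiableAt ℂ F (emb g) :=
    fun hF g => (hF.contDiffAt (hU.mem_nhds (hemb g))).differentiableAt (by simp)
  have hfield : ∀ {γ : ℝ → SU2} {J : Matrix (Fin 2) (Fin 2) ℂ}, IsDirection γ J →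
      fieldAlong γ (fieldAlong γ fun g => (G (emb g)).re) g =
        (lieDeriv (rightMul J) (lieDeriv (rightMul J) G) (emb g)).re := fun hd => by
    rw [show fieldAlong _ (fun g => (G (emb g)).re) = _ from
      funext fun g => fieldAlong_re hd (hdiff hG g),
      fieldAlong_re hd (hdiff (contDiffOn_lieDeriv hU hG _) g)]
  rw [sublaplacian_eq_fieldAlong, hfield isDirection_expX, hfield isDirection_expY]
  rfl

end Restriction

/-! ### Eigenfunctions of the sublaplacian -/

/-- The linear form `x a + y c` in a column `(a, c)` of a matrix. -/
noncomputable def columnForm (x y : ℂ) (j : Fin 2) : Mat →L[ℂ] ℂ :=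
  LinearMap.toContinuousLinearMap
    { toFun := fun A => x * A 0 j + y * A 1 j
      map_add' := fun A B => by simp only [Pi.add_apply]; ring
      map_smul' := fun c A => by
        simp only [Pi.smul_apply, smul_eq_mul, RingHom.id_apply]; ring }

theorem columnForm_apply (x y : ℂ) (j : Fin 2) (A : Mat) :
    columnForm x y j A = x * A 0 j + y * A 1 j := rfl

/-- The function `(x a + y c) ^ p (x b + y d) ^ s` of the matrix with rows `(a, b)`, `(c, d)`. For
fixed `p + s`, its restrictions to `SU(2)` span the matrix coefficients of the irreducible
representation on binary forms of degree `p + s`. -/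
noncomputable def wave (x y : ℂ) (p s : ℕ) (A : Mat) : ℂ :=
  columnForm x y 0 A ^ p * columnForm x y 1 A ^ s

/-- The eigenvalue of `-ℒ` on the waves of type `(p, s)`. -/
def eigenvalue (i : ℕ × ℕ) : ℝ := 2 * (i.1 + i.2) + 4 * (i.1 * i.2)

theorem contDiff_wave (x y : ℂ) (p s : ℕ) : ContDiff ℂ (⊤ : ℕ∞) (wave x y p s) :=
  ((columnForm x y 0).contDiff.pow p).mul ((columnForm x y 1).contDiff.pow s)

theorem lieDeriv_wave (R : Mat →L[ℂ] Mat) (x y : ℂ) (p s : ℕ) (A : Mat) :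
    lieDeriv R (wave x y p s) A =
      p * columnForm x y 0 A ^ (p - 1) * columnForm x y 0 (R A) * columnForm x y 1 A ^ s +
      s * columnForm x y 0 A ^ p * columnForm x y 1 A ^ (s - 1) * columnForm x y 1 (R A) := by
  have hderiv := (((columnForm x y 0).hasFDerivAt (x := A)).pow p).mul
    (((columnForm x y 1).hasFDerivAt (x := A)).pow s)
  refine (congrArg (fun L : Mat →L[ℂ] ℂ => L (R A)) hderiv.fderiv).trans ?_
  simp only [add_apply, smul_apply, smul_eq_mul, nsmul_eq_mul]
  ring

theorem lieDeriv_rightMul_pauliX_wave (x y : ℂ) (p s : ℕ) :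
    lieDeriv (rightMul pauliX) (wave x y p s) =
      (-p : ℂ) • wave x y (p - 1) (s + 1) + (s : ℂ) • wave x y (p + 1) (s - 1) := by
  funext A
  have hcol₀ : columnForm x y 0 (rightMul pauliX A) = -columnForm x y 1 A := by
    simp only [columnForm_apply, rightMul_pauliX_zero]; ring
  have hcol₁ : columnForm x y 1 (rightMul pauliX A) = columnForm x y 0 A := by
    simp only [columnForm_apply, rightMul_pauliX_one]
  simp only [lieDeriv_wave, hcol₀, hcol₁, wave, Pi.add_apply, Pi.smul_apply, smul_eq_mul]
  ring

theorem lieDeriv_rightMul_pauliY_wave (x y : ℂ) (p s : ℕ) :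
    lieDeriv (rightMul pauliY) (wave x y p s) =
      (Complex.I * p) • wave x y (p - 1) (s + 1) +
        (Complex.I * s) • wave x y (p + 1) (s - 1) := by
  funext A
  have hcol₀ : columnForm x y 0 (rightMul pauliY A) = Complex.I * columnForm x y 1 A := by
    simp only [columnForm_apply, rightMul_pauliY_zero]; ring
  have hcol₁ : columnForm x y 1 (rightMul pauliY A) = Complex.I * columnForm x y 0 A := by
    simp only [columnForm_apply, rightMul_pauliY_one]; ring
  simp only [lieDeriv_wave, hcol₀, hcol₁, wave, Pi.add_apply, Pi.smul_apply, smul_eq_mul]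
  ring

theorem complexLaplacian_wave (x y : ℂ) (p s : ℕ) :
    complexLaplacian (wave x y p s) = (-eigenvalue (p, s) : ℂ) • wave x y p s := by
  have hd : ∀ p s, Differentiable ℂ (wave x y p s) := fun p s =>
    (contDiff_wave x y p s).differentiable (by simp)
  have hd' : ∀ p s (c : ℂ), Differentiable ℂ (c • wave x y p s) := fun p s c =>
    (hd p s).const_smul c
  simp only [complexLaplacian, lieDeriv_rightMul_pauliX_wave, lieDeriv_rightMul_pauliY_wave,
    lieDeriv_add (hd' _ _ _) (hd' _ _ _), lieDeriv_const_smul (hd _ _)]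
  funext A
  simp only [Pi.add_apply, Pi.smul_apply, smul_eq_mul]
  have hI := Complex.I_sq
  rcases p with _ | p <;> rcases s with _ | s <;>
    simp only [eigenvalue, Nat.add_sub_cancel] <;> push_cast <;> ring_nf <;> rw [hI] <;> ring

/-- The entire functions `F` on the ambient space whose restrictions to `SU(2)` satisfy
`ℒ F = -c F`. -/
noncomputable def eigenspace (c : ℝ) : Submodule ℂ (Mat → ℂ) where
  carrier := {F | ContDiff ℂ (⊤ : ℕ∞) F ∧ complexLaplacian F = (-c : ℂ) • F}
  add_mem' := fun hF hG => ⟨hF.1.add hG.1, by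
    rw [complexLaplacian_add hF.1 hG.1, hF.2, hG.2, smul_add]⟩
  zero_mem' := ⟨contDiff_const, by
    simpa using complexLaplacian_const_smul (contDiff_const (c := (0 : ℂ))) 0⟩
  smul_mem' := fun a F hF => ⟨hF.1.const_smul a, by
    rw [complexLaplacian_const_smul hF.1, hF.2, smul_comm]⟩

theorem contDiff_of_mem_eigenspace {c : ℝ} {F : Mat → ℂ} (hF : F ∈ eigenspace c) :
    ContDiff ℂ (⊤ : ℕ∞) F := hF.1

theorem complexLaplacian_of_mem_eigenspace {c : ℝ} {F : Mat → ℂ} (hF : F ∈ eigenspace c) :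
    complexLaplacian F = (-c : ℂ) • F := hF.2

theorem wave_mem_eigenspace (x y : ℂ) (p s : ℕ) : wave x y p s ∈ eigenspace (eigenvalue (p, s)) :=
  ⟨contDiff_wave x y p s, complexLaplacian_wave x y p s⟩

/-! ### The Hermitian operator norm -/

/-- The operator norm of the transpose of a matrix on the Hermitian space `ℂ²`. -/
noncomputable def opNorm (A : Mat) : ℝ :=
  ‖Matrix.toEuclideanCLM (n := Fin 2) (𝕜 := ℂ) (Matrix.of A).transpose‖

theorem opNorm_nonneg (A : Mat) : 0 ≤ opNorm A := norm_nonneg _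

theorem continuous_opNorm : Continuous opNorm := by
  let L : Mat →ₗ[ℂ] EuclideanSpace ℂ (Fin 2) →L[ℂ] EuclideanSpace ℂ (Fin 2) :=
    (Matrix.toEuclideanCLM (n := Fin 2) (𝕜 := ℂ)).toAlgEquiv.toLinearMap ∘ₗ
      (Matrix.transposeLinearEquiv (Fin 2) (Fin 2) ℂ ℂ).toLinearMap
  exact L.continuous_of_finiteDimensional.norm

theorem sq_norm_columnForm_add_le (x y : ℂ) (A : Mat) :
    ‖columnForm x y 0 A‖ ^ 2 + ‖columnForm x y 1 A‖ ^ 2 ≤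
      opNorm A ^ 2 * (‖x‖ ^ 2 + ‖y‖ ^ 2) := by
  have h := pow_le_pow_left₀ (norm_nonneg _) ((Matrix.toEuclideanCLM (n := Fin 2) (𝕜 := ℂ)
    (Matrix.of A).transpose).le_opNorm !₂[x, y]) 2
  simpa [mul_pow, EuclideanSpace.norm_sq_eq, Fin.sum_univ_two, Matrix.mulVec, dotProduct,
    columnForm_apply, mul_comm, opNorm] using h

theorem norm_apply_le_opNorm (A : Mat) (i j : Fin 2) : ‖A i j‖ ≤ opNorm A := by
  refine (abs_le_of_sq_le_sq' ?_ (opNorm_nonneg A)).2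
  have hrow := sq_norm_columnForm_add_le (if i = 0 then 1 else 0) (if i = 1 then 1 else 0) A
  have hsq : ∀ i j, 0 ≤ ‖A i j‖ ^ 2 := fun i j => sq_nonneg _
  fin_cases i <;> fin_cases j <;> simp [columnForm_apply] at hrow ⊢ <;>
    linarith [hsq 0 0, hsq 0 1, hsq 1 0, hsq 1 1]

theorem opNorm_emb (g : SU2) : opNorm (emb g) = 1 := by
  have hg : (Matrix.of (emb g)).transpose ∈ Matrix.unitaryGroup (Fin 2) ℂ :=
    Matrix.transpose_mem_unitaryGroup_iff.2 (Matrix.specialUnitaryGroup_le_unitaryGroup g.2)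
  exact CStarRing.norm_of_mem_unitary (Unitary.map_mem _ hg)

/-- The open neighbourhood `‖A‖ < M` of `SU(2)` in the ambient space, for `M > 1`. -/
def opNormBall (M : ℝ) : Set Mat := {A | opNorm A < M}

theorem isOpen_opNormBall (M : ℝ) : IsOpen (opNormBall M) :=
  isOpen_lt continuous_opNorm continuous_const

theorem emb_mem_opNormBall {M : ℝ} (hM : 1 < M) (g : SU2) : emb g ∈ opNormBall M :=
  (opNorm_emb g).trans_lt hM

/-! ### The diagonal matrix coefficients -/

/-- The diagonal matrix coefficient of weight `(p, s)` of the representation on binary forms of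
degree `p + s`: the coefficient of `z ^ p` in `(a z + c) ^ p (b z + d) ^ s`. -/
noncomputable def diagCoeff (p s : ℕ) (A : Mat) : ℂ :=
  ∑ j ∈ Finset.range (p + s + 1), (p.choose j * s.choose j : ℂ) *
    (A 0 0 ^ (p - j) * A 1 1 ^ (s - j) * (A 0 1 * A 1 0) ^ j)

theorem diagCoeff_eq_coeff (p s : ℕ) (A : Mat) :
    diagCoeff p s A = (linearPowMul (A 0 0) (A 0 1) (A 1 0) (A 1 1) p s).coeff p :=
  (coeff_linearPowMul_left _ _ _ _ p s).symm

theorem eval_linearPowMul_eq_wave (p s : ℕ) (A : Mat) (z : ℂ) :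
    (linearPowMul (A 0 0) (A 0 1) (A 1 0) (A 1 1) p s).eval z = wave z 1 p s A := by
  simp only [eval_linearPowMul, wave, columnForm_apply, one_mul]

theorem diagCoeff_eq_sum_wave (p s : ℕ) : diagCoeff p s = ∑ l ∈ Finset.range (p + s + 1),
    fourierWeight (p + s + 1) p l • wave (rootOfUnity (p + s + 1) ^ l) 1 p s := by
  funext A
  have hdeg := natDegree_linearPowMul_le (A 0 0) (A 0 1) (A 1 0) (A 1 1) p s
  rw [diagCoeff_eq_coeff, ← sum_fourierWeight_mul_eval (N := p + s + 1) (by omega) (by omega)]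
  simp only [eval_linearPowMul_eq_wave, Finset.sum_apply, Pi.smul_apply, smul_eq_mul]

theorem diagCoeff_mem_eigenspace (p s : ℕ) : diagCoeff p s ∈ eigenspace (eigenvalue (p, s)) := by
  rw [diagCoeff_eq_sum_wave]
  exact Submodule.sum_mem _ fun l _ => Submodule.smul_mem _ _ (wave_mem_eigenspace _ _ p s)

theorem diagCoeff_congr_swap {A B : Mat} (h0 : B 0 0 = A 1 1) (h1 : B 1 1 = A 0 0)
    (hoff : B 0 1 * B 1 0 = A 0 1 * A 1 0) (p s : ℕ) : diagCoeff p s B = diagCoeff s p A := by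
  rw [diagCoeff, diagCoeff, h0, h1, hoff, add_comm s p]
  refine Finset.sum_congr rfl fun j _ => ?_
  ring

theorem diagCoeff_zero_right (p : ℕ) (A : Mat) : diagCoeff p 0 A = A 0 0 ^ p := by
  rw [diagCoeff, Finset.sum_eq_single 0]
  · simp
  · intro j _ hj
    rw [Nat.choose_eq_zero_of_lt (Nat.pos_of_ne_zero hj), Nat.cast_zero, mul_zero, zero_mul]
  · simp

theorem diagCoeff_zero_left (s : ℕ) (A : Mat) : diagCoeff 0 s A = A 1 1 ^ s :=
  (diagCoeff_congr_swap (A := fun i j => A i.rev j.rev) rfl rfl (mul_comm _ _) 0 s).trans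
    (diagCoeff_zero_right s _)

theorem pow_mul_pow_le_weighted_mean_pow {p s : ℕ} (h : p + s ≠ 0) {x y : ℝ} (hx : 0 ≤ x)
    (hy : 0 ≤ y) : x ^ p * y ^ s ≤ ((p * x + s * y) / (p + s)) ^ (p + s) := by
  have hps : (0 : ℝ) < p + s := by exact_mod_cast Nat.pos_of_ne_zero h
  have hmean := Real.geom_mean_le_arith_mean2_weighted (w₁ := p / (p + s)) (w₂ := s / (p + s))
    (by positivity) (by positivity) hx hy (by field_simp)
  have hpow := pow_le_pow_left₀ (by positivity) hmean (p + s)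
  rw [mul_pow, ← Real.rpow_mul_natCast hx, ← Real.rpow_mul_natCast hy] at hpow
  push_cast at hpow
  rw [div_mul_cancel₀ _ hps.ne', div_mul_cancel₀ _ hps.ne', Real.rpow_natCast,
    Real.rpow_natCast] at hpow
  exact hpow.trans_eq (by ring)

-- The radius `√(p / s)` is the one for which the two factors can be maximal simultaneously.
theorem norm_wave_le {p s : ℕ} (hp : p ≠ 0) (hs : s ≠ 0) {z : ℂ} (hz : ‖z‖ = √(p / s)) (A : Mat) :
    ‖wave z 1 p s A‖ ≤ opNorm A ^ (p + s) * ‖z‖ ^ p := by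
  have hs_pos : (0 : ℝ) < s := by positivity
  have hz2 : ‖z‖ ^ 2 = p / s := by rw [hz, Real.sq_sqrt (by positivity)]
  have hz0 : 0 < ‖z‖ := hz ▸ Real.sqrt_pos.2 (by positivity)
  set X := ‖columnForm z 1 0 A‖
  set Y := ‖columnForm z 1 1 A‖
  have hXY : X ^ 2 + Y ^ 2 ≤ opNorm A ^ 2 * (p / s + 1) := by
    simpa [hz2] using sq_norm_columnForm_add_le z 1 A
  have hmean : (p * (X / ‖z‖) ^ 2 + s * Y ^ 2) / (p + s) ≤ opNorm A ^ 2 := by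
    rw [div_pow, hz2, div_le_iff₀ (by positivity)]
    calc p * (X ^ 2 / (p / s)) + s * Y ^ 2 = s * (X ^ 2 + Y ^ 2) := by field_simp
      _ ≤ s * (opNorm A ^ 2 * (p / s + 1)) := mul_le_mul_of_nonneg_left hXY hs_pos.le
      _ = opNorm A ^ 2 * (p + s) := by field_simp
  have hsq : ((X / ‖z‖) ^ p * Y ^ s) ^ 2 ≤ (opNorm A ^ (p + s)) ^ 2 :=
    calc ((X / ‖z‖) ^ p * Y ^ s) ^ 2 = ((X / ‖z‖) ^ 2) ^ p * (Y ^ 2) ^ s := by ring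
      _ ≤ ((p * (X / ‖z‖) ^ 2 + s * Y ^ 2) / (p + s)) ^ (p + s) :=
        pow_mul_pow_le_weighted_mean_pow (by omega) (sq_nonneg _) (sq_nonneg _)
      _ ≤ (opNorm A ^ 2) ^ (p + s) := pow_le_pow_left₀ (by positivity) hmean _
      _ = (opNorm A ^ (p + s)) ^ 2 := by ring
  have hle := (abs_le_of_sq_le_sq' hsq (pow_nonneg (opNorm_nonneg A) _)).2
  rw [div_pow, div_mul_eq_mul_div, div_le_iff₀ (pow_pos hz0 p)] at hle
  rwa [wave, norm_mul, norm_pow, norm_pow]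

theorem norm_diagCoeff_le (p s : ℕ) (A : Mat) : ‖diagCoeff p s A‖ ≤ opNorm A ^ (p + s) := by
  rcases eq_or_ne p 0 with rfl | hp
  · rw [diagCoeff_zero_left, norm_pow, zero_add]
    exact pow_le_pow_left₀ (norm_nonneg _) (norm_apply_le_opNorm A 1 1) s
  rcases eq_or_ne s 0 with rfl | hs
  · rw [diagCoeff_zero_right, norm_pow, add_zero]
    exact pow_le_pow_left₀ (norm_nonneg _) (norm_apply_le_opNorm A 0 0) p
  have hρ : 0 < √((p : ℝ) / s) := Real.sqrt_pos.2 (by positivity)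
  have hCauchy := norm_coeff_mul_pow_le
    (P := linearPowMul (A 0 0) (A 0 1) (A 1 0) (A 1 1) p s)
    (C := opNorm A ^ (p + s) * √((p : ℝ) / s) ^ p) hρ.le (fun z hz => by
      rw [eval_linearPowMul_eq_wave]
      exact hz ▸ norm_wave_le hp hs hz A) p
  rw [← diagCoeff_eq_coeff] at hCauchy
  exact le_of_mul_le_mul_right hCauchy (pow_pos hρ p)

theorem norm_diagCoeff_emb_le (p s : ℕ) (g : SU2) : ‖diagCoeff p s (emb g)‖ ≤ 1 := by
  simpa [opNorm_emb] using norm_diagCoeff_le p s (emb g)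

theorem diagCoeff_emb_one (p s : ℕ) : diagCoeff p s (emb 1) = 1 := by
  rw [diagCoeff, Finset.sum_eq_single 0]
  · simp [emb_one]
  · intro j _ hj
    simp [emb_one, hj]
  · simp

theorem diagCoeff_emb_inv (p s : ℕ) (g : SU2) :
    diagCoeff p s (emb g⁻¹) = diagCoeff s p (emb g) := by
  refine diagCoeff_congr_swap ?_ ?_ ?_ p s
  · rw [emb_inv, emb_one_one]
  · rw [emb_inv, emb_one_one, star_star]
  · rw [emb_inv, emb_inv, emb_one_zero, star_neg, star_star]
    ring

theorem star_diagCoeff_emb (p s : ℕ) (g : SU2) :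
    star (diagCoeff p s (emb g)) = diagCoeff s p (emb g) := by
  rw [← diagCoeff_congr_swap (A := emb g) (B := fun i j => star (emb g i j)) (p := p) (s := s)]
  · simp [diagCoeff]
  · rw [emb_one_one]
  · rw [emb_one_one, star_star]
  · rw [emb_one_zero, star_neg, star_star]
    ring

/-! ### Termwise differentiation of holomorphic series -/

namespace LocallyNormallySummable

variable {I : Type*}

section LieDeriv

variable {E : Type*} [NormedAddCommGroup E] [NormedSpace ℂ E] {f : I → E → ℂ} {U : Set E}

protected theorem lieDeriv (h : LocallyNormallySummable f U) (hf : ∀ i, Differentiable ℂ (f i))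
    (R : E →L[ℂ] E) : LocallyNormallySummable (fun i => lieDeriv R (f i)) U := by
  intro x hx
  obtain ⟨r, hr, B, hB, hfB⟩ := h.fderiv hf x hx
  refine ⟨r, hr, fun i => B i * (‖R‖ * (‖x‖ + r)), hB.mul_right _, fun i y hy => ?_⟩
  have hy_norm : ‖y‖ ≤ ‖x‖ + r := by
    linarith [mem_ball_iff_norm.1 hy, norm_le_norm_add_norm_sub' y x]
  have hB_nonneg : 0 ≤ B i := (norm_nonneg _).trans (hfB i y hy)
  calc ‖fderiv ℂ (f i) y (R y)‖ ≤ ‖fderiv ℂ (f i) y‖ * (‖R‖ * ‖y‖) :=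
        (ContinuousLinearMap.le_opNorm _ _).trans (by gcongr; exact R.le_opNorm y)
    _ ≤ B i * (‖R‖ * (‖x‖ + r)) := by gcongr; exact hfB i y hy

theorem lieDeriv_tsum (h : LocallyNormallySummable f U) (hf : ∀ i, Differentiable ℂ (f i))
    (R : E →L[ℂ] E) {x : E} (hx : x ∈ U) :
    lieDeriv R (fun y => ∑' i, f i y) x = ∑' i, lieDeriv R (f i) x := by
  rw [SubellipticSU2.lieDeriv, (h.hasFDerivAt_tsum hf hx).fderiv]
  exact (ContinuousLinearMap.apply ℂ ℂ (R x)).map_tsum ((h.fderiv hf).summable hx)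

theorem hasSum_lieDeriv_lieDeriv (hU : IsOpen U) (h : LocallyNormallySummable f U)
    (hf : ∀ i, ContDiff ℂ (⊤ : ℕ∞) (f i)) (R : E →L[ℂ] E) {x : E} (hx : x ∈ U) :
    HasSum (fun i => lieDeriv R (lieDeriv R (f i)) x)
      (lieDeriv R (lieDeriv R (fun y => ∑' i, f i y)) x) := by
  have hd : ∀ i, Differentiable ℂ (f i) := fun i => (hf i).differentiable (by simp)
  have hd_lie : ∀ i, Differentiable ℂ (lieDeriv R (f i)) := fun i =>
    (contDiff_lieDeriv (hf i) R).differentiable (by simp)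
  have h_lie := h.lieDeriv hd R
  have heq : lieDeriv R (fun y => ∑' i, f i y) =ᶠ[𝓝 x] fun y => ∑' i, lieDeriv R (f i) y := by
    filter_upwards [hU.mem_nhds hx] with y hy using h.lieDeriv_tsum hd R hy
  have hsum := ((h_lie.lieDeriv hd_lie R).summable hx).hasSum
  rwa [← h_lie.lieDeriv_tsum hd_lie R hx, SubellipticSU2.lieDeriv, ← heq.fderiv_eq] at hsum

end LieDeriv

theorem hasSum_complexLaplacian {f : I → Mat → ℂ} {U : Set Mat} (hU : IsOpen U)
    (h : LocallyNormallySummable f U) (hf : ∀ i, ContDiff ℂ (⊤ : ℕ∞) (f i)) {x : Mat}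
    (hx : x ∈ U) : HasSum (fun i => complexLaplacian (f i) x)
      (complexLaplacian (fun y => ∑' i, f i y) x) :=
  (h.hasSum_lieDeriv_lieDeriv hU hf _ hx).add (h.hasSum_lieDeriv_lieDeriv hU hf _ hx)

end LocallyNormallySummable

/-! ### Series of diagonal coefficients -/

/-- The real part of the series `∑ c (p, s) D_{p, s}` of diagonal coefficients on `SU(2)`; for
summable `c` with `c (p, s) = c (s, p)` the series is real. -/
noncomputable def diagSeries (c : ℕ × ℕ → ℝ) (g : SU2) : ℝ :=
  ∑' i, c i * (diagCoeff i.1 i.2 (emb g)).re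

theorem norm_mul_re_diagCoeff_le (c : ℝ) (i : ℕ × ℕ) (g : SU2) :
    ‖c * (diagCoeff i.1 i.2 (emb g)).re‖ ≤ |c| := by
  rw [norm_mul, Real.norm_eq_abs, Real.norm_eq_abs]
  exact mul_le_of_le_one_right (abs_nonneg _)
    ((Complex.abs_re_le_norm _).trans (norm_diagCoeff_emb_le _ _ g))

theorem continuous_diagCoeff_emb (i : ℕ × ℕ) :
    Continuous fun g => diagCoeff i.1 i.2 (emb g) :=
  (contDiff_of_mem_eigenspace (diagCoeff_mem_eigenspace i.1 i.2)).continuous.comp continuous_emb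

theorem diagSeries_inv (c : ℕ × ℕ → ℝ) (g : SU2) : diagSeries c g⁻¹ = diagSeries c g := by
  refine tsum_congr fun i => ?_
  rw [diagCoeff_emb_inv, ← star_diagCoeff_emb, Complex.star_def, Complex.conj_re]

theorem diagSeries_congr_emb {g h : SU2} (hdiag : emb g 0 0 = emb h 0 0)
    (hoff : emb g 0 1 * emb g 1 0 = emb h 0 1 * emb h 1 0) (c : ℕ × ℕ → ℝ) :
    diagSeries c g = diagSeries c h := by
  simp only [diagSeries, diagCoeff, emb_one_one, hdiag, hoff]

theorem continuousAt_diagSeries {T : Type*} [TopologicalSpace T] {c : T → ℕ × ℕ → ℝ}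
    {B : ℕ × ℕ → ℝ} {t : T} (hc : ∀ i, Continuous fun s => c s i) (hB : Summable B)
    (hcB : ∀ᶠ s in 𝓝 t, ∀ i, |c s i| ≤ B i) (g : SU2) :
    ContinuousAt (fun q : T × SU2 => diagSeries (c q.1) q.2) (t, g) := by
  have hon : ContinuousOn (fun q : T × SU2 => diagSeries (c q.1) q.2)
      {q | ∀ i, |c q.1 i| ≤ B i} :=
    continuousOn_tsum (fun i => (((hc i).comp continuous_fst).mul (Complex.continuous_re.comp
      ((continuous_diagCoeff_emb i).comp continuous_snd))).continuousOn) hB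
      fun i q hq => (norm_mul_re_diagCoeff_le _ i _).trans (hq i)
  exact hon.continuousAt (continuous_fst.tendsto (t, g) hcB)

section Summable

variable {c : ℕ × ℕ → ℝ} (hc : Summable fun i => |c i|)

include hc

theorem summable_diagSeries (g : SU2) :
    Summable fun i => c i * (diagCoeff i.1 i.2 (emb g)).re :=
  .of_norm_bounded hc fun i => norm_mul_re_diagCoeff_le _ i g

theorem summable_ofReal_mul_diagCoeff (g : SU2) :
    Summable fun i => (c i : ℂ) * diagCoeff i.1 i.2 (emb g) :=
  .of_norm_bounded hc fun i => by
    rw [norm_mul, Complex.norm_real, Real.norm_eq_abs]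
    exact mul_le_of_le_one_right (abs_nonneg _) (norm_diagCoeff_emb_le _ _ g)

theorem re_tsum_diagCoeff (g : SU2) :
    (∑' i, (c i : ℂ) * diagCoeff i.1 i.2 (emb g)).re = diagSeries c g := by
  rw [Complex.re_tsum (summable_ofReal_mul_diagCoeff hc g)]
  simp [diagSeries]

theorem ofReal_diagSeries (hsymm : ∀ i, c i.swap = c i) (g : SU2) :
    (diagSeries c g : ℂ) = ∑' i, (c i : ℂ) * diagCoeff i.1 i.2 (emb g) := by
  rw [← re_tsum_diagCoeff hc g]
  refine Complex.conj_eq_iff_re.1 ?_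
  rw [Complex.conj_tsum, ← (Equiv.prodComm ℕ ℕ).tsum_eq]
  refine tsum_congr fun i => ?_
  rw [map_mul, Complex.conj_ofReal, starRingEnd_apply, star_diagCoeff_emb, Equiv.prodComm_apply,
    hsymm, Prod.fst_swap, Prod.snd_swap]

end Summable

section Weighted

variable {c : ℕ × ℕ → ℝ} {M : ℝ} (hM : 1 < M)
  (hc : Summable fun i : ℕ × ℕ => |c i| * M ^ (i.1 + i.2))

include hc

theorem locallyNormallySummable_diagCoeff : LocallyNormallySummable
    (fun (i : ℕ × ℕ) A => (c i : ℂ) * diagCoeff i.1 i.2 A) (opNormBall M) := by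
  intro x hx
  obtain ⟨ε, hε, hball⟩ := Metric.isOpen_iff.1 (isOpen_opNormBall M) x hx
  refine ⟨ε, hε, _, hc, fun i y hy => ?_⟩
  rw [norm_mul, Complex.norm_real, Real.norm_eq_abs]
  gcongr
  exact (norm_diagCoeff_le _ _ y).trans
    (pow_le_pow_left₀ (opNorm_nonneg y) (hball hy).le _)

include hM

theorem summable_abs_of_summable_mul_pow : Summable fun i => |c i| :=
  hc.of_nonneg_of_le (fun _ => abs_nonneg _) fun _ =>
    le_mul_of_one_le_right (abs_nonneg _) (one_le_pow₀ hM.le)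

theorem isSmooth_diagSeries : IsSmooth (diagSeries c) := by
  have hsmooth := isSmooth_re (isOpen_opNormBall M) (emb_mem_opNormBall hM)
    ((locallyNormallySummable_diagCoeff hc).contDiffOn_tsum fun i =>
      contDiff_const.mul (contDiff_of_mem_eigenspace (diagCoeff_mem_eigenspace i.1 i.2)))
  simpa only [re_tsum_diagCoeff (summable_abs_of_summable_mul_pow hM hc)] using hsmooth

theorem sublaplacian_diagSeries (g : SU2) :
    sublaplacian (diagSeries c) g = diagSeries (fun i => -eigenvalue i * c i) g := by
  have hmem : ∀ i : ℕ × ℕ, (fun A => (c i : ℂ) * diagCoeff i.1 i.2 A) ∈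
      eigenspace (eigenvalue i) := fun i =>
    Submodule.smul_mem _ (c i : ℂ) (diagCoeff_mem_eigenspace i.1 i.2)
  have hloc := locallyNormallySummable_diagCoeff hc
  have hf := fun i => contDiff_of_mem_eigenspace (hmem i)
  have hsub := sublaplacian_re (isOpen_opNormBall M) (emb_mem_opNormBall hM)
    (hloc.contDiffOn_tsum hf) g
  simp only [re_tsum_diagCoeff (summable_abs_of_summable_mul_pow hM hc)] at hsub
  rw [hsub, ← (Complex.hasSum_re (hloc.hasSum_complexLaplacian (isOpen_opNormBall M) hf
    (emb_mem_opNormBall hM g))).tsum_eq]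
  refine tsum_congr fun i => ?_
  rw [complexLaplacian_of_mem_eigenspace (hmem i)]
  simp [mul_assoc]

end Weighted

/-! ### The heat series -/

/-- The dimension of the representation on binary forms of degree `p + s`. -/
def dimension (i : ℕ × ℕ) : ℝ := i.1 + i.2 + 1

theorem dimension_pos (i : ℕ × ℕ) : 0 < dimension i := by unfold dimension; positivity

theorem dimension_swap (i : ℕ × ℕ) : dimension i.swap = dimension i := by
  simp [dimension, add_comm]

theorem eigenvalue_nonneg (i : ℕ × ℕ) : 0 ≤ eigenvalue i := by unfold eigenvalue; positivity

theorem eigenvalue_swap (i : ℕ × ℕ) : eigenvalue i.swap = eigenvalue i := by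
  simp [eigenvalue, add_comm, mul_comm]

theorem two_mul_le_eigenvalue (i : ℕ × ℕ) : 2 * (i.1 + i.2 : ℝ) ≤ eigenvalue i :=
  le_add_of_nonneg_right (by positivity)

/-- The coefficient `(p + s + 1) exp (-λ t)` of `D_{p, s}` in the heat kernel at time `t`, where
`λ` is the eigenvalue of `-ℒ` on `D_{p, s}`. -/
noncomputable def heatCoeff (t : ℝ) (i : ℕ × ℕ) : ℝ :=
  dimension i * Real.exp (-(t * eigenvalue i))

theorem heatCoeff_pos (t : ℝ) (i : ℕ × ℕ) : 0 < heatCoeff t i :=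
  mul_pos (dimension_pos i) (Real.exp_pos _)

theorem heatCoeff_swap (t : ℝ) (i : ℕ × ℕ) : heatCoeff t i.swap = heatCoeff t i := by
  rw [heatCoeff, heatCoeff, dimension_swap, eigenvalue_swap]

theorem heatCoeff_anti {s t : ℝ} (h : s ≤ t) (i : ℕ × ℕ) : heatCoeff t i ≤ heatCoeff s i :=
  mul_le_mul_of_nonneg_left (Real.exp_le_exp.2 <| neg_le_neg <|
    mul_le_mul_of_nonneg_right h (eigenvalue_nonneg i)) (dimension_pos i).le

theorem hasDerivAt_heatCoeff (t : ℝ) (i : ℕ × ℕ) :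
    HasDerivAt (fun t => heatCoeff t i) (-eigenvalue i * heatCoeff t i) t := by
  refine (((hasDerivAt_mul_const (eigenvalue i)).fun_neg.exp).const_mul
    (dimension i)).congr_deriv ?_
  rw [heatCoeff]
  ring

theorem continuous_heatCoeff (i : ℕ × ℕ) : Continuous fun t => heatCoeff t i :=
  continuous_iff_continuousAt.2 fun t => (hasDerivAt_heatCoeff t i).continuousAt

theorem abs_neg_eigenvalue_mul_heatCoeff (t : ℝ) (i : ℕ × ℕ) :
    |-eigenvalue i * heatCoeff t i| = eigenvalue i * heatCoeff t i := by
  rw [abs_mul, abs_neg, abs_of_nonneg (eigenvalue_nonneg i), abs_of_pos (heatCoeff_pos t i)]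

theorem summable_succ_pow_mul_exp (k : ℕ) {t : ℝ} (ht : 0 < t) :
    Summable fun n : ℕ => ((n : ℝ) + 1) ^ k * Real.exp (-(t * n)) := by
  refine (((summable_nat_add_iff 1).2 (Real.summable_pow_mul_exp_neg_nat_mul k ht)).mul_left
    (Real.exp t)).congr fun n => ?_
  rw [mul_left_comm, ← Real.exp_add]
  push_cast
  ring_nf

-- The summand is at most the product of the same function of `p` and of `s`.
theorem summable_eigenvalue_pow_mul_heatCoeff (k : ℕ) {t : ℝ} (ht : 0 < t) :
    Summable fun i => eigenvalue i ^ k * heatCoeff t i := by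
  have hsum := summable_succ_pow_mul_exp (k + 1) (t := 2 * t) (by positivity)
  refine ((hsum.mul_of_nonneg hsum (fun n => by positivity) fun n => by positivity).mul_left
    ((4 : ℝ) ^ k)).of_nonneg_of_le (fun i => mul_nonneg (pow_nonneg (eigenvalue_nonneg i) _)
    (heatCoeff_pos t i).le) fun i => ?_
  have hprod : (0 : ℝ) ≤ i.1 * i.2 := by positivity
  have hdim : dimension i ≤ (i.1 + 1) * (i.2 + 1) := by unfold dimension; linarith
  have heig : eigenvalue i ≤ 4 * ((i.1 + 1) * (i.2 + 1)) := by
    unfold eigenvalue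
    linarith [Nat.cast_nonneg (α := ℝ) i.1, Nat.cast_nonneg (α := ℝ) i.2]
  have hexp : Real.exp (-(t * eigenvalue i)) ≤
      Real.exp (-(2 * t * i.1)) * Real.exp (-(2 * t * i.2)) := by
    rw [← Real.exp_add, Real.exp_le_exp]
    linarith [mul_le_mul_of_nonneg_left (two_mul_le_eigenvalue i) ht.le]
  calc eigenvalue i ^ k * heatCoeff t i
      ≤ (4 * ((i.1 + 1) * (i.2 + 1))) ^ k * (((i.1 + 1) * (i.2 + 1)) *
          (Real.exp (-(2 * t * i.1)) * Real.exp (-(2 * t * i.2)))) := by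
        have hdim_nonneg := (dimension_pos i).le
        have heig_nonneg := eigenvalue_nonneg i
        unfold heatCoeff
        gcongr
    _ = _ := by simp only [mul_pow]; ring

theorem summable_heatCoeff {t : ℝ} (ht : 0 < t) : Summable (heatCoeff t) := by
  simpa using summable_eigenvalue_pow_mul_heatCoeff 0 ht

theorem summable_eigenvalue_mul_heatCoeff {t : ℝ} (ht : 0 < t) :
    Summable fun i => eigenvalue i * heatCoeff t i := by
  simpa using summable_eigenvalue_pow_mul_heatCoeff 1 ht

theorem summable_abs_heatCoeff {t : ℝ} (ht : 0 < t) : Summable fun i => |heatCoeff t i| :=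
  (summable_heatCoeff ht).abs

theorem summable_heatCoeff_mul_exp_pow {t : ℝ} (ht : 0 < t) :
    Summable fun i : ℕ × ℕ => |heatCoeff t i| * Real.exp t ^ (i.1 + i.2) := by
  refine (summable_heatCoeff (half_pos ht)).of_nonneg_of_le (fun i => by positivity) fun i => ?_
  rw [abs_of_pos (heatCoeff_pos t i), heatCoeff, heatCoeff, mul_assoc, ← Real.exp_nat_mul,
    ← Real.exp_add]
  refine mul_le_mul_of_nonneg_left (Real.exp_le_exp.2 ?_) (dimension_pos i).le
  push_cast
  linarith [mul_le_mul_of_nonneg_left (two_mul_le_eigenvalue i) (half_pos ht).le]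

/-- The series `p_t = ∑ (p + s + 1) exp (-λ t) D_{p, s}`, which turns out to be the heat kernel. -/
noncomputable def heatSeries (t : ℝ) : SU2 → ℝ := diagSeries (heatCoeff t)

theorem isSmooth_heatSeries {t : ℝ} (ht : 0 < t) : IsSmooth (heatSeries t) :=
  isSmooth_diagSeries (Real.one_lt_exp_iff.2 ht) (summable_heatCoeff_mul_exp_pow ht)

theorem sublaplacian_heatSeries {t : ℝ} (ht : 0 < t) (g : SU2) :
    sublaplacian (heatSeries t) g = diagSeries (fun i => -eigenvalue i * heatCoeff t i) g :=
  sublaplacian_diagSeries (Real.one_lt_exp_iff.2 ht) (summable_heatCoeff_mul_exp_pow ht) g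

theorem hasDerivAt_heatSeries {t : ℝ} (ht : 0 < t) (g : SU2) :
    HasDerivAt (fun s => heatSeries s g) (sublaplacian (heatSeries t) g) t := by
  rw [sublaplacian_heatSeries ht]
  refine hasDerivAt_tsum_of_isPreconnected
    (summable_eigenvalue_mul_heatCoeff (half_pos ht)) isOpen_Ioi isPreconnected_Ioi
    (g := fun i s => heatCoeff s i * (diagCoeff i.1 i.2 (emb g)).re)
    (g' := fun i s => -eigenvalue i * heatCoeff s i * (diagCoeff i.1 i.2 (emb g)).re)
    (fun i s _ => (hasDerivAt_heatCoeff s i).mul_const _) (fun i s hs => ?_)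
    (Set.mem_Ioi.2 (half_lt_self ht)) (summable_diagSeries (summable_abs_heatCoeff ht) g)
    (Set.mem_Ioi.2 (half_lt_self ht))
  refine (norm_mul_re_diagCoeff_le _ i g).trans ?_
  rw [abs_neg_eigenvalue_mul_heatCoeff]
  exact mul_le_mul_of_nonneg_left (heatCoeff_anti hs.le i) (eigenvalue_nonneg i)

theorem continuousAt_heatSeries {t : ℝ} (ht : 0 < t) (g : SU2) :
    ContinuousAt (fun q : ℝ × SU2 => heatSeries q.1 q.2) (t, g) := by
  refine continuousAt_diagSeries continuous_heatCoeff (summable_heatCoeff (half_pos ht)) ?_ g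
  filter_upwards [Ici_mem_nhds (half_lt_self ht)] with s hs i
  rw [abs_of_pos (heatCoeff_pos s i)]
  exact heatCoeff_anti hs i

theorem continuousAt_sublaplacian_heatSeries {t : ℝ} (ht : 0 < t) (g : SU2) :
    ContinuousAt (fun q : ℝ × SU2 => sublaplacian (heatSeries q.1) q.2) (t, g) := by
  refine (continuousAt_diagSeries (c := fun s i => -eigenvalue i * heatCoeff s i)
    (fun i => (continuous_heatCoeff i).const_mul _)
    (summable_eigenvalue_mul_heatCoeff (half_pos ht)) ?_ g).congr ?_
  · filter_upwards [Ici_mem_nhds (half_lt_self ht)] with s hs i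
    rw [abs_neg_eigenvalue_mul_heatCoeff]
    exact mul_le_mul_of_nonneg_left (heatCoeff_anti hs i) (eigenvalue_nonneg i)
  · filter_upwards [continuousAt_fst (Ioi_mem_nhds ht)] with q hq
    exact (sublaplacian_heatSeries hq q.2).symm

/-! ### Integrals of monomials -/

/-- The monomial `a ^ i b ^ j c ^ k d ^ l` in the entries of a matrix of `SU(2)`. -/
noncomputable def monomial (i j k l : ℕ) (g : SU2) : ℂ :=
  emb g 0 0 ^ i * emb g 0 1 ^ j * (emb g 1 0 ^ k * emb g 1 1 ^ l)

theorem continuous_monomial (i j k l : ℕ) : Continuous (monomial i j k l) := by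
  have := continuous_emb_apply
  unfold monomial
  fun_prop

theorem integrable_monomial (i j k l : ℕ) : Integrable (monomial i j k l) haar :=
  integrable_of_continuous (continuous_monomial i j k l)

/-- The diagonal element of `SU(2)` with upper left entry `τ`. -/
def diagonal (τ : ℂ) (hτ : ‖τ‖ = 1) : SU2 :=
  mk τ 0 (by rw [Complex.normSq_eq_norm_sq, hτ, map_zero, one_pow, add_zero])

theorem emb_diagonal (τ : ℂ) (hτ : ‖τ‖ = 1) : emb (diagonal τ hτ) = ![![τ, 0], ![0, star τ]] := by
  rw [diagonal, emb_mk, star_zero, neg_zero]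

theorem monomial_diagonal_mul (i j k l : ℕ) (τ : ℂ) (hτ : ‖τ‖ = 1) (g : SU2) :
    monomial i j k l (diagonal τ hτ * g) =
      τ ^ (i + j) * star τ ^ (k + l) * monomial i j k l g := by
  simp only [monomial, emb_mul, emb_diagonal, Matrix.cons_val_zero, Matrix.cons_val_one, zero_mul,
    add_zero, zero_add, mul_pow, pow_add]
  ring

theorem monomial_mul_diagonal (i j k l : ℕ) (τ : ℂ) (hτ : ‖τ‖ = 1) (g : SU2) :
    monomial i j k l (g * diagonal τ hτ) =
      τ ^ (i + k) * star τ ^ (j + l) * monomial i j k l g := by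
  simp only [monomial, emb_mul, emb_diagonal, Matrix.cons_val_zero, Matrix.cons_val_one, mul_zero,
    add_zero, zero_add, mul_pow, pow_add]
  ring

theorem eq_of_forall_pow_mul_star_pow_eq_one {m n : ℕ}
    (h : ∀ τ : ℂ, ‖τ‖ = 1 → τ ^ m * star τ ^ n = 1) : m = n := by
  set ζ := rootOfUnity (m + n + 1)
  have hprim : IsPrimitiveRoot ζ (m + n + 1) := isPrimitiveRoot_rootOfUnity (by omega)
  have hnorm : ‖ζ‖ = 1 := norm_rootOfUnity (by omega)
  have hstar : star ζ * ζ = 1 := by simpa [hnorm] using Complex.conj_mul' ζ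
  refine hprim.pow_inj (by omega) (by omega) ?_
  calc ζ ^ m = ζ ^ m * (star ζ * ζ) ^ n := by rw [hstar, one_pow, mul_one]
    _ = (ζ ^ m * star ζ ^ n) * ζ ^ n := by ring
    _ = ζ ^ n := by rw [h ζ hnorm, one_mul]

theorem integral_monomial_eq_zero {i j k l : ℕ} (h : ¬(i + j = k + l ∧ i + k = j + l)) :
    ∫ g, monomial i j k l g ∂haar = 0 := by
  by_contra hI
  refine h ⟨eq_of_forall_pow_mul_star_pow_eq_one fun τ hτ => mul_right_cancel₀ hI ?_,
    eq_of_forall_pow_mul_star_pow_eq_one fun τ hτ => mul_right_cancel₀ hI ?_⟩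
  · simp only [one_mul, ← integral_const_mul, ← monomial_diagonal_mul i j k l τ hτ]
    exact integral_mul_left_eq_self _ _
  · simp only [one_mul, ← integral_const_mul, ← monomial_mul_diagonal i j k l τ hτ]
    exact integral_mul_right_eq_self _ _

theorem lieDeriv_mul {𝕜 E : Type*} [NontriviallyNormedField 𝕜] [NormedAddCommGroup E]
    [NormedSpace 𝕜 E] {F G : E → 𝕜} (hF : Differentiable 𝕜 F) (hG : Differentiable 𝕜 G)
    (R : E →L[𝕜] E) : lieDeriv R (F * G) = F * lieDeriv R G + G * lieDeriv R F := by
  funext A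
  simp [lieDeriv, fderiv_mul (hF A) (hG A)]

theorem continuous_lieDeriv_emb {F : Mat → ℂ} (hF : ContDiff ℂ (⊤ : ℕ∞) F) (R : Mat →L[ℂ] Mat) :
    Continuous fun g => lieDeriv R F (emb g) :=
  (contDiff_lieDeriv hF R).continuous.comp continuous_emb

theorem integral_lieDeriv {γ : ℝ → SU2} {J : Matrix (Fin 2) (Fin 2) ℂ} (hd : IsDirection γ J)
    {F : Mat → ℂ} (hF : ContDiff ℂ (⊤ : ℕ∞) F) :
    ∫ g, lieDeriv (rightMul J) F (emb g) ∂haar = 0 := by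
  have hre : ∀ {F : Mat → ℂ}, ContDiff ℂ (⊤ : ℕ∞) F →
      ∫ g, (lieDeriv (rightMul J) F (emb g)).re ∂haar = 0 := fun {F} hF => by
    have hzero := integral_fieldAlong hd
      (isSmooth_re isOpen_univ (fun _ => Set.mem_univ _) hF.contDiffOn)
    rwa [funext fun g => fieldAlong_re hd (hF.differentiable (by simp) (emb g))] at hzero
  have hint := integrable_of_continuous (μ := haar) (continuous_lieDeriv_emb hF (rightMul J))
  have him := hre (F := -Complex.I • F) (hF.const_smul (-Complex.I))
  rw [lieDeriv_const_smul (hF.differentiable (by simp))] at him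
  refine Complex.ext ((integral_re hint).symm.trans (hre hF)) ((integral_im hint).symm.trans ?_)
  simpa using him

-- The complex field `X - i Y` annihilates the first column `(a, c)` and maps `(b, d)` to
-- `2 (a, c)`.
theorem lieDeriv_pauliX_wave_sub (x y : ℂ) (p s : ℕ) :
    lieDeriv (rightMul pauliX) (wave x y p s) -
      Complex.I • lieDeriv (rightMul pauliY) (wave x y p s) =
      (2 * s : ℂ) • wave x y (p + 1) (s - 1) := by
  rw [lieDeriv_rightMul_pauliX_wave, lieDeriv_rightMul_pauliY_wave, smul_add, smul_smul, smul_smul,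
    ← mul_assoc, ← mul_assoc, Complex.I_mul_I]
  module

theorem wave_one_zero (p s : ℕ) (A : Mat) : wave 1 0 p s A = A 0 0 ^ p * A 0 1 ^ s := by
  simp [wave, columnForm_apply]

theorem wave_zero_one (p s : ℕ) (A : Mat) : wave 0 1 p s A = A 1 0 ^ p * A 1 1 ^ s := by
  simp [wave, columnForm_apply]

theorem continuous_wave_emb (x y : ℂ) (p s : ℕ) : Continuous fun g => wave x y p s (emb g) :=
  (contDiff_wave x y p s).continuous.comp continuous_emb

/-- The integral of `(a d) ^ p (b c) ^ s` over `SU(2)`, a beta integral up to sign. -/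
noncomputable def betaIntegral (p s : ℕ) : ℂ := ∫ g, monomial p s s p g ∂haar

theorem betaIntegral_succ_sub (p s : ℕ) :
    betaIntegral (p + 1) s - betaIntegral p (s + 1) = betaIntegral p s := by
  rw [betaIntegral, betaIntegral, betaIntegral,
    ← integral_sub (integrable_monomial _ _ _ _) (integrable_monomial _ _ _ _)]
  refine integral_congr_ae (Eventually.of_forall fun g => ?_)
  simp only [monomial]
  linear_combination
    (emb g 0 0 ^ p * emb g 0 1 ^ s * (emb g 1 0 ^ s * emb g 1 1 ^ p)) * emb_det g

-- Integrate the `X - i Y` derivative of `a ^ p b ^ (s + 1) c ^ s d ^ (p + 1)`.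
theorem betaIntegral_add (p s : ℕ) :
    (s + 1) * betaIntegral (p + 1) s + (p + 1) * betaIntegral p (s + 1) = 0 := by
  set F : Mat → ℂ := wave 1 0 p (s + 1) * wave 0 1 s (p + 1)
  have hF : ContDiff ℂ (⊤ : ℕ∞) F := (contDiff_wave _ _ _ _).mul (contDiff_wave _ _ _ _)
  have hint : ∀ J, Integrable (fun g => lieDeriv (rightMul J) F (emb g)) haar := fun J =>
    integrable_of_continuous (continuous_lieDeriv_emb hF _)
  have hzero : ∫ g, (lieDeriv (rightMul pauliX) F (emb g) -
      Complex.I * lieDeriv (rightMul pauliY) F (emb g)) ∂haar = 0 := by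
    rw [integral_sub (hint _) ((hint _).const_mul _), integral_const_mul,
      integral_lieDeriv isDirection_expX hF, integral_lieDeriv isDirection_expY hF, mul_zero,
      sub_zero]
  have hderiv : ∀ g, lieDeriv (rightMul pauliX) F (emb g) -
      Complex.I * lieDeriv (rightMul pauliY) F (emb g) =
      2 * ((s + 1) * monomial (p + 1) s s (p + 1) g +
        (p + 1) * monomial p (s + 1) (s + 1) p g) := fun g => by
    have hd : ∀ x y p s, Differentiable ℂ (wave x y p s) := fun x y p s =>
      (contDiff_wave x y p s).differentiable (by simp)
    have hleft := congrFun (lieDeriv_pauliX_wave_sub 1 0 p (s + 1)) (emb g)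
    have hright := congrFun (lieDeriv_pauliX_wave_sub 0 1 s (p + 1)) (emb g)
    simp only [Pi.sub_apply, Pi.smul_apply, smul_eq_mul, wave_one_zero, wave_zero_one,
      Nat.add_sub_cancel] at hleft hright
    simp only [F, lieDeriv_mul (hd _ _ _ _) (hd _ _ _ _), Pi.add_apply, Pi.mul_apply,
      wave_one_zero, wave_zero_one, monomial]
    push_cast at hleft hright
    linear_combination (emb g 1 0 ^ s * emb g 1 1 ^ (p + 1)) * hleft +
      (emb g 0 0 ^ p * emb g 0 1 ^ (s + 1)) * hright
  simp only [hderiv] at hzero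
  rw [integral_const_mul, integral_add ((integrable_monomial _ _ _ _).const_mul _)
    ((integrable_monomial _ _ _ _).const_mul _), integral_const_mul, integral_const_mul] at hzero
  exact (mul_eq_zero.1 hzero).resolve_left two_ne_zero

theorem betaIntegral_succ_left (p s : ℕ) :
    (p + s + 2) * betaIntegral (p + 1) s = (p + 1) * betaIntegral p s := by
  linear_combination betaIntegral_add p s + (p + 1) * betaIntegral_succ_sub p s

theorem betaIntegral_succ_right (p s : ℕ) :
    (p + s + 2) * betaIntegral p (s + 1) = -(s + 1) * betaIntegral p s := by
  linear_combination betaIntegral_add p s - (s + 1) * betaIntegral_succ_sub p s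

theorem factorial_mul_betaIntegral (p s : ℕ) :
    ((p + s + 1).factorial : ℂ) * betaIntegral p s = (-1) ^ s * (p.factorial * s.factorial) := by
  induction s with
  | zero =>
    induction p with
    | zero => simp [betaIntegral, monomial]
    | succ p ih =>
      have hrec := betaIntegral_succ_left p 0
      rw [add_zero] at ih ⊢
      rw [Nat.factorial_succ (p + 1), Nat.factorial_succ p]
      rw [Nat.factorial_succ p] at ih
      push_cast at hrec ih ⊢
      linear_combination ((p + 1) * p.factorial : ℂ) * hrec + (p + 1) * ih
  | succ s ih =>
    have hrec := betaIntegral_succ_right p s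
    rw [← add_assoc, Nat.factorial_succ, Nat.factorial_succ s]
    push_cast at hrec ih ⊢
    linear_combination ((p + s + 1).factorial : ℂ) * hrec - (s + 1) * ih

theorem dimension_mul_choose_mul_betaIntegral (p s : ℕ) :
    (dimension (p, s) : ℂ) * ((p + s).choose s * ((-1) ^ s * betaIntegral p s)) = 1 := by
  have hfact := factorial_mul_betaIntegral p s
  have hchoose : ((p + s).choose s : ℂ) * p.factorial * s.factorial = (p + s).factorial := by
    exact_mod_cast Nat.add_choose_mul_factorial_mul_factorial p s
  have hne : (p.factorial * s.factorial : ℂ) ≠ 0 := by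
    exact_mod_cast mul_ne_zero p.factorial_ne_zero s.factorial_ne_zero
  have hsign : (-1 : ℂ) ^ s * (-1) ^ s = 1 := by rw [← mul_pow]; simp
  refine mul_right_cancel₀ hne ?_
  rw [Nat.factorial_succ] at hfact
  simp only [dimension]
  push_cast at hfact ⊢
  linear_combination ((-1) ^ s) * hfact + ((p + s + 1) * ((-1) ^ s * betaIntegral p s)) * hchoose +
    (p.factorial * s.factorial : ℂ) * hsign

/-! ### Orthogonality of waves -/

theorem columnForm_emb_mul (x y : ℂ) (j : Fin 2) (k h : SU2) :
    columnForm x y j (emb (k * h)) =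
      columnForm (columnForm x y 0 (emb k)) (columnForm x y 1 (emb k)) j (emb h) := by
  simp only [columnForm_apply, emb_mul]
  ring

theorem wave_emb_mul (x y : ℂ) (p s : ℕ) (k h : SU2) :
    wave x y p s (emb (k * h)) =
      wave (columnForm x y 0 (emb k)) (columnForm x y 1 (emb k)) p s (emb h) := by
  simp only [wave, columnForm_emb_mul]

theorem columnForm_det (x y x' y' : ℂ) (k : SU2) :
    columnForm x y 0 (emb k) * columnForm x' y' 1 (emb k) -
      columnForm x' y' 0 (emb k) * columnForm x y 1 (emb k) = x * y' - x' * y := by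
  simp only [columnForm_apply]
  linear_combination (x * y' - x' * y) * emb_det k

theorem columnForm_det_inv (x y x' y' : ℂ) (k : SU2) :
    x * columnForm x' y' 1 (emb k⁻¹) - columnForm x' y' 0 (emb k⁻¹) * y =
      columnForm x y 0 (emb k) * y' - x' * columnForm x y 1 (emb k) := by
  rw [← columnForm_det _ _ _ _ k, ← columnForm_emb_mul, ← columnForm_emb_mul, inv_mul_cancel]
  simp [columnForm_apply, emb_one]

theorem wave_mul_wave_one_zero (x y : ℂ) (p' s' p s : ℕ) (h : SU2) :
    wave x y p' s' (emb h) * wave 1 0 p s (emb h) =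
      ∑ i ∈ Finset.range (p' + 1) ×ˢ Finset.range (s' + 1),
        x ^ i.1 * y ^ (p' - i.1) * p'.choose i.1 * (x ^ i.2 * y ^ (s' - i.2) * s'.choose i.2) *
          monomial (i.1 + p) (i.2 + s) (p' - i.1) (s' - i.2) h := by
  rw [wave_one_zero, wave, columnForm_apply, columnForm_apply, add_pow, add_pow,
    Finset.sum_mul_sum, ← Finset.sum_product', Finset.sum_mul]
  refine Finset.sum_congr rfl fun i _ => ?_
  simp only [monomial, mul_pow, pow_add]
  ring

theorem integral_wave_mul_wave_one_zero (x y : ℂ) {p' s' p s : ℕ} (hn : p' + s' ≤ p + s) :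
    ∫ h, wave x y p' s' (emb h) * wave 1 0 p s (emb h) ∂haar =
      if p' = s ∧ s' = p then y ^ (p + s) * betaIntegral p s else 0 := by
  simp only [wave_mul_wave_one_zero]
  rw [integral_finsetSum _ fun i _ => (integrable_monomial _ _ _ _).const_mul _]
  simp only [integral_const_mul]
  have hvanish : ∀ i ∈ Finset.range (p' + 1) ×ˢ Finset.range (s' + 1),
      ¬(i = (0, 0) ∧ p' = s ∧ s' = p) →
        ∫ h, monomial (i.1 + p) (i.2 + s) (p' - i.1) (s' - i.2) h ∂haar = 0 := by
    rintro ⟨i, j⟩ hi hne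
    simp only [Finset.mem_product, Finset.mem_range, Prod.mk.injEq] at hi hne
    exact integral_monomial_eq_zero (by omega)
  split_ifs with h
  · rw [Finset.sum_eq_single (0, 0) (fun i hi hi0 => by
      rw [hvanish i hi fun h => hi0 h.1, mul_zero]) (by simp)]
    obtain ⟨rfl, rfl⟩ := h
    simp only [pow_zero, Nat.sub_zero, Nat.choose_zero_right, Nat.cast_one, zero_add,
      betaIntegral, pow_add]
    ring
  · exact Finset.sum_eq_zero fun i hi => by rw [hvanish i hi fun h' => h h'.2, mul_zero]

theorem exists_row_eq (x y : ℂ) : ∃ (r : ℝ) (k : SU2), x = r * emb k 0 0 ∧ y = r * emb k 0 1 := by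
  by_cases h : x = 0 ∧ y = 0
  · exact ⟨0, 1, by simp [h.1], by simp [h.2]⟩
  set r := √(Complex.normSq x + Complex.normSq y)
  have hr_sq : r * r = Complex.normSq x + Complex.normSq y :=
    Real.mul_self_sqrt (add_nonneg (Complex.normSq_nonneg x) (Complex.normSq_nonneg y))
  have hr : r ≠ 0 := fun hr => h <| by
    rw [hr, mul_zero, eq_comm, add_eq_zero_iff_of_nonneg (Complex.normSq_nonneg x)
      (Complex.normSq_nonneg y)] at hr_sq
    exact ⟨Complex.normSq_eq_zero.1 hr_sq.1, Complex.normSq_eq_zero.1 hr_sq.2⟩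
  have hrc : (r : ℂ) ≠ 0 := by exact_mod_cast hr
  refine ⟨r, mk (x / r) (y / r) ?_, ?_, ?_⟩
  · rw [Complex.normSq_div, Complex.normSq_div, Complex.normSq_ofReal, ← add_div, ← hr_sq,
      div_self (mul_ne_zero hr hr)]
  · simp [emb_mk, mul_div_cancel₀ _ hrc]
  · simp [emb_mk, mul_div_cancel₀ _ hrc]

-- By invariance of the integral the vector `(x, y)` can be rotated to a multiple of `(1, 0)`.
theorem integral_wave_mul_wave_of_le (x' y' x y : ℂ) {p' s' p s : ℕ} (hn : p' + s' ≤ p + s) :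
    ∫ h, wave x' y' p' s' (emb h) * wave x y p s (emb h) ∂haar =
      if p' = s ∧ s' = p then (x * y' - x' * y) ^ (p + s) * betaIntegral p s else 0 := by
  obtain ⟨r, k, hx, hy⟩ := exists_row_eq x y
  set u := columnForm x' y' 0 (emb k⁻¹)
  set v := columnForm x' y' 1 (emb k⁻¹)
  have hleft : ∀ h, wave x' y' p' s' (emb h) = wave u v p' s' (emb (k * h)) := fun h => by
    rw [← wave_emb_mul, inv_mul_cancel_left]
  have hright : ∀ h, wave x y p s (emb h) = (r : ℂ) ^ (p + s) * wave 1 0 p s (emb (k * h)) :=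
    fun h => by
      rw [wave_one_zero, wave, columnForm_apply, columnForm_apply, hx, hy, emb_mul, emb_mul,
        pow_add, mul_mul_mul_comm, ← mul_pow, ← mul_pow]
      ring
  have hdet : x * y' - x' * y = r * v := by
    have hv := columnForm_det_inv 1 0 x' y' k
    rw [one_mul, mul_zero, sub_zero, columnForm_apply 1, columnForm_apply 1] at hv
    rw [hx, hy]
    linear_combination -(r : ℂ) * hv
  simp only [hleft, hright, mul_left_comm _ ((r : ℂ) ^ (p + s))]
  rw [integral_const_mul,
    integral_mul_left_eq_self (fun h => wave u v p' s' (emb h) * wave 1 0 p s (emb h)) k,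
    integral_wave_mul_wave_one_zero u v hn, hdet, mul_ite, mul_zero, mul_pow, mul_assoc]

theorem integral_wave_mul_wave (x' y' x y : ℂ) (p' s' p s : ℕ) :
    ∫ h, wave x' y' p' s' (emb h) * wave x y p s (emb h) ∂haar =
      if p' = s ∧ s' = p then (x * y' - x' * y) ^ (p + s) * betaIntegral p s else 0 := by
  by_cases hn : p' + s' ≤ p + s
  · exact integral_wave_mul_wave_of_le x' y' x y hn
  · simp only [mul_comm (wave x' y' p' s' _)]
    rw [integral_wave_mul_wave_of_le x y x' y' (by omega), if_neg (by omega), if_neg (by omega)]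

theorem sum_fourierWeight_mul_linear_pow (a c : ℂ) {N n k : ℕ} (hn : n < N) (hk : k < N) :
    ∑ l ∈ Finset.range N, fourierWeight N k l * (rootOfUnity N ^ l * a + c) ^ n =
      n.choose k * (a ^ k * c ^ (n - k)) := by
  have hdeg : ((Polynomial.C a * Polynomial.X + Polynomial.C c) ^ n).natDegree < N :=
    (Polynomial.natDegree_pow_le_of_le n Polynomial.natDegree_linear_le).trans_lt (by omega)
  rw [← coeff_C_mul_X_add_C_pow, ← sum_fourierWeight_mul_eval hdeg hk]
  simp [mul_comm a]

theorem diagCoeff_emb_inv_mul (p s : ℕ) (g h : SU2) :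
    diagCoeff p s (emb (h⁻¹ * g)) = ∑ l ∈ Finset.range (s + p + 1),
      fourierWeight (s + p + 1) s l *
        wave (columnForm (rootOfUnity (s + p + 1) ^ l) 1 0 (emb g⁻¹))
          (columnForm (rootOfUnity (s + p + 1) ^ l) 1 1 (emb g⁻¹)) s p (emb h) := by
  rw [show h⁻¹ * g = (g⁻¹ * h)⁻¹ by group, diagCoeff_emb_inv, diagCoeff_eq_sum_wave]
  simp only [Finset.sum_apply, Pi.smul_apply, smul_eq_mul, wave_emb_mul]

theorem dimension_mul_integral_diagCoeff_mul_wave (x y : ℂ) (i : ℕ × ℕ) (p s : ℕ) (g : SU2) :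
    (dimension i : ℂ) * ∫ h, diagCoeff i.1 i.2 (emb (h⁻¹ * g)) * wave x y p s (emb h) ∂haar =
      if i = (p, s) then wave x y p s (emb g) else 0 := by
  obtain ⟨p', s'⟩ := i
  simp only [diagCoeff_emb_inv_mul, Finset.sum_mul, mul_assoc]
  have hint : ∀ u v, Integrable
      (fun h => wave u v s' p' (emb h) * wave x y p s (emb h)) haar := fun u v =>
    integrable_of_continuous ((continuous_wave_emb _ _ _ _).mul (continuous_wave_emb _ _ _ _))
  rw [integral_finsetSum _ fun l _ => (hint _ _).const_mul _]
  simp only [integral_const_mul, integral_wave_mul_wave, Prod.mk.injEq]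
  by_cases h : s' = s ∧ p' = p
  · obtain ⟨rfl, rfl⟩ := h
    set X := columnForm x y 0 (emb g) with hX
    set Y := columnForm x y 1 (emb g) with hY
    have hdet : ∀ z, x * columnForm z 1 1 (emb g⁻¹) - columnForm z 1 0 (emb g⁻¹) * y =
        z * -Y + X := fun z => by
      rw [columnForm_det_inv]
      ring
    have hsum := sum_fourierWeight_mul_linear_pow (-Y) X (N := s' + p' + 1) (n := p' + s')
      (k := s') (by omega) (by omega)
    simp only [and_self, if_true, hdet, ← mul_assoc]
    rw [← Finset.sum_mul, hsum, Nat.add_sub_cancel, wave, ← hX, ← hY, neg_pow]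
    linear_combination (X ^ p' * Y ^ s') * dimension_mul_choose_mul_betaIntegral p' s'
  · simp only [if_neg h, if_neg (fun h' => h (And.symm h')), mul_zero, Finset.sum_const_zero]

theorem integral_heatSeries_mul_wave {t : ℝ} (ht : 0 < t) (x y : ℂ) (p s : ℕ) (g : SU2) :
    ∫ h, (heatSeries t (h⁻¹ * g) : ℂ) * wave x y p s (emb h) ∂haar =
      Real.exp (-(t * eigenvalue (p, s))) * wave x y p s (emb g) := by
  have hc := summable_abs_heatCoeff ht
  obtain ⟨C, hC⟩ := isCompact_univ.exists_bound_of_continuousOn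
    (continuous_wave_emb x y p s).continuousOn
  set F : ℕ × ℕ → SU2 → ℂ := fun i h =>
    (heatCoeff t i : ℂ) * (diagCoeff i.1 i.2 (emb (h⁻¹ * g)) * wave x y p s (emb h))
  have hF : ∀ i, Continuous (F i) := fun i => continuous_const.mul
    (((continuous_diagCoeff_emb i).comp (continuous_inv.mul continuous_const)).mul
      (continuous_wave_emb x y p s))
  have hbound : ∀ i h, ‖F i h‖ ≤ |heatCoeff t i| * C := fun i h => by
    rw [norm_mul, norm_mul, Complex.norm_real, Real.norm_eq_abs]
    exact mul_le_mul_of_nonneg_left ((mul_le_of_le_one_left (norm_nonneg _)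
      (norm_diagCoeff_emb_le _ _ _)).trans (hC h trivial)) (abs_nonneg _)
  have hsum := hasSum_integral_of_summable_integral_norm (μ := haar) (F := F)
    (fun i => integrable_of_continuous (hF i)) <|
    (hc.mul_right C).of_nonneg_of_le (fun i => integral_nonneg fun _ => norm_nonneg _) fun i => by
      simpa using integral_mono (μ := haar) (integrable_of_continuous (hF i).norm)
        (integrable_const _) (hbound i)
  have hterm : ∀ i, ∫ h, F i h ∂haar = if i = (p, s) then
      Real.exp (-(t * eigenvalue i)) * wave x y p s (emb g) else 0 := fun i => by
    rw [integral_const_mul, heatCoeff, ← mul_ite_zero,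
      ← dimension_mul_integral_diagCoeff_mul_wave x y i p s g]
    push_cast
    ring
  have hseries : ∀ h, (heatSeries t (h⁻¹ * g) : ℂ) * wave x y p s (emb h) = ∑' i, F i h :=
    fun h => by
      rw [heatSeries, ofReal_diagSeries hc (heatCoeff_swap t), ← tsum_mul_right]
      simp only [F, mul_assoc]
  simp only [hseries, ← hsum.tsum_eq, hterm]
  exact tsum_ite_eq (p, s) _

/-! ### Density of the waves -/

/-- The linear span of the waves, as functions on `SU(2)`. -/
noncomputable def waveSpan : Submodule ℂ (SU2 → ℂ) :=
  Submodule.span ℂ {φ | ∃ x y p s, φ = fun g => wave x y p s (emb g)}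

theorem wave_mem_waveSpan (x y : ℂ) (p s : ℕ) : (fun g => wave x y p s (emb g)) ∈ waveSpan :=
  Submodule.subset_span ⟨x, y, p, s, rfl⟩

theorem continuous_of_mem_waveSpan {φ : SU2 → ℂ} (hφ : φ ∈ waveSpan) : Continuous φ := by
  induction hφ using Submodule.span_induction with
  | mem φ hφ =>
    obtain ⟨x, y, p, s, rfl⟩ := hφ
    exact continuous_wave_emb x y p s
  | zero => exact continuous_zero
  | add φ ψ _ _ hφ hψ => exact hφ.add hψ
  | smul c φ _ hφ => exact hφ.const_smul c

-- The derivative of the polynomial map `z ↦ wave (z * x' + x) (z * y' + y) p s` at `0` is a linear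
-- combination of its values at roots of unity.
theorem polarization_mem_waveSpan (x y x' y' : ℂ) (p s : ℕ) :
    (fun g => p * columnForm x' y' 0 (emb g) * wave x y (p - 1) s (emb g) +
      s * columnForm x' y' 1 (emb g) * wave x y p (s - 1) (emb g)) ∈ waveSpan := by
  set ζ := rootOfUnity (p + s + 2)
  have hsum : (fun g => p * columnForm x' y' 0 (emb g) * wave x y (p - 1) s (emb g) +
      s * columnForm x' y' 1 (emb g) * wave x y p (s - 1) (emb g)) =
      ∑ l ∈ Finset.range (p + s + 2), fourierWeight (p + s + 2) 1 l •
        fun g => wave (ζ ^ l * x' + x) (ζ ^ l * y' + y) p s (emb g) := by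
    funext g
    set P := linearPowMul (columnForm x' y' 0 (emb g)) (columnForm x' y' 1 (emb g))
      (columnForm x y 0 (emb g)) (columnForm x y 1 (emb g)) p s with hP
    have heval : ∀ z, P.eval z = wave (z * x' + x) (z * y' + y) p s (emb g) := fun z => by
      simp only [hP, eval_linearPowMul, wave, columnForm_apply]
      ring
    have hdeg : P.natDegree < p + s + 2 := (natDegree_linearPowMul_le ..).trans_lt (by omega)
    simp only [Finset.sum_apply, Pi.smul_apply, smul_eq_mul, ← heval]
    rw [sum_fourierWeight_mul_eval hdeg (by omega), coeff_one_linearPowMul, wave, wave]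
  rw [hsum]
  exact Submodule.sum_mem _ fun l _ => Submodule.smul_mem _ _ (wave_mem_waveSpan _ _ _ _)

theorem columnForm_mul_wave_mem_waveSpan (j : Fin 2) (x' y' x y : ℂ) (p s : ℕ) :
    (fun g => columnForm x' y' j (emb g) * wave x y p s (emb g)) ∈ waveSpan := by
  have hn : (p + s + 1 : ℂ) ≠ 0 := by exact_mod_cast (p + s).succ_ne_zero
  refine (Submodule.smul_mem_iff _ hn).1 ?_
  fin_cases j
  · have hsplit : ((p + s + 1 : ℂ) • fun g => columnForm x' y' 0 (emb g) * wave x y p s (emb g)) =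
        (fun g => (p + 1 : ℕ) * columnForm x' y' 0 (emb g) * wave x y (p + 1 - 1) s (emb g) +
          s * columnForm x' y' 1 (emb g) * wave x y (p + 1) (s - 1) (emb g)) -
        (s * (x * y' - x' * y)) • fun g => wave x y p (s - 1) (emb g) := by
      funext g
      simp only [Pi.sub_apply, Pi.smul_apply, smul_eq_mul, wave, Nat.add_sub_cancel]
      rcases s with _ | s <;> push_cast
      · ring
      · linear_combination (-(s + 1) * columnForm x y 0 (emb g) ^ p *
          columnForm x y 1 (emb g) ^ s) * columnForm_det x y x' y' g
    exact hsplit ▸ Submodule.sub_mem _ (polarization_mem_waveSpan _ _ _ _ _ _)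
      (Submodule.smul_mem _ _ (wave_mem_waveSpan _ _ _ _))
  · have hsplit : ((p + s + 1 : ℂ) • fun g => columnForm x' y' 1 (emb g) * wave x y p s (emb g)) =
        (fun g => p * columnForm x' y' 0 (emb g) * wave x y (p - 1) (s + 1) (emb g) +
          (s + 1 : ℕ) * columnForm x' y' 1 (emb g) * wave x y p (s + 1 - 1) (emb g)) +
        (p * (x * y' - x' * y)) • fun g => wave x y (p - 1) s (emb g) := by
      funext g
      simp only [Pi.add_apply, Pi.smul_apply, smul_eq_mul, wave, Nat.add_sub_cancel]
      rcases p with _ | p <;> push_cast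
      · ring
      · linear_combination ((p + 1) * columnForm x y 0 (emb g) ^ p *
          columnForm x y 1 (emb g) ^ s) * columnForm_det x y x' y' g
    exact hsplit ▸ Submodule.add_mem _ (polarization_mem_waveSpan _ _ _ _ _ _)
      (Submodule.smul_mem _ _ (wave_mem_waveSpan _ _ _ _))

theorem emb_mul_mem_waveSpan (i j : Fin 2) {φ : SU2 → ℂ} (hφ : φ ∈ waveSpan) :
    (fun g => emb g i j * φ g) ∈ waveSpan := by
  have hentry : ∀ g, emb g i j = columnForm (![1, 0] i) (![0, 1] i) j (emb g) := fun g => by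
    fin_cases i <;> simp [columnForm_apply]
  induction hφ using Submodule.span_induction with
  | mem φ hφ =>
    obtain ⟨x, y, p, s, rfl⟩ := hφ
    simp only [hentry]
    exact columnForm_mul_wave_mem_waveSpan _ _ _ _ _ _ _
  | zero =>
    simp only [Pi.zero_apply, mul_zero]
    exact Submodule.zero_mem waveSpan
  | add φ ψ _ _ hφ hψ =>
    simp only [Pi.add_apply, mul_add]
    exact Submodule.add_mem _ hφ hψ
  | smul c φ _ hφ =>
    simp only [Pi.smul_apply, smul_eq_mul, mul_left_comm]
    exact Submodule.smul_mem _ c hφ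

theorem star_emb_mul_mem_waveSpan (i j : Fin 2) {φ : SU2 → ℂ} (hφ : φ ∈ waveSpan) :
    (fun g => star (emb g i j) * φ g) ∈ waveSpan := by
  have hneg : ∀ i j, (fun g => -(emb g i j * φ g)) ∈ waveSpan := fun i j =>
    Submodule.neg_mem _ (emb_mul_mem_waveSpan i j hφ)
  match i, j with
  | 0, 0 => simpa only [emb_one_one] using emb_mul_mem_waveSpan 1 1 hφ
  | 0, 1 => simpa only [emb_one_zero, neg_mul, neg_neg] using hneg 1 0
  | 1, 0 => simpa only [emb_one_zero, star_neg, star_star, neg_mul] using hneg 0 1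
  | 1, 1 => simpa only [emb_one_one, star_star] using emb_mul_mem_waveSpan 0 0 hφ

/-- A matrix entry as a continuous function on `SU(2)`. -/
def matrixEntry (i j : Fin 2) : C(SU2, ℂ) := ⟨fun g => emb g i j, continuous_emb_apply i j⟩

/-- The algebra of continuous functions that multiply the span of the waves into itself. -/
noncomputable def waveMultiplier : Subalgebra ℂ C(SU2, ℂ) where
  carrier := {f | ∀ φ ∈ waveSpan, ⇑f * φ ∈ waveSpan}
  mul_mem' hf hh φ hφ := by
    rw [ContinuousMap.coe_mul, mul_assoc]
    exact hf _ (hh φ hφ)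
  add_mem' hf hh φ hφ := by
    rw [ContinuousMap.coe_add, add_mul]
    exact Submodule.add_mem _ (hf φ hφ) (hh φ hφ)
  algebraMap_mem' c _ hφ := Submodule.smul_mem _ c hφ

/-- The star algebra generated by the matrix entries. -/
noncomputable def entryAlgebra : StarSubalgebra ℂ C(SU2, ℂ) :=
  StarAlgebra.adjoin ℂ (Set.range fun q : Fin 2 × Fin 2 => matrixEntry q.1 q.2)

theorem entryAlgebra_le_waveMultiplier : entryAlgebra.toSubalgebra ≤ waveMultiplier := by
  refine Algebra.adjoin_le (Set.union_subset ?_ ?_)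
  · rintro _ ⟨⟨i, j⟩, rfl⟩ φ hφ
    exact emb_mul_mem_waveSpan i j hφ
  · rintro f ⟨⟨i, j⟩, hf⟩ φ hφ
    have hstar : f = star (matrixEntry i j) := star_eq_iff_star_eq.1 hf.symm |>.symm
    rw [hstar]
    exact star_emb_mul_mem_waveSpan i j hφ

theorem coe_mem_waveSpan_of_mem_entryAlgebra {f : C(SU2, ℂ)} (hf : f ∈ entryAlgebra) :
    ⇑f ∈ waveSpan := by
  have hmul := entryAlgebra_le_waveMultiplier hf _ (wave_mem_waveSpan 0 0 0 0)
  rwa [show (fun g => wave 0 0 0 0 (emb g)) = 1 from funext fun g => by simp [wave],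
    mul_one] at hmul

theorem separatesPoints_entryAlgebra : entryAlgebra.SeparatesPoints := fun g h hgh => by
  obtain ⟨i, j, hij⟩ : ∃ i j, emb g i j ≠ emb h i j := by
    by_contra! heq
    exact hgh (emb_injective (funext fun i => funext (heq i)))
  exact ⟨matrixEntry i j, ⟨matrixEntry i j, StarAlgebra.subset_adjoin ℂ _ ⟨(i, j), rfl⟩, rfl⟩, hij⟩

theorem exists_mem_waveSpan_forall_abs_sub_re_lt {f : SU2 → ℝ} (hf : Continuous f) {ε : ℝ}
    (hε : 0 < ε) : ∃ φ ∈ waveSpan, ∀ g, |f g - (φ g).re| < ε := by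
  set F : C(SU2, ℂ) := ⟨fun g => (f g : ℂ), Complex.continuous_ofReal.comp hf⟩
  have hF : F ∈ closure (entryAlgebra : Set C(SU2, ℂ)) := by
    rw [← StarSubalgebra.topologicalClosure_coe,
      ContinuousMap.starSubalgebra_topologicalClosure_eq_top_of_separatesPoints _
        separatesPoints_entryAlgebra]
    trivial
  obtain ⟨φ, hφ, hdist⟩ := Metric.mem_closure_iff.1 hF ε hε
  refine ⟨φ, coe_mem_waveSpan_of_mem_entryAlgebra hφ, fun g => ?_⟩
  calc |f g - (φ g).re| = |(F g - φ g).re| := by rw [Complex.sub_re]; rfl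
    _ ≤ dist (F g) (φ g) := (Complex.abs_re_le_norm _).trans_eq (dist_eq_norm _ _).symm
    _ < ε := (ContinuousMap.dist_apply_le_dist g).trans_lt hdist

/-! ### The heat flow -/

section UniformConvergence

variable {α β ι : Type*} [UniformSpace β] {F F' : ι → α → β} {f : α → β} {l : Filter ι}

theorem tendstoUniformly_of_eventually_eq (h : TendstoUniformly F f l)
    (heq : ∀ᶠ n in l, F n = F' n) : TendstoUniformly F' f l :=
  tendstoUniformlyOn_univ.1 <| (tendstoUniformlyOn_univ.2 h).congr <|
    heq.mono fun _ hn => hn ▸ Set.eqOn_refl _ _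

theorem tendsto_prod_nhds_of_tendstoUniformly [TopologicalSpace α] {x : α}
    (h : TendstoUniformly F f l) (hf : ContinuousAt f x) :
    Tendsto (fun q : ι × α => F q.1 q.2) (l ×ˢ 𝓝 x) (𝓝 (f x)) :=
  TendstoUniformly.tendsto_comp (F := fun q : ι × α => F q.1) (g := Prod.snd)
    (fun u hu => tendsto_fst.eventually (h u hu)) hf tendsto_snd

end UniformConvergence

section Convolution

variable {E : Type*} [NormedAddCommGroup E] [NormedSpace ℝ E] {t : ℝ}

/-- The convolution `f ∗ p_t` with the heat series, for functions valued in any real normed space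
(`ℝ` for the heat flow itself, `ℂ` for its action on waves). -/
noncomputable def heatConvolution (t : ℝ) (f : SU2 → E) (g : SU2) : E :=
  ∫ h, heatSeries t (h⁻¹ * g) • f h ∂haar

theorem continuous_heatSeries_inv_mul_smul (ht : 0 < t) (g : SU2) {f : SU2 → E}
    (hf : Continuous f) : Continuous fun h => heatSeries t (h⁻¹ * g) • f h :=
  ((isSmooth_heatSeries ht).continuous.comp (continuous_inv.mul continuous_const)).smul hf

theorem heatConvolution_add (ht : 0 < t) {f₁ f₂ : SU2 → E} (h₁ : Continuous f₁)
    (h₂ : Continuous f₂) :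
    heatConvolution t (f₁ + f₂) = heatConvolution t f₁ + heatConvolution t f₂ := by
  funext g
  simp only [heatConvolution, Pi.add_apply, smul_add]
  exact integral_add (integrable_of_continuous (continuous_heatSeries_inv_mul_smul ht g h₁))
    (integrable_of_continuous (continuous_heatSeries_inv_mul_smul ht g h₂))

theorem heatConvolution_sub (ht : 0 < t) {f₁ f₂ : SU2 → E} (h₁ : Continuous f₁)
    (h₂ : Continuous f₂) :
    heatConvolution t (f₁ - f₂) = heatConvolution t f₁ - heatConvolution t f₂ :=
  eq_sub_of_add_eq <| by rw [← heatConvolution_add ht (h₁.sub h₂) h₂, sub_add_cancel]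

theorem heatConvolution_const_smul (t : ℝ) (c : ℂ) (φ : SU2 → ℂ) :
    heatConvolution t (c • φ) = c • heatConvolution t φ := by
  funext g
  simp only [heatConvolution, Pi.smul_apply, smul_comm _ c, integral_smul]

theorem heatConvolution_re (ht : 0 < t) {φ : SU2 → ℂ} (hφ : Continuous φ) (g : SU2) :
    heatConvolution t (fun h => (φ h).re) g = (heatConvolution t φ g).re := by
  refine Eq.trans ?_ (integral_re
    (integrable_of_continuous (continuous_heatSeries_inv_mul_smul ht g hφ)))
  simp [heatConvolution]

theorem heatConvolution_wave (ht : 0 < t) (x y : ℂ) (p s : ℕ) :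
    heatConvolution t (fun g => wave x y p s (emb g)) =
      fun g => (Real.exp (-(t * eigenvalue (p, s))) : ℂ) * wave x y p s (emb g) :=
  funext fun g => by simpa [heatConvolution] using integral_heatSeries_mul_wave ht x y p s g

variable {f : SU2 → ℝ}

theorem isSmooth_heatConvolution (ht : 0 < t) (hf : Continuous f) :
    IsSmooth (heatConvolution t f) :=
  (isSmooth_heatSeries ht).convolution hf

theorem hasDerivAt_heatConvolution (ht : 0 < t) (hf : Continuous f) (g : SU2) :
    HasDerivAt (fun s => heatConvolution s f g) (sublaplacian (heatConvolution t f) g) t := by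
  have hsub : sublaplacian (heatConvolution t f) g =
      ∫ h, sublaplacian (heatSeries t) (h⁻¹ * g) * f h ∂haar :=
    sublaplacian_convolution (isSmooth_heatSeries ht) hf g
  rw [hsub]
  refine hasDerivAt_integral haar (f := fun s h => heatSeries s (h⁻¹ * g) * f h)
    (f' := fun s h => sublaplacian (heatSeries s) (h⁻¹ * g) * f h) ?_ (fun h => ?_) ?_
  · filter_upwards [Ioi_mem_nhds ht] with s hs using continuous_heatSeries_inv_mul_smul hs g hf
  · have hmap : ContinuousAt (fun q : ℝ × SU2 => (q.1, q.2⁻¹ * g)) (t, h) := by fun_prop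
    exact (ContinuousAt.comp (f := fun q : ℝ × SU2 => (q.1, q.2⁻¹ * g))
      (continuousAt_sublaplacian_heatSeries ht (h⁻¹ * g)) hmap).mul
      (hf.comp continuous_snd).continuousAt
  · filter_upwards [Ioi_mem_nhds ht] with s hs h using (hasDerivAt_heatSeries hs _).mul_const _

theorem continuousAt_heatConvolution (ht : 0 < t) (hf : Continuous f) (g : SU2) :
    ContinuousAt (fun q : ℝ × SU2 => heatConvolution q.1 f q.2) (t, g) := by
  refine continuousAt_integral haar
    (f := fun (q : ℝ × SU2) h => heatSeries q.1 (h⁻¹ * q.2) * f h) ?_ fun h => ?_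
  · filter_upwards [continuousAt_fst (Ioi_mem_nhds ht)] with q hq using
      continuous_heatSeries_inv_mul_smul hq q.2 hf
  · have hmap : ContinuousAt (fun q : (ℝ × SU2) × SU2 => (q.1.1, q.2⁻¹ * q.1.2)) ((t, g), h) := by
      fun_prop
    exact (ContinuousAt.comp (f := fun q : (ℝ × SU2) × SU2 => (q.1.1, q.2⁻¹ * q.1.2))
      (continuousAt_heatSeries ht (h⁻¹ * g)) hmap).mul (hf.comp continuous_snd).continuousAt

theorem abs_heatConvolution_le_of_forall_le (t : ℝ) {C M : ℝ} (hC : ∀ g, |heatSeries t g| ≤ C)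
    (hf : ∀ g, |f g| ≤ M) (g : SU2) : |heatConvolution t f g| ≤ C * M := by
  have hbound : ∀ h, ‖heatSeries t (h⁻¹ * g) • f h‖ ≤ C * M := fun h => by
    rw [norm_smul]
    exact mul_le_mul (hC _) (hf h) (abs_nonneg _) ((abs_nonneg _).trans (hC 1))
  simpa [heatConvolution] using
    norm_integral_le_of_norm_le_const (μ := haar) (Eventually.of_forall hbound)

end Convolution

/-- The candidate solution of the Cauchy problem with initial datum `f`. -/
noncomputable def heatFlow (f : SU2 → ℝ) (t : ℝ) : SU2 → ℝ :=
  if 0 < t then heatConvolution t f else f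

theorem heatFlow_of_pos (f : SU2 → ℝ) {t : ℝ} (ht : 0 < t) : heatFlow f t = heatConvolution t f :=
  if_pos ht

theorem heatFlow_zero (f : SU2 → ℝ) : heatFlow f 0 = f := if_neg (lt_irrefl 0)

theorem tendstoUniformly_heatFlow {f : SU2 → ℝ}
    (h : TendstoUniformly (fun t => heatConvolution t f) f (𝓝[>] 0)) :
    TendstoUniformly (heatFlow f) f (𝓝[≥] 0) := by
  rw [← Set.Ioi_insert, nhdsWithin_insert]
  refine fun u hu => eventually_sup.2 ⟨?_, ?_⟩
  · exact eventually_pure.2 fun g => by rw [heatFlow_zero]; exact refl_mem_uniformity hu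
  · refine tendstoUniformly_of_eventually_eq h ?_ u hu
    filter_upwards [self_mem_nhdsWithin] with t ht using (heatFlow_of_pos f ht).symm

theorem isHeatSolution_heatFlow_of_tendstoUniformly {f : SU2 → ℝ} (hf : Continuous f)
    (h : TendstoUniformly (fun t => heatConvolution t f) f (𝓝[>] 0)) :
    IsHeatSolution f (heatFlow f) := by
  refine ⟨heatFlow_zero f, ?_, fun t ht => ?_, fun t ht g => ?_⟩
  · rintro ⟨t, g⟩ ⟨ht, -⟩
    obtain rfl | hpos := (Set.mem_Ici.1 ht).eq_or_lt
    · rw [ContinuousWithinAt, nhdsWithin_prod_eq, nhdsWithin_univ, heatFlow_zero]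
      exact tendsto_prod_nhds_of_tendstoUniformly (tendstoUniformly_heatFlow h) hf.continuousAt
    · refine ((continuousAt_heatConvolution hpos hf g).congr ?_).continuousWithinAt
      filter_upwards [continuousAt_fst (Ioi_mem_nhds hpos)] with q hq
      rw [heatFlow_of_pos f hq]
  · rw [heatFlow_of_pos f ht]
    exact isSmooth_heatConvolution ht hf
  · rw [heatFlow_of_pos f ht]
    refine (hasDerivAt_heatConvolution ht hf g).congr_of_eventuallyEq ?_
    filter_upwards [Ioi_mem_nhds ht] with s hs
    rw [heatFlow_of_pos f hs]

theorem tendstoUniformly_heatConvolution_wave (x y : ℂ) (p s : ℕ) :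
    TendstoUniformly (fun t => heatConvolution t fun g => wave x y p s (emb g))
      (fun g => wave x y p s (emb g)) (𝓝[>] 0) := by
  obtain ⟨C, hC⟩ := isCompact_univ.exists_bound_of_continuousOn
    (continuous_wave_emb x y p s).continuousOn
  have htend : Tendsto (fun t : ℝ => |1 - Real.exp (-(t * eigenvalue (p, s)))| * C) (𝓝[>] 0)
      (𝓝 0) := by
    have hcont : Continuous fun t : ℝ => |1 - Real.exp (-(t * eigenvalue (p, s)))| * C := by
      fun_prop
    exact (hcont.tendsto' 0 0 (by simp)).mono_left nhdsWithin_le_nhds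
  rw [Metric.tendstoUniformly_iff]
  intro ε hε
  filter_upwards [htend.eventually (Iio_mem_nhds hε), self_mem_nhdsWithin] with t hlt ht g
  refine lt_of_le_of_lt ?_ hlt
  rw [heatConvolution_wave ht, dist_eq_norm, ← one_sub_mul, norm_mul, ← Complex.ofReal_one,
    ← Complex.ofReal_sub, Complex.norm_real, Real.norm_eq_abs]
  exact mul_le_mul_of_nonneg_left (hC g trivial) (abs_nonneg _)

theorem tendstoUniformly_heatConvolution_of_mem_waveSpan {φ : SU2 → ℂ} (hφ : φ ∈ waveSpan) :
    TendstoUniformly (fun t => heatConvolution t φ) φ (𝓝[>] 0) := by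
  induction hφ using Submodule.span_induction with
  | mem φ hφ =>
    obtain ⟨x, y, p, s, rfl⟩ := hφ
    exact tendstoUniformly_heatConvolution_wave x y p s
  | zero =>
    refine fun u hu => Eventually.of_forall fun t g => ?_
    simpa [heatConvolution] using refl_mem_uniformity hu
  | add φ ψ hφ hψ ihφ ihψ =>
    refine tendstoUniformly_of_eventually_eq (ihφ.add ihψ) ?_
    filter_upwards [self_mem_nhdsWithin] with t ht using
      (heatConvolution_add ht (continuous_of_mem_waveSpan hφ) (continuous_of_mem_waveSpan hψ)).symm
  | smul c φ _ ih =>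
    refine tendstoUniformly_of_eventually_eq
      ((uniformContinuous_const_smul c).comp_tendstoUniformly ih) ?_
    exact Eventually.of_forall fun t => (heatConvolution_const_smul t c φ).symm

theorem tendstoUniformly_heatConvolution_re {φ : SU2 → ℂ} (hφ : φ ∈ waveSpan) :
    TendstoUniformly (fun t => heatConvolution t fun g => (φ g).re) (fun g => (φ g).re)
      (𝓝[>] 0) := by
  refine tendstoUniformly_of_eventually_eq (Complex.reCLM.uniformContinuous.comp_tendstoUniformly
    (tendstoUniformly_heatConvolution_of_mem_waveSpan hφ)) ?_
  filter_upwards [self_mem_nhdsWithin] with t ht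
  exact funext fun g => (heatConvolution_re ht (continuous_of_mem_waveSpan hφ) g).symm

theorem isHeatSolution_re {φ : SU2 → ℂ} (hφ : φ ∈ waveSpan) :
    IsHeatSolution (fun g => (φ g).re) (heatFlow fun g => (φ g).re) :=
  isHeatSolution_heatFlow_of_tendstoUniformly
    (Complex.continuous_re.comp (continuous_of_mem_waveSpan hφ))
    (tendstoUniformly_heatConvolution_re hφ)

-- Positivity of the heat series is not visible on its expansion; the contraction property comes
-- from the maximum principle on the dense space of waves.
theorem abs_heatConvolution_le {t : ℝ} (ht : 0 < t) {f : SU2 → ℝ} (hf : Continuous f) {M : ℝ}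
    (hM : ∀ g, |f g| ≤ M) (g : SU2) : |heatConvolution t f g| ≤ M := by
  obtain ⟨C, hC⟩ := isCompact_univ.exists_bound_of_continuousOn
    (isSmooth_heatSeries ht).continuous.continuousOn
  replace hC : ∀ g, |heatSeries t g| ≤ C := fun g => hC g trivial
  have hC0 : 0 ≤ C := (abs_nonneg _).trans (hC 1)
  refine le_of_forall_pos_le_add fun ε hε => ?_
  obtain ⟨φ, hφ, hclose⟩ := exists_mem_waveSpan_forall_abs_sub_re_lt hf
    (ε := ε / (C + 1)) (by positivity)
  set f' : SU2 → ℝ := fun g => (φ g).re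
  have hf' : Continuous f' := Complex.continuous_re.comp (continuous_of_mem_waveSpan hφ)
  have hwave : |heatConvolution t f' g| ≤ M + ε / (C + 1) := by
    rw [← heatFlow_of_pos f' ht]
    refine (isHeatSolution_re hφ).abs_le (fun h => ?_) ht.le g
    rw [← sub_sub_cancel (f h) (φ h).re]
    exact (abs_sub _ _).trans (add_le_add (hM h) (hclose h).le)
  have herror : |heatConvolution t (f - f') g| ≤ C * (ε / (C + 1)) :=
    abs_heatConvolution_le_of_forall_le t hC (fun h => (hclose h).le) g
  calc |heatConvolution t f g|
      = |heatConvolution t (f - f') g + heatConvolution t f' g| := by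
        rw [heatConvolution_sub ht hf hf', Pi.sub_apply, sub_add_cancel]
    _ ≤ C * (ε / (C + 1)) + (M + ε / (C + 1)) :=
        (abs_add_le _ _).trans (add_le_add herror hwave)
    _ = M + ε := by field_simp; ring

theorem tendstoUniformly_heatConvolution {f : SU2 → ℝ} (hf : Continuous f) :
    TendstoUniformly (fun t => heatConvolution t f) f (𝓝[>] 0) := by
  rw [Metric.tendstoUniformly_iff]
  intro ε hε
  obtain ⟨φ, hφ, hclose⟩ := exists_mem_waveSpan_forall_abs_sub_re_lt hf (ε := ε / 3) (by positivity)
  set f' : SU2 → ℝ := fun g => (φ g).re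
  have hf' : Continuous f' := Complex.continuous_re.comp (continuous_of_mem_waveSpan hφ)
  filter_upwards [Metric.tendstoUniformly_iff.1 (tendstoUniformly_heatConvolution_re hφ) (ε / 3)
    (by positivity), self_mem_nhdsWithin] with t hwave ht g
  have hcontract : |heatConvolution t (f - f') g| ≤ ε / 3 :=
    abs_heatConvolution_le ht (hf.sub hf') (fun h => (hclose h).le) g
  rw [heatConvolution_sub ht hf hf', Pi.sub_apply, ← Real.dist_eq] at hcontract
  calc dist (f g) (heatConvolution t f g)
      ≤ dist (f g) (f' g) + dist (f' g) (heatConvolution t f' g) +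
          dist (heatConvolution t f' g) (heatConvolution t f g) := dist_triangle4 _ _ _ _
    _ < ε / 3 + ε / 3 + ε / 3 := by
        rw [dist_comm (heatConvolution t f' g)]
        exact add_lt_add_of_lt_of_le (add_lt_add (hclose g) (hwave g)) hcontract
    _ = ε := by ring

theorem isHeatSolution_heatFlow {f : SU2 → ℝ} (hf : Continuous f) :
    IsHeatSolution f (heatFlow f) :=
  isHeatSolution_heatFlow_of_tendstoUniformly hf (tendstoUniformly_heatConvolution hf)

theorem isHeatSolution_heatSemigroup {f : SU2 → ℝ} (hf : Continuous f) :
    IsHeatSolution f fun t => heatSemigroup t f :=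
  Classical.epsilon_spec (p := IsHeatSolution f) ⟨_, isHeatSolution_heatFlow hf⟩

theorem heatSemigroup_eq_heatConvolution {f : SU2 → ℝ} (hf : Continuous f) {t : ℝ} (ht : 0 < t) :
    heatSemigroup t f = heatConvolution t f := by
  rw [← heatFlow_of_pos f ht]
  exact (isHeatSolution_heatSemigroup hf).unique (isHeatSolution_heatFlow hf) ht.le

/-! ### The heat kernel -/

section HeatKernel

variable {t : ℝ}

theorem heatConvolution_one (t : ℝ) {E : Type*} [NormedAddCommGroup E] [NormedSpace ℝ E]
    (f : SU2 → E) : heatConvolution t f 1 = ∫ h, heatSeries t h • f h ∂haar := by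
  simp only [heatConvolution, mul_one, heatSeries, diagSeries_inv]

theorem isHeatKernel_heatSeries (ht : 0 < t) : IsHeatKernel t (heatSeries t) :=
  ⟨isSmooth_heatSeries ht, fun f hf => by
    rw [heatSemigroup_eq_heatConvolution hf.continuous ht, heatConvolution_one]; rfl⟩

theorem IsHeatKernel.unique {p q : SU2 → ℝ} (hp : IsHeatKernel t p) (hq : IsHeatKernel t q) :
    p = q := by
  have hpq := hp.1.sub hq.1
  have hzero : ∫ g, (p g - q g) * (p g - q g) ∂haar = 0 := by
    simp only [sub_mul _ _ (p _ - q _)]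
    rw [integral_sub (integrable_of_continuous (hp.1.mul hpq).continuous)
      (integrable_of_continuous (hq.1.mul hpq).continuous), ← hp.2 _ hpq, ← hq.2 _ hpq, sub_self]
  have hsq : (fun g => (p g - q g) * (p g - q g)) = fun _ => 0 :=
    (Continuous.ae_eq_iff_eq haar (hpq.mul hpq).continuous continuous_const).1 <|
      (integral_eq_zero_iff_of_nonneg (fun g => mul_self_nonneg _)
        (integrable_of_continuous (hpq.mul hpq).continuous)).1 hzero
  exact funext fun g => sub_eq_zero.1 (mul_self_eq_zero.1 (congrFun hsq g))

theorem isHeatKernel_heatKernel (ht : 0 < t) : IsHeatKernel t (heatKernel t) :=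
  Classical.epsilon_spec (p := IsHeatKernel t) ⟨_, isHeatKernel_heatSeries ht⟩

theorem heatKernel_eq_heatSeries (ht : 0 < t) : heatKernel t = heatSeries t :=
  (isHeatKernel_heatKernel ht).unique (isHeatKernel_heatSeries ht)

theorem heatConvolution_of_sublaplacian_eq (ht : 0 < t) {f : SU2 → ℝ} (hf : IsSmooth f) {c : ℝ}
    (hc : ∀ g, sublaplacian f g = -c * f g) :
    heatConvolution t f = fun g => Real.exp (-(t * c)) * f g := by
  have hsol : IsHeatSolution f fun s g => Real.exp (-(s * c)) * f g := by
    refine ⟨by simp, ?_, fun s _ => hf.const_mul _, fun s _ g => ?_⟩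
    · have hcont := hf.continuous
      exact Continuous.continuousOn (by fun_prop)
    · rw [sublaplacian_const_mul hf, hc]
      exact (((hasDerivAt_mul_const c).fun_neg.exp).mul_const (f g)).congr_deriv (by ring)
  rw [← heatFlow_of_pos f ht]
  exact (isHeatSolution_heatFlow hf.continuous).unique hsol ht.le

theorem isSmooth_re_diagCoeff (i : ℕ × ℕ) : IsSmooth fun g => (diagCoeff i.1 i.2 (emb g)).re :=
  isSmooth_re isOpen_univ (fun _ => trivial)
    (contDiff_of_mem_eigenspace (diagCoeff_mem_eigenspace i.1 i.2)).contDiffOn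

theorem sublaplacian_re_diagCoeff (i : ℕ × ℕ) (g : SU2) :
    sublaplacian (fun g => (diagCoeff i.1 i.2 (emb g)).re) g =
      -eigenvalue i * (diagCoeff i.1 i.2 (emb g)).re := by
  have hmem := diagCoeff_mem_eigenspace i.1 i.2
  rw [sublaplacian_re isOpen_univ (fun _ => trivial)
    (contDiff_of_mem_eigenspace hmem).contDiffOn, complexLaplacian_of_mem_eigenspace hmem]
  simp

theorem integral_heatSeries_mul_re_diagCoeff (ht : 0 < t) (i : ℕ × ℕ) :
    ∫ h, heatSeries t h * (diagCoeff i.1 i.2 (emb h)).re ∂haar =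
      Real.exp (-(t * eigenvalue i)) := by
  refine (heatConvolution_one t _).symm.trans <| (congrFun (heatConvolution_of_sublaplacian_eq ht
    (isSmooth_re_diagCoeff i) (sublaplacian_re_diagCoeff i)) 1).trans ?_
  rw [diagCoeff_emb_one, Complex.one_re, mul_one]

theorem integral_heatSeries_mul_diagSeries (ht : 0 < t) {c : ℕ × ℕ → ℝ}
    (hc : Summable fun i => |c i|) :
    ∫ h, heatSeries t h * diagSeries c h ∂haar = ∑' i, c i * Real.exp (-(t * eigenvalue i)) := by
  have hheat := (isSmooth_heatSeries ht).continuous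
  have hcont : ∀ i : ℕ × ℕ, Continuous fun h =>
      heatSeries t h * (c i * (diagCoeff i.1 i.2 (emb h)).re) := fun i =>
    hheat.mul (continuous_const.mul (isSmooth_re_diagCoeff i).continuous)
  obtain ⟨C, hC⟩ := isCompact_univ.exists_bound_of_continuousOn hheat.continuousOn
  have hC0 : 0 ≤ C := (norm_nonneg _).trans (hC 1 trivial)
  have hnorm : ∀ i h, ‖heatSeries t h * (c i * (diagCoeff i.1 i.2 (emb h)).re)‖ ≤ C * |c i| :=
    fun i h => by
      rw [norm_mul]
      exact mul_le_mul (hC h trivial) (norm_mul_re_diagCoeff_le _ i h) (norm_nonneg _) hC0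
  have hsum : Summable fun i =>
      ∫ h, ‖heatSeries t h * (c i * (diagCoeff i.1 i.2 (emb h)).re)‖ ∂haar :=
    (hc.mul_left C).of_nonneg_of_le (fun i => integral_nonneg fun _ => norm_nonneg _) fun i =>
      (integral_mono (integrable_of_continuous (hcont i).norm) (integrable_const _)
        (hnorm i)).trans_eq (by simp)
  simp only [diagSeries, ← tsum_mul_left]
  rw [← integral_tsum_of_summable_integral_norm (fun i => integrable_of_continuous (hcont i)) hsum]
  simp only [mul_left_comm _ (c _), integral_const_mul, integral_heatSeries_mul_re_diagCoeff ht]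

/-! ### Energy of the heat kernel -/

theorem heatCoeff_mul_exp (t : ℝ) (i : ℕ × ℕ) :
    heatCoeff t i * Real.exp (-(t * eigenvalue i)) = heatCoeff (2 * t) i := by
  rw [heatCoeff, heatCoeff, mul_assoc, ← Real.exp_add]
  ring_nf

/-- The general term of the spectral expansion of `2 A(t)`. -/
noncomputable def gradTerm (t : ℝ) (i : ℕ × ℕ) : ℝ := eigenvalue i * heatCoeff (2 * t) i

theorem gradTerm_nonneg (t : ℝ) (i : ℕ × ℕ) : 0 ≤ gradTerm t i :=
  mul_nonneg (eigenvalue_nonneg i) (heatCoeff_pos _ i).le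

theorem summable_gradTerm (ht : 0 < t) : Summable (gradTerm t) :=
  summable_eigenvalue_mul_heatCoeff (mul_pos two_pos ht)

theorem diagSeries_one (c : ℕ × ℕ → ℝ) : diagSeries c 1 = ∑' i, c i := by
  simp only [diagSeries, diagCoeff_emb_one, Complex.one_re, mul_one]

theorem integral_heatSeries_sq (ht : 0 < t) :
    ∫ h, heatSeries t h ^ 2 ∂haar = heatSeries (2 * t) 1 := by
  simp only [sq]
  refine (integral_heatSeries_mul_diagSeries ht (summable_abs_heatCoeff ht)).trans ?_
  simp only [heatCoeff_mul_exp, heatSeries, diagSeries_one]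

theorem integral_heatSeries_mul_sublaplacian (ht : 0 < t) :
    ∫ h, heatSeries t h * sublaplacian (heatSeries t) h ∂haar =
      -∑' i, gradTerm t i := by
  have hsum : Summable fun i => |-eigenvalue i * heatCoeff t i| := by
    simpa only [abs_neg_eigenvalue_mul_heatCoeff] using summable_eigenvalue_mul_heatCoeff ht
  simp only [sublaplacian_heatSeries ht]
  rw [integral_heatSeries_mul_diagSeries ht hsum]
  simp only [mul_assoc, heatCoeff_mul_exp, neg_mul, tsum_neg, gradTerm]

theorem hasDerivAt_integral_heatKernel_sq (ht : 0 < t) :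
    HasDerivAt (fun s => ∫ g, heatKernel s g ^ 2 ∂haar)
      (-(2 * ∑' i, gradTerm t i)) t := by
  have hderiv := (hasDerivAt_heatSeries (mul_pos two_pos ht) 1).comp t
    ((hasDerivAt_id t).const_mul 2)
  rw [sublaplacian_heatSeries (mul_pos two_pos ht), diagSeries_one] at hderiv
  refine (hderiv.congr_of_eventuallyEq ?_).congr_deriv ?_
  · filter_upwards [Ioi_mem_nhds ht] with s hs
    rw [heatKernel_eq_heatSeries hs, integral_heatSeries_sq hs]
    rfl
  · simp only [neg_mul, tsum_neg, gradTerm]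
    ring

theorem gradConst_eq_tsum (ht : 0 < t) :
    gradConst t = (∑' i, gradTerm t i) / 2 := by
  rw [gradConst, (hasDerivAt_integral_heatKernel_sq ht).deriv]
  ring

theorem gradConst_pos (ht : 0 < t) : 0 < gradConst t := by
  rw [gradConst_eq_tsum ht]
  refine half_pos ((summable_gradTerm ht).tsum_pos (gradTerm_nonneg t) (1, 0) ?_)
  exact mul_pos (by norm_num [eigenvalue]) (heatCoeff_pos _ _)

/-! ### Rotation symmetry of the heat kernel -/

/-- The diagonal element of `SU(2)` with entry `exp (i π / 4)`; conjugation by it rotates the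
direction `X` to `Y`. -/
noncomputable def rotation : SU2 :=
  diagonal (Complex.exp ((Real.pi / 4 : ℝ) * Complex.I)) (Complex.norm_exp_ofReal_mul_I _)

theorem emb_rotation_conj (g : SU2) : emb (rotation * g * rotation⁻¹) =
    ![![emb g 0 0, Complex.I * emb g 0 1], ![-Complex.I * emb g 1 0, emb g 1 1]] := by
  set τ := Complex.exp ((Real.pi / 4 : ℝ) * Complex.I) with hτ
  have hnorm : star τ * τ = 1 := by
    rw [Complex.star_def, ← Complex.normSq_eq_conj_mul_self, Complex.normSq_eq_norm_sq,
      Complex.norm_exp_ofReal_mul_I]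
    norm_num
  have hsq : τ * τ = Complex.I := by
    rw [hτ, ← Complex.exp_add, ← add_mul, ← Complex.ofReal_add,
      show Real.pi / 4 + Real.pi / 4 = Real.pi / 2 by ring]
    push_cast
    exact Complex.exp_pi_div_two_mul_I
  have hsq' : star τ * star τ = -Complex.I := by
    rw [← star_mul', hsq, Complex.star_def, Complex.conj_I]
  ext i j
  simp only [emb_mul, emb_inv, rotation, emb_diagonal, ← hτ]
  fin_cases i <;> fin_cases j <;>
    simp only [Fin.zero_eta, Fin.mk_one, Matrix.cons_val_zero, Matrix.cons_val_one, star_zero,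
      star_star, zero_mul, mul_zero, add_zero, zero_add]
  · linear_combination emb g 0 0 * hnorm
  · linear_combination emb g 0 1 * hsq
  · linear_combination emb g 1 0 * hsq'
  · linear_combination emb g 1 1 * hnorm

theorem heatSeries_rotation_conj (t : ℝ) (g : SU2) :
    heatSeries t (rotation * g * rotation⁻¹) = heatSeries t g := by
  refine diagSeries_congr_emb ?_ ?_ _
  · rw [emb_rotation_conj]
    rfl
  · rw [emb_rotation_conj]
    simp only [Matrix.cons_val_zero, Matrix.cons_val_one]
    linear_combination -(emb g 0 1 * emb g 1 0) * Complex.I_mul_I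

theorem emb_expX (s : ℝ) : emb (expX s) = ![![(Real.cos s : ℂ), (Real.sin s : ℂ)],
    ![-(Real.sin s : ℂ), (Real.cos s : ℂ)]] := exp_smul_pauliX s

theorem emb_expY (s : ℝ) : emb (expY s) = ![![(Real.cos s : ℂ), (Real.sin s : ℂ) * Complex.I],
    ![(Real.sin s : ℂ) * Complex.I, (Real.cos s : ℂ)]] := exp_smul_pauliY s

theorem rotation_conj_expX (s : ℝ) : rotation * expX s * rotation⁻¹ = expY s := by
  apply emb_injective
  rw [emb_rotation_conj, emb_expX, emb_expY]
  simp [mul_comm]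

theorem rotation_conj_expY_neg (s : ℝ) : rotation * expY (-s) * rotation⁻¹ = expX s := by
  apply emb_injective
  rw [emb_rotation_conj, emb_expX, emb_expY]
  have hI := Complex.I_mul_I
  ext i j
  fin_cases i <;> fin_cases j <;> simp
  · linear_combination (-Complex.sin s) * hI
  · linear_combination (Complex.sin s) * hI

theorem heatSeries_rotation_conj_mul (t : ℝ) (g h : SU2) :
    heatSeries t (rotation * g * rotation⁻¹ * (rotation * h * rotation⁻¹)) =
      heatSeries t (g * h) := by
  rw [← heatSeries_rotation_conj t (g * h)]
  congr 1
  group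

theorem fieldY_heatSeries_rotation_conj (t : ℝ) (g : SU2) :
    fieldY (heatSeries t) (rotation * g * rotation⁻¹) = fieldX (heatSeries t) g := by
  simp only [fieldX, fieldY, ← rotation_conj_expX, heatSeries_rotation_conj_mul]

theorem fieldX_heatSeries_rotation_conj (t : ℝ) (g : SU2) :
    fieldX (heatSeries t) (rotation * g * rotation⁻¹) = -fieldY (heatSeries t) g := by
  simp only [fieldX, fieldY, ← rotation_conj_expY_neg, heatSeries_rotation_conj_mul]
  exact (deriv_comp_neg (fun s => heatSeries t (g * expY s)) 0).trans (by rw [neg_zero])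

theorem integral_rotation_conj (F : SU2 → ℝ) :
    ∫ g, F (rotation * g * rotation⁻¹) ∂haar = ∫ g, F g ∂haar := by
  rw [integral_mul_left_eq_self (fun g => F (g * rotation⁻¹)) rotation,
    integral_mul_right_eq_self]

theorem integral_fieldX_mul_fieldY_heatSeries (t : ℝ) :
    ∫ g, fieldX (heatSeries t) g * fieldY (heatSeries t) g ∂haar = 0 := by
  have hrot := integral_rotation_conj fun g => fieldX (heatSeries t) g * fieldY (heatSeries t) g
  simp only [fieldX_heatSeries_rotation_conj, fieldY_heatSeries_rotation_conj, neg_mul,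
    integral_neg, mul_comm (fieldY _ _)] at hrot
  linarith

theorem integral_fieldY_sq_heatSeries (t : ℝ) :
    ∫ g, fieldY (heatSeries t) g ^ 2 ∂haar = ∫ g, fieldX (heatSeries t) g ^ 2 ∂haar := by
  simpa only [fieldY_heatSeries_rotation_conj] using
    (integral_rotation_conj fun g => fieldY (heatSeries t) g ^ 2).symm

theorem integral_fieldX_sq_heatSeries (ht : 0 < t) :
    ∫ g, fieldX (heatSeries t) g ^ 2 ∂haar = gradConst t := by
  have hheat := isSmooth_heatSeries ht
  have hX : Integrable (fun g => fieldX (heatSeries t) g ^ 2) haar :=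
    integrable_of_continuous (hheat.fieldX.continuous.pow 2)
  have hY : Integrable (fun g => fieldY (heatSeries t) g ^ 2) haar :=
    integrable_of_continuous (hheat.fieldY.continuous.pow 2)
  have henergy := integral_fieldX_sq_add_fieldY_sq hheat
  rw [integral_add hX hY, integral_fieldY_sq_heatSeries,
    integral_heatSeries_mul_sublaplacian ht, neg_neg] at henergy
  rw [gradConst_eq_tsum ht]
  linarith

/-! ### The gradient bound -/

theorem sq_integral_mul_add_sq_integral_mul_le {α : Type*} [MeasurableSpace α] {μ : Measure α}
    {φ₁ φ₂ ψ : α → ℝ} (hφ₁ : MemLp φ₁ 2 μ) (hφ₂ : MemLp φ₂ 2 μ) (hψ : MemLp ψ 2 μ) {a : ℝ}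
    (ha : 0 < a) (hnorm₁ : ∫ x, φ₁ x ^ 2 ∂μ = a) (hnorm₂ : ∫ x, φ₂ x ^ 2 ∂μ = a)
    (horth : ∫ x, φ₁ x * φ₂ x ∂μ = 0) :
    (∫ x, φ₁ x * ψ x ∂μ) ^ 2 + (∫ x, φ₂ x * ψ x ∂μ) ^ 2 ≤ a * ∫ x, ψ x ^ 2 ∂μ := by
  set b₁ := ∫ x, φ₁ x * ψ x ∂μ
  set b₂ := ∫ x, φ₂ x * ψ x ∂μ
  have hexpand : ∫ x, (a * ψ x - b₁ * φ₁ x - b₂ * φ₂ x) ^ 2 ∂μ =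
      a * (a * ∫ x, ψ x ^ 2 ∂μ - (b₁ ^ 2 + b₂ ^ 2)) := by
    have hpoint : ∀ x, (a * ψ x - b₁ * φ₁ x - b₂ * φ₂ x) ^ 2 = a ^ 2 * ψ x ^ 2 +
        b₁ ^ 2 * φ₁ x ^ 2 + b₂ ^ 2 * φ₂ x ^ 2 + -(2 * a * b₁) * (φ₁ x * ψ x) +
        -(2 * a * b₂) * (φ₂ x * ψ x) + 2 * b₁ * b₂ * (φ₁ x * φ₂ x) := fun x => by ring
    have hψψ := hψ.integrable_sq
    have h₁₁ := hφ₁.integrable_sq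
    have h₂₂ := hφ₂.integrable_sq
    have h₁ψ : Integrable (fun x => φ₁ x * ψ x) μ := hφ₁.integrable_mul hψ
    have h₂ψ : Integrable (fun x => φ₂ x * ψ x) μ := hφ₂.integrable_mul hψ
    have h₁₂ : Integrable (fun x => φ₁ x * φ₂ x) μ := hφ₁.integrable_mul hφ₂
    simp only [hpoint]
    rw [integral_add (by fun_prop) (by fun_prop), integral_add (by fun_prop) (by fun_prop),
      integral_add (by fun_prop) (by fun_prop), integral_add (by fun_prop) (by fun_prop),
      integral_add (by fun_prop) (by fun_prop)]
    simp only [integral_const_mul, hnorm₁, hnorm₂, horth]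
    ring
  have hnonneg := hexpand ▸ integral_nonneg (μ := μ) fun x =>
    sq_nonneg (a * ψ x - b₁ * φ₁ x - b₂ * φ₂ x)
  exact sub_nonneg.1 (nonneg_of_mul_nonneg_right hnonneg ha)

theorem memLp_of_continuous {f : SU2 → ℝ} (hf : Continuous f) (q : ENNReal) : MemLp f q haar :=
  hf.memLp_of_hasCompactSupport (HasCompactSupport.of_compactSpace f)

theorem fieldAlong_heatConvolution {γ : ℝ → SU2} {J : Matrix (Fin 2) (Fin 2) ℂ}
    (hd : IsDirection γ J) (ht : 0 < t) {f : SU2 → ℝ} (hf : Continuous f) (g : SU2) (c : ℝ) :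
    fieldAlong γ (heatConvolution t f) g =
      ∫ h, fieldAlong γ (heatSeries t) (h⁻¹ * g) * (f h - c) ∂haar := by
  have hheat := isSmooth_heatSeries ht
  have hcont : Continuous fun h => fieldAlong γ (heatSeries t) (h⁻¹ * g) :=
    (hheat.fieldAlong hd).continuous.comp (continuous_inv.mul continuous_const)
  have hint : Integrable (fun h => fieldAlong γ (heatSeries t) (h⁻¹ * g) * f h) haar :=
    integrable_of_continuous (hcont.mul hf)
  simp only [mul_sub]
  rw [integral_sub hint ((integrable_of_continuous hcont).mul_const c), integral_mul_const,
    integral_comp_inv_mul haar, integral_fieldAlong hd hheat, zero_mul, sub_zero]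
  exact fieldAlong_convolution hd hheat hf g

theorem carreDuChamp_heatConvolution_le (ht : 0 < t) {f : SU2 → ℝ} (hf : Continuous f) (g : SU2) :
    carreDuChamp (heatConvolution t f) (heatConvolution t f) g ≤
      gradConst t * ((∫ h, f h ^ 2 ∂haar) - (∫ h, f h ∂haar) ^ 2) := by
  have hheat := isSmooth_heatSeries ht
  have hmap : Continuous fun h : SU2 => h⁻¹ * g := continuous_inv.mul continuous_const
  have hvar : ∫ h, (f h - ∫ h, f h ∂haar) ^ 2 ∂haar =
      (∫ h, f h ^ 2 ∂haar) - (∫ h, f h ∂haar) ^ 2 :=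
    (ProbabilityTheory.variance_eq_integral hf.aemeasurable).symm.trans
      (ProbabilityTheory.variance_eq_sub (memLp_of_continuous hf 2))
  rw [carreDuChamp_self (isSmooth_heatConvolution ht hf), ← hvar, fieldX_eq_fieldAlong,
    fieldY_eq_fieldAlong,
    fieldAlong_heatConvolution isDirection_expX ht hf g (∫ h, f h ∂haar),
    fieldAlong_heatConvolution isDirection_expY ht hf g (∫ h, f h ∂haar)]
  refine sq_integral_mul_add_sq_integral_mul_le
    (memLp_of_continuous (hheat.fieldX.continuous.comp hmap) 2)
    (memLp_of_continuous (hheat.fieldY.continuous.comp hmap) 2)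
    (memLp_of_continuous (hf.sub continuous_const) 2) (gradConst_pos ht) ?_ ?_ ?_
  · exact (integral_comp_inv_mul haar (fun h => fieldX (heatSeries t) h ^ 2) g).trans
      (integral_fieldX_sq_heatSeries ht)
  · exact (integral_comp_inv_mul haar (fun h => fieldY (heatSeries t) h ^ 2) g).trans
      ((integral_fieldY_sq_heatSeries t).trans (integral_fieldX_sq_heatSeries ht))
  · exact (integral_comp_inv_mul haar
      (fun h => fieldX (heatSeries t) h * fieldY (heatSeries t) h) g).trans
      (integral_fieldX_mul_fieldY_heatSeries t)

/-! ### The constant of the gradient bound -/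

theorem eigenvalue_one_zero : eigenvalue (1, 0) = 2 := by simp [eigenvalue]

theorem eigenvalue_zero_one : eigenvalue (0, 1) = 2 := by simp [eigenvalue]

theorem gradConst_strictAntiOn : StrictAntiOn gradConst (Set.Ioi 0) := by
  intro s hs t ht hst
  rw [gradConst_eq_tsum hs, gradConst_eq_tsum ht]
  refine div_lt_div_of_pos_right ?_ two_pos
  refine Summable.tsum_lt_tsum (i := (1, 0)) (fun i => ?_) ?_ (summable_gradTerm ht)
    (summable_gradTerm hs)
  · exact mul_le_mul_of_nonneg_left (heatCoeff_anti (by linarith) i) (eigenvalue_nonneg i)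
  · rw [gradTerm, gradTerm, heatCoeff, heatCoeff, eigenvalue_one_zero]
    refine mul_lt_mul_of_pos_left (mul_lt_mul_of_pos_left ?_ (dimension_pos _)) two_pos
    exact Real.exp_lt_exp.2 (by linarith)

/-! ### Large time -/

theorem eq_or_four_le_eigenvalue (i : ℕ × ℕ) :
    i = (0, 0) ∨ i = (1, 0) ∨ i = (0, 1) ∨ 4 ≤ eigenvalue i := by
  obtain ⟨p, s⟩ := i
  rcases Nat.lt_or_ge (p + s) 2 with hlt | hge
  · have hsmall : (p = 0 ∧ s = 0) ∨ (p = 1 ∧ s = 0) ∨ (p = 0 ∧ s = 1) := by omega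
    rcases hsmall with ⟨rfl, rfl⟩ | ⟨rfl, rfl⟩ | ⟨rfl, rfl⟩ <;> simp
  · have hge' : (2 : ℝ) ≤ p + s := by exact_mod_cast hge
    exact .inr (.inr (.inr (by linarith [two_mul_le_eigenvalue (p, s)])))

theorem gradTerm_mul_exp (t : ℝ) (i : ℕ × ℕ) : gradTerm t i * Real.exp (4 * t) =
    eigenvalue i * dimension i * Real.exp (-(2 * t * (eigenvalue i - 2))) := by
  rw [gradTerm, heatCoeff, mul_assoc, mul_assoc, ← Real.exp_add, mul_assoc]
  ring_nf

theorem tendsto_gradTerm_mul_exp (i : ℕ × ℕ) :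
    Tendsto (fun t => gradTerm t i * Real.exp (4 * t)) atTop
      (𝓝 (if i ∈ ({(1, 0), (0, 1)} : Finset (ℕ × ℕ)) then 4 else 0)) := by
  simp only [gradTerm_mul_exp]
  rcases eq_or_four_le_eigenvalue i with rfl | rfl | rfl | hfour
  · simp [eigenvalue]
  · norm_num [eigenvalue_one_zero, dimension]
  · norm_num [eigenvalue_zero_one, dimension]
  · rw [if_neg]
    · rw [← mul_zero (eigenvalue i * dimension i)]
      refine (Real.tendsto_exp_neg_atTop_nhds_zero.comp ?_).const_mul _
      exact (tendsto_id.const_mul_atTop two_pos).atTop_mul_const (by linarith)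
    · intro hi
      simp only [Finset.mem_insert, Finset.mem_singleton] at hi
      rcases hi with rfl | rfl <;> norm_num [eigenvalue] at hfour

theorem gradTerm_mul_exp_le (ht : 1 ≤ t) (i : ℕ × ℕ) :
    gradTerm t i * Real.exp (4 * t) ≤ gradTerm 1 i * Real.exp (4 * 1) := by
  rw [gradTerm_mul_exp, gradTerm_mul_exp]
  rcases eq_or_four_le_eigenvalue i with rfl | hi
  · simp [eigenvalue]
  · have htwo : 2 ≤ eigenvalue i := by
      rcases hi with rfl | rfl | hfour
      · exact eigenvalue_one_zero.ge
      · exact eigenvalue_zero_one.ge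
      · linarith
    refine mul_le_mul_of_nonneg_left (Real.exp_le_exp.2 ?_)
      (mul_nonneg (eigenvalue_nonneg i) (dimension_pos i).le)
    nlinarith

theorem tendsto_gradConst_mul_exp :
    Tendsto (fun t => gradConst t * Real.exp (4 * t)) atTop (𝓝 4) := by
  have hlim : Tendsto (fun t => ∑' i, gradTerm t i * Real.exp (4 * t)) atTop
      (𝓝 (∑' i, if i ∈ ({(1, 0), (0, 1)} : Finset (ℕ × ℕ)) then (4 : ℝ) else 0)) := by
    refine tendsto_tsum_of_dominated_convergence
      ((summable_gradTerm one_pos).mul_right (Real.exp (4 * 1))) tendsto_gradTerm_mul_exp ?_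
    filter_upwards [eventually_ge_atTop 1] with t ht i
    rw [Real.norm_of_nonneg (mul_nonneg (gradTerm_nonneg t i) (Real.exp_pos _).le)]
    exact gradTerm_mul_exp_le ht i
  have hval : (∑' i, if i ∈ ({(1, 0), (0, 1)} : Finset (ℕ × ℕ)) then (4 : ℝ) else 0) / 2 = 4 := by
    rw [tsum_eq_sum (s := {(1, 0), (0, 1)}) fun i hi => if_neg hi,
      Finset.sum_congr rfl fun i hi => if_pos hi]
    norm_num
  refine (hval ▸ hlim.div_const 2).congr' ?_
  filter_upwards [eventually_gt_atTop 0] with t ht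
  rw [gradConst_eq_tsum ht, tsum_mul_right]
  ring

theorem gradConst_isEquivalent_atTop :
    gradConst ~[atTop] fun t : ℝ => 4 * Real.exp (-(4 * t)) := by
  rw [isEquivalent_iff_tendsto_one (Eventually.of_forall fun t => by positivity)]
  have hlim := tendsto_gradConst_mul_exp.div_const 4
  rw [div_self four_ne_zero] at hlim
  refine hlim.congr fun t => ?_
  simp only [Pi.div_apply]
  rw [Real.exp_neg]
  field_simp

end HeatKernel

/-! ### Small time -/

section OddSums

variable {w : ℝ}

/-- The closed form of `∑ (2 p + 1) exp (-w (2 p + 1))`, for `0 < w`. -/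
noncomputable def oddSum (w : ℝ) : ℝ := Real.cosh w / (2 * Real.sinh w ^ 2)

/-- The closed form of `∑ (2 p + 1)² exp (-w (2 p + 1))`, for `0 < w`. -/
noncomputable def oddSqSum (w : ℝ) : ℝ := (2 + Real.sinh w ^ 2) / (2 * Real.sinh w ^ 3)

theorem cosh_eq_exp_neg_add_sinh (w : ℝ) : Real.cosh w = Real.exp (-w) + Real.sinh w := by
  rw [← Real.cosh_sub_sinh, sub_add_cancel]

theorem exp_neg_mul_exp_neg_add (w : ℝ) :
    Real.exp (-w) * (Real.exp (-w) + 2 * Real.sinh w) = 1 := by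
  rw [← Real.cosh_sub_sinh]
  linear_combination Real.cosh_sq w

theorem one_sub_exp_neg_two_mul (w : ℝ) :
    1 - Real.exp (-(2 * w)) = 2 * Real.exp (-w) * Real.sinh w := by
  have hsq : Real.exp (-(2 * w)) = Real.exp (-w) ^ 2 := by
    rw [← Real.exp_nat_mul, Nat.cast_ofNat, mul_neg]
  rw [hsq]
  linear_combination -exp_neg_mul_exp_neg_add w

theorem exp_neg_mul_odd (w : ℝ) (p : ℕ) :
    Real.exp (-(w * (2 * p + 1))) = Real.exp (-w) * Real.exp (-(2 * w)) ^ p := by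
  rw [← Real.exp_nat_mul, ← Real.exp_add]
  ring_nf

theorem norm_exp_neg_two_mul_lt_one (hw : 0 < w) : ‖Real.exp (-(2 * w))‖ < 1 := by
  rw [Real.norm_of_nonneg (Real.exp_pos _).le, Real.exp_lt_one_iff]
  linarith

theorem hasSum_odd_mul_exp (hw : 0 < w) :
    HasSum (fun p : ℕ => (2 * p + 1 : ℝ) * Real.exp (-(w * (2 * p + 1)))) (oddSum w) := by
  have hnorm := norm_exp_neg_two_mul_lt_one hw
  -- `2 p + 1 = 2 * (p + 1).choose 1 - 1`
  have hsum := (((hasSum_choose_mul_geometric_of_norm_lt_one 1 hnorm).mul_left 2).sub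
    (hasSum_geometric_of_norm_lt_one hnorm)).mul_left (Real.exp (-w))
  have hsinh : Real.sinh w ≠ 0 := (Real.sinh_pos_iff.2 hw).ne'
  have hexp : Real.exp (-w) ≠ 0 := (Real.exp_pos _).ne'
  have hrel := exp_neg_mul_exp_neg_add w
  convert! hsum using 1
  · funext p
    rw [Nat.choose_one_right, exp_neg_mul_odd]
    push_cast
    ring
  · rw [one_sub_exp_neg_two_mul, oddSum, cosh_eq_exp_neg_add_sinh]
    generalize Real.exp (-w) = y at *
    generalize Real.sinh w = D at *
    field_simp
    linear_combination (4 * y * D ^ 2) * hrel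

theorem hasSum_odd_sq_mul_exp (hw : 0 < w) :
    HasSum (fun p : ℕ => (2 * p + 1 : ℝ) ^ 2 * Real.exp (-(w * (2 * p + 1)))) (oddSqSum w) := by
  have hnorm := norm_exp_neg_two_mul_lt_one hw
  -- `(2 p + 1) ^ 2 = 8 * (p + 2).choose 2 - 8 * (p + 1).choose 1 + 1`
  have hsum := ((((hasSum_choose_mul_geometric_of_norm_lt_one 2 hnorm).mul_left 8).sub
    ((hasSum_choose_mul_geometric_of_norm_lt_one 1 hnorm).mul_left 8)).add
    (hasSum_geometric_of_norm_lt_one hnorm)).mul_left (Real.exp (-w))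
  have hsinh : Real.sinh w ≠ 0 := (Real.sinh_pos_iff.2 hw).ne'
  have hexp : Real.exp (-w) ≠ 0 := (Real.exp_pos _).ne'
  have hrel := exp_neg_mul_exp_neg_add w
  convert! hsum using 1
  · funext p
    rw [Nat.choose_one_right, Nat.cast_choose_two, exp_neg_mul_odd]
    push_cast
    ring
  · rw [one_sub_exp_neg_two_mul, oddSqSum]
    generalize Real.exp (-w) = y at *
    generalize Real.sinh w = D at *
    field_simp
    linear_combination (64 * D ^ 5 * y ^ 3) * hrel

theorem cube_div_six_le_sinh (hw : 0 ≤ w) : w ^ 3 / 6 ≤ Real.sinh w := by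
  have hterm := le_hasSum (Real.hasSum_sinh w) 1 fun i _ => by positivity
  norm_num [Nat.factorial] at hterm
  linarith

theorem tendsto_div_sinh : Tendsto (fun w => w / Real.sinh w) (𝓝[>] 0) (𝓝 1) := by
  have hslope : Tendsto (fun w : ℝ => w⁻¹ * Real.sinh w) (𝓝[>] 0) (𝓝 1) := by
    simpa using (Real.hasDerivAt_sinh 0).tendsto_slope_zero_right
  refine (inv_one (G := ℝ) ▸ hslope.inv₀ one_ne_zero).congr fun w => ?_
  rw [mul_inv, inv_inv, div_eq_mul_inv]

theorem tendsto_sq_mul_oddSum : Tendsto (fun w => w ^ 2 * oddSum w) (𝓝[>] 0) (𝓝 (1 / 2)) := by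
  have hcosh : Tendsto Real.cosh (𝓝[>] 0) (𝓝 1) :=
    Real.cosh_zero ▸ (Real.continuous_cosh.tendsto 0).mono_left nhdsWithin_le_nhds
  have hlim := ((tendsto_div_sinh.pow 2).mul hcosh).div_const 2
  rw [one_pow, one_mul] at hlim
  refine hlim.congr fun w => ?_
  rw [oddSum]
  ring

theorem tendsto_cube_mul_oddSqSum : Tendsto (fun w => w ^ 3 * oddSqSum w) (𝓝[>] 0) (𝓝 1) := by
  have hsinh : Tendsto Real.sinh (𝓝[>] 0) (𝓝 0) := by
    simpa using (Real.continuous_sinh.tendsto 0).mono_left nhdsWithin_le_nhds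
  have hlim := ((tendsto_div_sinh.pow 3).mul ((hsinh.pow 2).const_add 2)).div_const 2
  norm_num at hlim
  refine hlim.congr fun w => ?_
  rw [oddSqSum]
  ring

theorem oddSum_nonneg (w : ℝ) : 0 ≤ oddSum w :=
  div_nonneg (Real.cosh_pos w).le (by positivity)

theorem oddSqSum_nonneg (hw : 0 < w) : 0 ≤ oddSqSum w :=
  div_nonneg (by positivity) (mul_pos two_pos (pow_pos (Real.sinh_pos_iff.2 hw) 3)).le

theorem sq_mul_oddSum_le (hw : 0 < w) : w ^ 2 * oddSum w ≤ 3 := by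
  have hle : w ≤ Real.sinh w := Real.self_le_sinh_iff.2 hw.le
  have hcube := cube_div_six_le_sinh hw.le
  have hsinh := hw.trans_le hle
  have hcosh : Real.cosh w ≤ 1 + Real.sinh w := by
    rw [cosh_eq_exp_neg_add_sinh]
    gcongr
    exact Real.exp_le_one_iff.2 (by linarith)
  have hsq : w ^ 2 ≤ 4 * Real.sinh w := by nlinarith [sq_nonneg (w - 1)]
  rw [oddSum, mul_div_assoc', div_le_iff₀ (by positivity)]
  nlinarith [mul_le_mul_of_nonneg_left hcosh (sq_nonneg w),
    mul_le_mul_of_nonneg_right hsq hsinh.le, pow_le_pow_left₀ hw.le hle 2]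

theorem cube_mul_oddSqSum_le (hw : 0 < w) : w ^ 3 * oddSqSum w ≤ 4 := by
  have hle : w ≤ Real.sinh w := Real.self_le_sinh_iff.2 hw.le
  have hcube := cube_div_six_le_sinh hw.le
  have hsinh := pow_pos (hw.trans_le hle) 3
  rw [oddSqSum, mul_div_assoc', div_le_iff₀ (mul_pos two_pos hsinh)]
  nlinarith [pow_le_pow_left₀ hw.le hle 3,
    mul_le_mul_of_nonneg_right hcube (sq_nonneg (Real.sinh w))]

end OddSums

section RowSums

variable {t : ℝ}

/-- The sum over `p` of `(2 p + 1) λ exp (-2 t λ)`, where `λ = (2 s + 1) (2 p + 1) - 1`. -/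
noncomputable def rowSum (t : ℝ) (s : ℕ) : ℝ :=
  Real.exp (2 * t) *
    ((2 * s + 1) * oddSqSum (2 * t * (2 * s + 1)) - oddSum (2 * t * (2 * s + 1)))

theorem hasSum_rowSum (ht : 0 < t) (s : ℕ) :
    HasSum (fun p : ℕ => (2 * p + 1 : ℝ) * eigenvalue (s, p) *
      Real.exp (-(2 * t * eigenvalue (s, p)))) (rowSum t s) := by
  have hw : 0 < 2 * t * (2 * s + 1) := by positivity
  have heigen (p : ℕ) : eigenvalue (s, p) = (2 * s + 1) * (2 * p + 1) - 1 := by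
    simp only [eigenvalue]
    ring
  refine ((((hasSum_odd_sq_mul_exp hw).mul_left (2 * s + 1 : ℝ)).sub
    (hasSum_odd_mul_exp hw)).mul_left (Real.exp (2 * t))).congr_fun fun p => ?_
  have hexp : Real.exp (-(2 * t * ((2 * s + 1) * (2 * p + 1) - 1))) =
      Real.exp (2 * t) * Real.exp (-(2 * t * (2 * s + 1) * (2 * p + 1))) := by
    rw [← Real.exp_add]
    ring_nf
  rw [heigen, hexp]
  ring

-- Both `eigenvalue` and `dimension` are symmetric in `(p, s)`, so the factor `p + s + 1` may be
-- replaced by `2 p + 1`, which makes the inner sum explicit.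
theorem tsum_gradTerm (ht : 0 < t) : ∑' i, gradTerm t i = ∑' s, rowSum t s := by
  set F : ℕ × ℕ → ℝ := fun i => (2 * i.2 + 1) * eigenvalue i * Real.exp (-(2 * t * eigenvalue i))
  have hsymm (i : ℕ × ℕ) : 2 * gradTerm t i = F i + F i.swap := by
    simp only [F, gradTerm, heatCoeff, dimension, eigenvalue_swap, Prod.snd_swap]
    ring
  have hnonneg (i : ℕ × ℕ) : 0 ≤ F i :=
    mul_nonneg (mul_nonneg (by positivity) (eigenvalue_nonneg i)) (Real.exp_pos _).le
  have hF : Summable F := ((summable_gradTerm ht).mul_left 2).of_nonneg_of_le hnonneg fun i => by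
    linarith [hsymm i, hnonneg i.swap]
  have hswap : Summable fun i : ℕ × ℕ => F i.swap := (Equiv.prodComm ℕ ℕ).summable_iff.2 hF
  have hdouble : 2 * ∑' i, gradTerm t i = 2 * ∑' i, F i := by
    rw [← tsum_mul_left, tsum_congr hsymm, hF.tsum_add hswap,
      show ∑' i : ℕ × ℕ, F i.swap = ∑' i, F i from (Equiv.prodComm ℕ ℕ).tsum_eq F, two_mul]
  rw [mul_left_cancel₀ two_ne_zero hdouble, hF.tsum_prod]
  exact tsum_congr fun s => (hasSum_rowSum ht s).tsum_eq

theorem cube_mul_rowSum (t : ℝ) (s : ℕ) : t ^ 3 * rowSum t s = Real.exp (2 * t) *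
    ((2 * t * (2 * s + 1)) ^ 3 * oddSqSum (2 * t * (2 * s + 1)) / 8 -
      t * ((2 * t * (2 * s + 1)) ^ 2 * oddSum (2 * t * (2 * s + 1))) / 4) / (2 * s + 1) ^ 2 := by
  have hne : (2 * s + 1 : ℝ) ≠ 0 := by positivity
  rw [rowSum]
  field_simp
  ring

theorem tendsto_cube_mul_rowSum (s : ℕ) :
    Tendsto (fun t => t ^ 3 * rowSum t s) (𝓝[>] 0) (𝓝 (1 / 8 / (2 * s + 1) ^ 2)) := by
  simp only [cube_mul_rowSum]
  have hw : Tendsto (fun t : ℝ => 2 * t * (2 * s + 1)) (𝓝[>] 0) (𝓝[>] 0) := by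
    refine tendsto_nhdsWithin_iff.2 ⟨?_, ?_⟩
    · have hcont : Continuous fun t : ℝ => 2 * t * (2 * s + 1) := by fun_prop
      simpa using (hcont.tendsto 0).mono_left nhdsWithin_le_nhds
    · filter_upwards [self_mem_nhdsWithin] with t (ht : 0 < t)
      exact mul_pos (mul_pos two_pos ht) (by positivity)
  have hexp : Tendsto (fun t : ℝ => Real.exp (2 * t)) (𝓝[>] 0) (𝓝 1) := by
    have hcont : Continuous fun t : ℝ => Real.exp (2 * t) := by fun_prop
    simpa using (hcont.tendsto 0).mono_left nhdsWithin_le_nhds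
  have hid : Tendsto (fun t : ℝ => t) (𝓝[>] 0) (𝓝 0) := tendsto_id.mono_left nhdsWithin_le_nhds
  simpa using (hexp.mul (((tendsto_cube_mul_oddSqSum.comp hw).div_const 8).sub
    ((hid.mul (tendsto_sq_mul_oddSum.comp hw)).div_const 4))).div_const ((2 * s + 1 : ℝ) ^ 2)

theorem norm_cube_mul_rowSum_le (ht : 0 < t) (ht1 : t ≤ 1) (s : ℕ) :
    ‖t ^ 3 * rowSum t s‖ ≤ Real.exp 2 * 2 * (1 / (2 * s + 1 : ℝ) ^ 2) := by
  rw [cube_mul_rowSum]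
  have hw : 0 < 2 * t * (2 * s + 1) := by positivity
  generalize 2 * t * (2 * (s : ℝ) + 1) = w at hw ⊢
  have hcube := cube_mul_oddSqSum_le hw
  have hcube_nonneg := mul_nonneg (pow_pos hw 3).le (oddSqSum_nonneg hw)
  have hsq_nonneg := mul_nonneg (sq_nonneg w) (oddSum_nonneg w)
  have htsq := mul_le_mul ht1 (sq_mul_oddSum_le hw) hsq_nonneg zero_le_one
  have htsq_nonneg := mul_nonneg ht.le hsq_nonneg
  rw [norm_div, norm_mul, Real.norm_of_nonneg (Real.exp_pos _).le,
    Real.norm_of_nonneg (by positivity : (0 : ℝ) ≤ (2 * s + 1) ^ 2), ← mul_one_div]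
  gcongr
  · linarith
  · rw [Real.norm_eq_abs, abs_le]
    constructor <;> linarith

theorem hasSum_one_div_odd_sq :
    HasSum (fun s : ℕ => 1 / (2 * s + 1 : ℝ) ^ 2) (Real.pi ^ 2 / 8) := by
  set f : ℕ → ℝ := fun n => 1 / (n : ℝ) ^ 2 with hf
  have hzeta : HasSum f (Real.pi ^ 2 / 6) := hasSum_zeta_two
  have heven : HasSum (fun n => f (2 * n)) (1 / 4 * (Real.pi ^ 2 / 6)) := by
    refine (hzeta.mul_left (1 / 4)).congr_fun fun n => ?_
    simp only [hf]
    push_cast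
    ring
  have hodd : Summable fun n => f (2 * n + 1) :=
    hzeta.summable.comp_injective (i := fun n : ℕ => 2 * n + 1) fun a b hab => by
      simp only at hab
      omega
  have hsplit := (heven.even_add_odd hodd.hasSum).unique hzeta
  have hval : ∑' n, f (2 * n + 1) = Real.pi ^ 2 / 8 := by linarith
  rw [← hval]
  simpa [hf] using hodd.hasSum

theorem tendsto_cube_mul_gradConst :
    Tendsto (fun t => t ^ 3 * gradConst t) (𝓝[>] 0) (𝓝 (Real.pi ^ 2 / 128)) := by
  have hlim : Tendsto (fun t => ∑' s, t ^ 3 * rowSum t s) (𝓝[>] 0)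
      (𝓝 (∑' s : ℕ, 1 / 8 / (2 * s + 1 : ℝ) ^ 2)) := by
    refine tendsto_tsum_of_dominated_convergence
      (hasSum_one_div_odd_sq.summable.mul_left (Real.exp 2 * 2)) tendsto_cube_mul_rowSum ?_
    filter_upwards [Ioc_mem_nhdsGT (zero_lt_one (α := ℝ))] with t ht s
    exact norm_cube_mul_rowSum_le ht.1 ht.2 s
  have hval : (∑' s : ℕ, 1 / 8 / (2 * s + 1 : ℝ) ^ 2) / 2 = Real.pi ^ 2 / 128 := by
    rw [tsum_congr fun s : ℕ => (mul_one_div (1 / 8 : ℝ) ((2 * s + 1 : ℝ) ^ 2)).symm,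
      tsum_mul_left, hasSum_one_div_odd_sq.tsum_eq]
    ring
  refine (hval ▸ hlim.div_const 2).congr' ?_
  filter_upwards [self_mem_nhdsWithin] with t ht
  rw [gradConst_eq_tsum ht, tsum_gradTerm ht, tsum_mul_left]
  ring

theorem gradConst_isEquivalent_zero :
    gradConst ~[𝓝[>] 0] fun t : ℝ => Real.pi ^ 2 / (128 * t ^ 3) := by
  have hne : ∀ᶠ t : ℝ in 𝓝[>] 0, Real.pi ^ 2 / (128 * t ^ 3) ≠ 0 := by
    filter_upwards [self_mem_nhdsWithin] with t (ht : 0 < t)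
    positivity
  rw [isEquivalent_iff_tendsto_one hne]
  have hlim := tendsto_cube_mul_gradConst.div_const (Real.pi ^ 2 / 128)
  rw [div_self (by positivity)] at hlim
  refine hlim.congr' ?_
  filter_upwards [self_mem_nhdsWithin] with t (ht : 0 < t)
  simp only [Pi.div_apply]
  field_simp

end RowSums

end SubellipticSU2

open SubellipticSU2 in
theorem mainTheorem8_general :
    (∀ f : SU2 → ℝ, Continuous f →
      IsHeatSolution f (fun t => heatSemigroup t f) ∧
      ∀ u : ℝ → SU2 → ℝ, IsHeatSolution f u → ∀ t : ℝ, 0 ≤ t → u t = heatSemigroup t f) ∧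
    (∀ t : ℝ, 0 < t →
      IsHeatKernel t (heatKernel t) ∧ ∀ p : SU2 → ℝ, IsHeatKernel t p → p = heatKernel t) ∧
    (∀ t : ℝ, 0 < t → DifferentiableAt ℝ (fun s : ℝ => ∫ g, heatKernel s g ^ 2 ∂haar) t) ∧
    (∀ f : SU2 → ℝ, Continuous f → ∀ t : ℝ, 0 < t → ∀ g : SU2,
      carreDuChamp (heatSemigroup t f) (heatSemigroup t f) g ≤
        gradConst t * ((∫ h, f h ^ 2 ∂haar) - (∫ h, f h ∂haar) ^ 2)) ∧
    StrictAntiOn gradConst (Set.Ioi 0) ∧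
    (gradConst ~[𝓝[>] 0] fun t : ℝ => Real.pi ^ 2 / (128 * t ^ 3)) ∧
    gradConst ~[atTop] fun t : ℝ => 4 * Real.exp (-(4 * t)) := by
  refine ⟨fun f hf => ?_, fun t ht => ?_, fun t ht => ?_, fun f hf t ht g => ?_,
    gradConst_strictAntiOn, gradConst_isEquivalent_zero, gradConst_isEquivalent_atTop⟩
  · have hsol := isHeatSolution_heatSemigroup hf
    exact ⟨hsol, fun u hu t ht => hu.unique hsol ht⟩
  · have hker := isHeatKernel_heatKernel ht
    exact ⟨hker, fun p hp => hp.unique hker⟩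
  · exact (hasDerivAt_integral_heatKernel_sq ht).differentiableAt
  · rw [heatSemigroup_eq_heatConvolution hf ht]
    exact carreDuChamp_heatConvolution_le ht hf g

theorem mainTheorem8 :
    (∀ f : SubellipticSU2.SU2 → ℝ, SubellipticSU2.IsSmooth f →
      SubellipticSU2.IsHeatSolution f (fun t => SubellipticSU2.heatSemigroup t f) ∧
      ∀ u : ℝ → SubellipticSU2.SU2 → ℝ, SubellipticSU2.IsHeatSolution f u →
        ∀ t : ℝ, 0 ≤ t → u t = SubellipticSU2.heatSemigroup t f) ∧
    (∀ t : ℝ, 0 < t →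
      SubellipticSU2.IsHeatKernel t (SubellipticSU2.heatKernel t) ∧
      ∀ p : SubellipticSU2.SU2 → ℝ, SubellipticSU2.IsHeatKernel t p →
        p = SubellipticSU2.heatKernel t) ∧
    (∀ t : ℝ, 0 < t →
      DifferentiableAt ℝ
        (fun s : ℝ => ∫ g, SubellipticSU2.heatKernel s g ^ 2 ∂SubellipticSU2.haar) t) ∧
    (∀ f : SubellipticSU2.SU2 → ℝ, SubellipticSU2.IsSmooth f →
      ∀ t : ℝ, 0 < t → ∀ g : SubellipticSU2.SU2,
        SubellipticSU2.carreDuChamp (SubellipticSU2.heatSemigroup t f)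
            (SubellipticSU2.heatSemigroup t f) g ≤
          SubellipticSU2.gradConst t *
            ((∫ h, f h ^ 2 ∂SubellipticSU2.haar) - (∫ h, f h ∂SubellipticSU2.haar) ^ 2)) ∧
    StrictAntiOn SubellipticSU2.gradConst (Set.Ioi 0) ∧
    Asymptotics.IsEquivalent (𝓝[>] 0) SubellipticSU2.gradConst
      (fun t : ℝ => Real.pi ^ 2 / (128 * t ^ 3)) ∧
    Asymptotics.IsEquivalent atTop SubellipticSU2.gradConst
      (fun t : ℝ => 4 * Real.exp (-(4 * t))) :=
  let ⟨cauchy, kernel, diff, bound, asymptotics⟩ := mainTheorem8_general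
  ⟨fun f hf => cauchy f hf.continuous, kernel, diff, fun f hf => bound f hf.continuous, asymptotics⟩
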